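/- **Theorem (convergence rates under the discrepancy principle).** Let $\Omega\subset\mathbb R^3$ be a bounded Lipschitz domain, $1<p<3/2$, and let $l,h:\mathbb R^3\to[0,\infty)$ be bounded measurable functions. Let $L:L^p(\Omega)\to L^2(\Omega)$ be the forward operator $$Lu(x,y,z)=\iiint l(s,t,w)\,u(s,t,w-z)\,h(x-s,y-t,w)\,ds\,dt\,dw$$ ($u$ is extended by $0$ outside $\Omega$). Put $\mathrm{TV}(u)=\sup\{\int_\Omega u\,\mathrm{div}\,\xi\,dx:\xi\in C_c^\infty(\Omega,\mathbb R^3),\ |\xi|\le1\}\in[0,\infty]$ and, for $g\in L^1(\Omega)$ and $f\in L^2(\Omega)$, $$\Phi(g,f)=\inf_{v\in L^2(\Omega),\,v\ge0}\Big\{\tfrac12\|f-v\|_{L^2}^2+D_{KL}(v,g)\Big\},$$ where $D_{KL}(v,g)=\int_\Omega\big(g-v+v\log\frac vg\big)dx$ if $v,g\ge0$ a.e. and $\int_\Omega v\,dx=\int_\Omega g\,dx=1$, and $D_{KL}(v,g)=+\infty$ otherwise (with $0\log\frac0b=0$ for $b\ge0$ and $a\log\frac a0=+\infty$ for $a>0$).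 Let $\bar f\in L^2(\Omega)$ with $\int_\Omega\bar f\,dx=1$, and let $u^\dagger_{TV}\in L^p(\Omega)$, $u^\dagger_{TV}\ge0$ a.e., be a TV-minimising solution of $Lu=\bar f$, i.e. $Lu^\dagger_{TV}=\bar f$ and $\mathrm{TV}(u^\dagger_{TV})\le\mathrm{TV}(u)$ whenever $Lu=\bar f$. Assume the source condition: there is $\mu^\dagger\in L^\infty(\Omega)$ such that $q^\dagger:=L^*\mu^\dagger\in\partial\mathrm{TV}(u^\dagger_{TV})$, where $\langle L^*\mu^\dagger,u\rangle=\int_\Omega\mu^\dagger\,Lu\,dx$ and TV is regarded as a functional on $L^p(\Omega)$. Let $\tau>1$. Then there is a constant $C$, independent of $\sigma_G$, $\gamma$ and the noisy data, such that the following holds for all $\sigma_G,\gamma>0$, with $\delta=\frac{\sigma_G^2}2+\gamma$, and all $f\in L^2(\Omega)$ with $\Phi(\bar f,f)\le\delta$ (in particular, for all $f=\bar z+w$ with $\bar z,w\in L^2(\Omega)$, $\bar z\ge0$, $D_{KL}(\bar z,\bar f)\le\gamma$, $\|w\|_{L^2}\le\sigma_G$). If the real number $\alpha$ is given by the discrepancy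 principle $$\alpha=\sup\{\beta>0:\ \Phi(Lu^\beta,f)\le\tau\delta\},$$ where $u^\beta$ denotes a minimiser of $u\mapsto\Phi(Lu,f)+\beta\,\mathrm{TV}(u)$ over $\{u\in L^p(\Omega):u\ge0\text{ a.e.}\}$, and if $u_{\sigma_G,\gamma}$ is such a minimiser for $\beta=\alpha$, then $$D^{q^\dagger}_{TV}(u_{\sigma_G,\gamma},u^\dagger_{TV})=\mathrm{TV}(u_{\sigma_G,\gamma})-\mathrm{TV}(u^\dagger_{TV})-\langle q^\dagger,u_{\sigma_G,\gamma}-u^\dagger_{TV}\rangle\le C\,(\sigma_G+\sqrt\gamma).$$ -/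

import Mathlib

open MeasureTheory
open scoped ENNReal Topology

noncomputable section

/-- Three-dimensional Euclidean space. -/
abbrev E3 : Type := EuclideanSpace ℝ (Fin 3)

/-- `Ω` is a bounded Lipschitz domain: a bounded, open, connected, non-empty set which, near each of
its boundary points and after a rigid change of coordinates, is the region strictly below
the graph of a Lipschitz function of the first two coordinates. -/
structure IsBoundedLipschitzDomain (Ω : Set E3) : Prop where
  isOpen : IsOpen Ω
  isConnected : IsConnected Ω
  isBounded : Bornology.IsBounded Ω
  lipschitz_boundary : ∀ x ∈ frontier Ω, ∃ (e : E3 ≃ₗᵢ[ℝ] E3) (φ : EuclideanSpace ℝ (Fin 2) → ℝ)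
    (κ : NNReal), LipschitzWith κ φ ∧
      ∀ᶠ y in 𝓝 x, (y ∈ Ω ↔ e y 2 < φ !₂[e y 0, e y 1])

/-- Lebesgue measure on `Ω`. -/
abbrev volOn (Ω : Set E3) : Measure E3 := volume.restrict Ω

theorem IsBoundedLipschitzDomain.isFiniteMeasure {Ω : Set E3} (hΩ : IsBoundedLipschitzDomain Ω) :
    IsFiniteMeasure (volOn Ω) :=
  ⟨by simpa using hΩ.isBounded.measure_lt_top⟩

/-! ### The light-sheet forward operator -/

/-- The two point spread functions of the microscope: the light-sheet `l` and the detection PSF `h`,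
non-negative, bounded and measurable. -/
structure LightSheetKernels where
  l : E3 → ℝ
  h : E3 → ℝ
  measurable_l : Measurable l
  measurable_h : Measurable h
  l_nonneg : ∀ x, 0 ≤ l x
  h_nonneg : ∀ x, 0 ≤ h x
  l_bounded : ∃ C, ∀ x, l x ≤ C
  h_bounded : ∃ C, ∀ x, h x ≤ C

/-- The light-sheet image of a density `u` living on `Ω` (and vanishing outside `Ω`):
`(x, y, z) ↦ ∭ l (s, t, w) u (s, t, w - z) h (x - s, y - t, w) ds dt dw`. -/
def lightSheet (K : LightSheetKernels) (Ω : Set E3) (u : E3 → ℝ) (x : E3) : ℝ :=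
  ∫ s : E3, K.l s * Ω.indicator u !₂[s 0, s 1, s 2 - x 2] * K.h !₂[x 0 - s 0, x 1 - s 1, s 2]

/-- The kernel of the forward operator after the substitution `w' = w - z`. -/
def lightSheetKernel (K : LightSheetKernels) (x y : E3) : ℝ :=
  K.l !₂[y 0, y 1, y 2 + x 2] * K.h !₂[x 0 - y 0, x 1 - y 1, y 2 + x 2]

theorem lightSheet_eq (K : LightSheetKernels) {Ω : Set E3} (hΩ : MeasurableSet Ω) (u : E3 → ℝ)
    (x : E3) : lightSheet K Ω u x = ∫ y, lightSheetKernel K x y * u y ∂(volOn Ω) := by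
  rw [lightSheet, ← integral_indicator hΩ,
    ← integral_add_right_eq_self _ (!₂[0, 0, x 2] : E3)]
  congr 1
  ext y
  have h1 : (!₂[y 0, y 1, y 2 + x 2] : E3) = y + !₂[0, 0, x 2] := by
    ext i; fin_cases i <;> simp
  have h2 : (!₂[y 0, y 1, y 2] : E3) = y := by
    ext i; fin_cases i <;> simp
  simp only [lightSheetKernel]
  by_cases hy : y ∈ Ω <;> simp [h2, hy]
  rw [← h1]
  ring

theorem measurable_lightSheetKernel (K : LightSheetKernels) :
    Measurable (Function.uncurry (lightSheetKernel K)) := by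
  unfold lightSheetKernel Function.uncurry
  refine (K.measurable_l.comp ?_).mul (K.measurable_h.comp ?_)
  · refine (WithLp.measurable_toLp 2 (Fin 3 → ℝ)).comp (measurable_pi_iff.2 fun i => ?_)
    fin_cases i <;> simp <;> fun_prop
  · refine (WithLp.measurable_toLp 2 (Fin 3 → ℝ)).comp (measurable_pi_iff.2 fun i => ?_)
    fin_cases i <;> simp <;> fun_prop

theorem exists_lightSheetKernel_bound (K : LightSheetKernels) :
    ∃ C, 0 ≤ C ∧ ∀ x y, ‖lightSheetKernel K x y‖ ≤ C := by
  obtain ⟨a, ha⟩ := K.l_bounded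
  obtain ⟨b, hb⟩ := K.h_bounded
  have ha0 : 0 ≤ a := (K.l_nonneg 0).trans (ha 0)
  have hb0 : 0 ≤ b := (K.h_nonneg 0).trans (hb 0)
  refine ⟨a * b, mul_nonneg ha0 hb0, fun x y => ?_⟩
  rw [lightSheetKernel, norm_mul, Real.norm_of_nonneg (K.l_nonneg _),
    Real.norm_of_nonneg (K.h_nonneg _)]
  exact mul_le_mul (ha _) (hb _) (K.h_nonneg _) ha0

theorem integrable_of_Lp {Ω : Set E3} (hΩ : IsBoundedLipschitzDomain Ω)
    {p : ℝ≥0∞} [hp : Fact (1 ≤ p)] (u : Lp ℝ p (volOn Ω)) : Integrable u (volOn Ω) :=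
  haveI := hΩ.isFiniteMeasure
  memLp_one_iff_integrable.1 ((Lp.memLp u).mono_exponent hp.out)

theorem integrable_lightSheetKernel_mul (K : LightSheetKernels) {Ω : Set E3}
    (hΩ : IsBoundedLipschitzDomain Ω) {p : ℝ≥0∞} [hp : Fact (1 ≤ p)] (u : Lp ℝ p (volOn Ω)) (x : E3) :
    Integrable (fun y => lightSheetKernel K x y * u y) (volOn Ω) := by
  obtain ⟨C, -, hC⟩ := exists_lightSheetKernel_bound K
  exact (integrable_of_Lp hΩ u).bdd_mul
    ((measurable_lightSheetKernel K).comp measurable_prodMk_left).aestronglyMeasurable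
    (Filter.Eventually.of_forall (hC x))

theorem norm_lightSheet_le (K : LightSheetKernels) {Ω : Set E3}
    (hΩ : IsBoundedLipschitzDomain Ω) {p : ℝ≥0∞} [hp : Fact (1 ≤ p)] {C : ℝ} (hC : ∀ x y, ‖lightSheetKernel K x y‖ ≤ C)
    (u : Lp ℝ p (volOn Ω)) (x : E3) :
    ‖lightSheet K Ω u x‖ ≤ C * ∫ y, ‖u y‖ ∂(volOn Ω) := by
  rw [lightSheet_eq K hΩ.isOpen.measurableSet, ← integral_const_mul]
  refine norm_integral_le_of_norm_le ((integrable_of_Lp hΩ u).norm.const_mul C)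
    (Filter.Eventually.of_forall fun y => ?_)
  rw [norm_mul]
  exact mul_le_mul_of_nonneg_right (hC x y) (norm_nonneg _)

theorem memLp_lightSheet (K : LightSheetKernels) {Ω : Set E3}
    (hΩ : IsBoundedLipschitzDomain Ω) {p : ℝ≥0∞} [hp : Fact (1 ≤ p)] (u : Lp ℝ p (volOn Ω)) :
    MemLp (lightSheet K Ω u) 2 (volOn Ω) := by
  have := hΩ.isFiniteMeasure
  obtain ⟨C, -, hC⟩ := exists_lightSheetKernel_bound K
  refine MemLp.of_bound ?_ _ (Filter.Eventually.of_forall (norm_lightSheet_le K hΩ hC u))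
  have : lightSheet K Ω u = fun x => ∫ y, lightSheetKernel K x y * u y ∂(volOn Ω) := by
    ext x; exact lightSheet_eq K hΩ.isOpen.measurableSet _ _
  rw [this]
  refine (StronglyMeasurable.integral_prod_right ?_).aestronglyMeasurable
  exact (measurable_lightSheetKernel K).stronglyMeasurable.mul
    ((Lp.stronglyMeasurable u).comp_measurable measurable_snd)

theorem exists_integral_norm_le {Ω : Set E3} (hΩ : IsBoundedLipschitzDomain Ω)
    {p : ℝ≥0∞} [hp : Fact (1 ≤ p)] :
    ∃ c, 0 ≤ c ∧ ∀ u : Lp ℝ p (volOn Ω), ∫ y, ‖u y‖ ∂(volOn Ω) ≤ c * ‖u‖ := by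
  have := hΩ.isFiniteMeasure
  have hne : volOn Ω Set.univ ^ (1 / (1 : ℝ≥0∞).toReal - 1 / p.toReal) ≠ ∞ := by
    refine ENNReal.rpow_ne_top_of_nonneg ?_ (measure_ne_top _ _)
    rcases eq_or_ne p ∞ with rfl | hpt
    · simp
    · have : 1 ≤ p.toReal := by
        simpa using (ENNReal.toReal_le_toReal ENNReal.one_ne_top hpt).2 hp.out
      simpa using inv_le_one_of_one_le₀ this
  refine ⟨(volOn Ω Set.univ ^ (1 / (1 : ℝ≥0∞).toReal - 1 / p.toReal)).toReal,
    ENNReal.toReal_nonneg, fun u => ?_⟩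
  rw [integral_norm_eq_lintegral_enorm (Lp.aestronglyMeasurable u),
    ← eLpNorm_one_eq_lintegral_enorm, Lp.norm_def, mul_comm, ← ENNReal.toReal_mul]
  exact ENNReal.toReal_mono (ENNReal.mul_ne_top (Lp.eLpNorm_ne_top u) hne)
    (eLpNorm_le_eLpNorm_mul_rpow_measure_univ hp.out (Lp.aestronglyMeasurable u))

/-- The forward operator `L : L^p(Ω) → L²(Ω)`, `L u = lightSheet u`, as a bounded linear map. -/
def forwardOperator (K : LightSheetKernels) {Ω : Set E3}
    (hΩ : IsBoundedLipschitzDomain Ω) {p : ℝ≥0∞} [hp : Fact (1 ≤ p)] :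
    Lp ℝ p (volOn Ω) →L[ℝ] Lp ℝ 2 (volOn Ω) :=
  LinearMap.mkContinuousOfExistsBound
    { toFun := fun u => (memLp_lightSheet K hΩ u).toLp
      map_add' := fun u v => by
        rw [← MemLp.toLp_add]
        refine MemLp.toLp_congr _ _ (Filter.Eventually.of_forall fun x => ?_)
        simp only [Pi.add_apply, lightSheet_eq K hΩ.isOpen.measurableSet]
        rw [← integral_add (integrable_lightSheetKernel_mul K hΩ u x)
          (integrable_lightSheetKernel_mul K hΩ v x)]
        refine integral_congr_ae ((Lp.coeFn_add u v).mono fun y hy => ?_)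
        simp only [hy, Pi.add_apply, mul_add]
      map_smul' := fun c u => by
        rw [RingHom.id_apply, ← MemLp.toLp_const_smul]
        refine MemLp.toLp_congr _ _ (Filter.Eventually.of_forall fun x => ?_)
        simp only [Pi.smul_apply, lightSheet_eq K hΩ.isOpen.measurableSet, smul_eq_mul]
        rw [← integral_const_mul]
        refine integral_congr_ae ((Lp.coeFn_smul c u).mono fun y hy => ?_)
        simp only [hy, Pi.smul_apply, smul_eq_mul]
        ring } <| by
    have := hΩ.isFiniteMeasure
    obtain ⟨C, hC0, hC⟩ := exists_lightSheetKernel_bound K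
    obtain ⟨c, hc0, hc⟩ := exists_integral_norm_le (p := p) hΩ
    refine ⟨(measureUnivNNReal (volOn Ω) : ℝ) ^ (2 : ℝ≥0∞).toReal⁻¹ * (C * c), fun u => ?_⟩
    refine (Lp.norm_le_of_ae_bound (C := C * (c * ‖u‖)) (by positivity) ?_).trans_eq (by
      ring)
    filter_upwards [(memLp_lightSheet K hΩ u).coeFn_toLp] with x hx
    simp only [LinearMap.coe_mk, AddHom.coe_mk, hx]
    exact (norm_lightSheet_le K hΩ hC u x).trans (mul_le_mul_of_nonneg_left (hc u) hC0)

theorem forwardOperator_apply_ae (K : LightSheetKernels) {Ω : Set E3}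
    (hΩ : IsBoundedLipschitzDomain Ω) {p : ℝ≥0∞} [hp : Fact (1 ≤ p)] (u : Lp ℝ p (volOn Ω)) :
    forwardOperator K hΩ u =ᵐ[volOn Ω] lightSheet K Ω u :=
  (memLp_lightSheet K hΩ u).coeFn_toLp

/-- For `m ∈ L^∞(Ω)` and a bounded operator `L : L^p(Ω) → L²(Ω)` (`Ω` of finite measure), the
element `L* m` of the dual of `L^p(Ω)`, that is `⟨L* m, u⟩ = ∫_Ω m (L u) dx`. -/
def adjointApply {Ω : Set E3} (hΩ : IsBoundedLipschitzDomain Ω) {p : ℝ≥0∞} [Fact (1 ≤ p)]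
    (L : Lp ℝ p (volOn Ω) →L[ℝ] Lp ℝ 2 (volOn Ω)) (m : Lp ℝ ∞ (volOn Ω)) :
    StrongDual ℝ (Lp ℝ p (volOn Ω)) :=
  haveI := hΩ.isFiniteMeasure
  (innerSL ℝ (((Lp.memLp m).mono_exponent (p := 2) le_top).toLp (m : E3 → ℝ))).comp L

theorem adjointApply_apply {Ω : Set E3} (hΩ : IsBoundedLipschitzDomain Ω) {p : ℝ≥0∞}
    [Fact (1 ≤ p)] (L : Lp ℝ p (volOn Ω) →L[ℝ] Lp ℝ 2 (volOn Ω)) (m : Lp ℝ ∞ (volOn Ω))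
    (u : Lp ℝ p (volOn Ω)) : adjointApply hΩ L m u = ∫ x, m x * L u x ∂(volOn Ω) := by
  have := hΩ.isFiniteMeasure
  simp only [adjointApply, ContinuousLinearMap.comp_apply, innerSL_apply_apply, L2.inner_def]
  refine integral_congr_ae ?_
  filter_upwards [((Lp.memLp m).mono_exponent (p := 2) le_top).coeFn_toLp] with x hx
  rw [hx]
  simp [mul_comm]

/-! ### Total variation, subdifferential, Bregman distance -/

/-- The divergence of a vector field on `ℝ³`. -/
def divergence (ξ : E3 → E3) (x : E3) : ℝ :=
  ∑ i : Fin 3, fderiv ℝ ξ x (EuclideanSpace.single i 1) i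

/-- The total variation of `u` on `Ω`: the supremum of `∫_Ω u div ξ` over the smooth vector fields
`ξ`, compactly supported in `Ω`, with `|ξ| ≤ 1`.  It is `∞` exactly when `u ∉ BV(Ω)`. -/
def totalVariation {Ω : Set E3} {p : ℝ≥0∞} (u : Lp ℝ p (volOn Ω)) : ℝ≥0∞ :=
  ⨆ (ξ : E3 → E3) (_ : ContDiff ℝ ((⊤ : ℕ∞) : WithTop ℕ∞) ξ) (_ : HasCompactSupport ξ) (_ : tsupport ξ ⊆ Ω)
    (_ : ∀ x, ‖ξ x‖ ≤ 1), ENNReal.ofReal (∫ x, u x * divergence ξ x ∂(volOn Ω))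

/-- The subdifferential at `y` of a functional `J : X → [0, ∞]` (it is empty where `J y = ∞`). -/
def subdifferential {X : Type*} [NormedAddCommGroup X] [NormedSpace ℝ X] (J : X → ℝ≥0∞) (y : X) :
    Set (StrongDual ℝ X) :=
  {q | J y ≠ ∞ ∧ ∀ x, (J y : EReal) + ((q (x - y) : ℝ) : EReal) ≤ (J x : EReal)}

/-- The generalised Bregman distance `D_J^q(x, y) = J x - J y - ⟨q, x - y⟩`, used for
`q ∈ subdifferential J y`. -/
def bregmanDist {X : Type*} [NormedAddCommGroup X] [NormedSpace ℝ X] (J : X → ℝ≥0∞)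
    (q : StrongDual ℝ X) (x y : X) : EReal :=
  (J x : EReal) - (J y : EReal) - ((q (x - y) : ℝ) : EReal)

/-! ### The infimal convolution fidelity -/

/-- The (non-negative) integrand `b - a + a log (a / b)` of the Kullback-Leibler divergence for
`a, b ≥ 0`, with the conventions `0 log (0 / b) = 0` and `a log (a / 0) = ∞` for `a > 0`. -/
def klIntegrand (a b : ℝ) : ℝ≥0∞ :=
  if b = 0 ∧ a ≠ 0 then ∞ else ENNReal.ofReal (b - a + a * Real.log (a / b))

open Classical in
/-- The Kullback-Leibler divergence `D_KL(v, g)`: it is infinite unless `v` and `g` are both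
non-negative with integral one. -/
def klDivergence (Ω : Set E3) (v g : E3 → ℝ) : ℝ≥0∞ :=
  if 0 ≤ᵐ[volOn Ω] v ∧ 0 ≤ᵐ[volOn Ω] g ∧ ∫ x, v x ∂(volOn Ω) = 1 ∧ ∫ x, g x ∂(volOn Ω) = 1 then
    ∫⁻ x, klIntegrand (v x) (g x) ∂(volOn Ω)
  else ∞

/-- The infimal convolution fidelity
`Φ(g, f) = inf { ½ ‖f - v‖² + D_KL(v, g) : v ∈ L²(Ω), v ≥ 0 }` of exact data `g` and measured
data `f ∈ L²(Ω)`. -/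
def fidelity {Ω : Set E3} (g : E3 → ℝ) (f : Lp ℝ 2 (volOn Ω)) : ℝ≥0∞ :=
  ⨅ (v : Lp ℝ 2 (volOn Ω)) (_ : 0 ≤ v),
    ENNReal.ofReal (1 / 2 * ‖f - v‖ ^ 2) + klDivergence Ω v g

/-- Data `f = z + w` produced by the mixed noise model (`z ≥ 0` the Poisson part with
`D_KL(z, g) ≤ γ`, and `w` the Gaussian part with `‖w‖ ≤ σ`) satisfy `Φ(g, f) ≤ σ²/2 + γ`. -/
theorem fidelity_le_of_noise {Ω : Set E3} {g : E3 → ℝ} {z w : Lp ℝ 2 (volOn Ω)} {σ γ : ℝ}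
    (hγ : 0 ≤ γ) (hz : 0 ≤ z) (hzg : klDivergence Ω z g ≤ ENNReal.ofReal γ) (hw : ‖w‖ ≤ σ) :
    fidelity g (z + w) ≤ ENNReal.ofReal (σ ^ 2 / 2 + γ) := by
  refine (iInf₂_le z hz).trans ?_
  rw [ENNReal.ofReal_add (by positivity) hγ]
  refine add_le_add (ENNReal.ofReal_le_ofReal ?_) hzg
  have := pow_le_pow_left₀ (norm_nonneg w) hw 2
  rw [add_sub_cancel_left]
  linarith

/-! ### Variational regularisation -/

section Regularisation

variable {Ω : Set E3} {p : ℝ≥0∞} [Fact (1 ≤ p)]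
  (L : Lp ℝ p (volOn Ω) →L[ℝ] Lp ℝ 2 (volOn Ω))

/-- `u` is a total-variation-minimising solution of `L u = g`. -/
def IsTVMinimisingSolution (g : Lp ℝ 2 (volOn Ω)) (u : Lp ℝ p (volOn Ω)) : Prop :=
  L u = g ∧ ∀ w : Lp ℝ p (volOn Ω), L w = g → totalVariation u ≤ totalVariation w

/-- `u` is a regularised solution: a minimiser of `Φ(L u, f) + α TV(u)` over `L^p_+(Ω)`. -/
def IsRegularisedSolution (f : Lp ℝ 2 (volOn Ω)) (α : ℝ) (u : Lp ℝ p (volOn Ω)) : Prop :=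
  0 ≤ u ∧ ∀ w : Lp ℝ p (volOn Ω), 0 ≤ w →
    fidelity (L u) f + ENNReal.ofReal α * totalVariation u ≤
      fidelity (L w) f + ENNReal.ofReal α * totalVariation w

/-- The discrepancy principle with threshold `t`: the real number `α` is the supremum of the
parameters `β > 0` for which the regularised solution `u^β` satisfies `Φ(L u^β, f) ≤ t`. -/
def IsDiscrepancyParameter (f : Lp ℝ 2 (volOn Ω)) (t : ℝ) (α : ℝ) : Prop :=
  IsLUB {β : ℝ | 0 < β ∧ ∃ u : Lp ℝ p (volOn Ω),
    IsRegularisedSolution L f β u ∧ fidelity (L u) f ≤ ENNReal.ofReal t} α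

end Regularisation

end

/-!
Write `δ = σ² / 2 + γ`, `Φ` for the fidelity and `TV` for the total variation. The fidelity
controls the `L¹` distance: by a Pinsker inequality for the Kullback–Leibler divergence,
`∫ |f - g| ≤ C √k` whenever `Φ(g, f) ≤ k` (`exists_integral_abs_sub_le_of_fidelity_le`). Since the
source element is `L* μ` with `μ` bounded, its pairing with `u - u†` is at most
`B (√Φ(L u, f) + √δ)` (`exists_abs_adjointApply_le`). Comparing a minimiser for the parameter `β`
with `u†`, and using the subgradient inequality, one gets `Φ(L u, f) ≤ δ + β B (√Φ(L u, f) + √δ)`;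
hence every minimiser for a parameter `β ≤ c √δ`, with `c` depending only on `B` and `τ`,
satisfies `Φ(L u, f) ≤ τ δ` (`discrepancy_le_of_le_sqrt`). If minimisers exist, the discrepancy
parameter therefore satisfies `α ≥ c √δ`. If moreover the given minimiser for `α` itself satisfies
`Φ(L u, f) ≤ τ δ`, the comparison with `u†` bounds `TV(u) - TV(u†)` by `δ / α ≤ √δ / c` and the
pairing by a multiple of `√δ`, which is the claimed rate because `√δ ≤ σ + √γ`.

So two facts of the calculus of variations are needed: minimisers exist for every `β > 0`
(`exists_isRegularisedSolution`), and the supremum defining `α` is attained, for each minimiser at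
`α` (`fidelity_le_of_isDiscrepancyParameter`). The latter holds because limits of minimisers for
`β ↑ α` are minimisers for `α`, and because all minimisers for one parameter have the same
fidelity: in the inner problem `v` is unique by strict convexity of the squared norm, and where
`v > 0` the divergence is strictly convex in its second argument, while on `{v = 0}` it is
determined by the mass (`fidelity_eq_of_isRegularisedSolution`).

Both rest on the direct method (`exists_splitEnergy_le`). Compact embeddings of `BV` are avoided:
since all the sets involved are convex, nearly minimising the strictly convex functional
`∫ exp (-u) + ‖v‖²` over decreasing sublevel sets makes `exp (-u / 2)` and `v` Cauchy in `L²`, and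
if `u` is bounded in `L^p`, `p > 1`, it converges almost everywhere and in `L¹`
(`exists_tendsto_of_antitone_midpoint`). What remains is boundedness in `L^p`. For `p < 3 / 2` it
is obtained by duality from the total variation: on a set from which a solid cone of directions
stays in `Ω`, a function `φ` is, up to a remainder, a multiple of the divergence of a field
bounded, as is the remainder, by the `L^q` norm of `φ`, where `q > 3` is the conjugate exponent
(`divergence_coneField`, `exists_integral_rpow_le_of_cone`); Lipschitz domains are covered by
finitely many such sets (`exists_norm_le_totalVariation_add`). The `L¹` norm is bounded by a
Poincaré inequality (`exists_integral_le_totalVariation_add`) in which the mean is replaced by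
`∫ L u`, which is `1` where the divergence is finite.
-/


open Filter

/-! ### Convergent representatives of decreasing convex sets -/

section Compactness

variable {X : Type*} [MeasurableSpace X] {μ : Measure X} {p : ℝ≥0∞}

theorem unifIntegrable_one_of_eLpNorm_le {ι : Type*} {f : ι → X → ℝ} (hp : 1 < p)
    (hf : ∀ n, AEStronglyMeasurable (f n) μ) {R : ℝ}
    (hR : ∀ n, eLpNorm (f n) p μ ≤ ENNReal.ofReal R) :
    UnifIntegrable f 1 μ := by
  intro ε hε
  have ha : 0 < 1 - 1 / p.toReal := by
    rcases eq_or_ne p ∞ with rfl | hpt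
    · simp
    · have : 1 < p.toReal := by
        simpa using (ENNReal.toReal_lt_toReal ENNReal.one_ne_top hpt).2 hp
      rw [sub_pos, div_lt_one (by linarith)]
      exact this
  set a := 1 - 1 / p.toReal with ha'
  set R' := max R 0 + 1 with hR'
  have hR'0 : 0 < R' := by positivity
  refine ⟨(ε / R') ^ (1 / a), by positivity, fun i s hs hμ => ?_⟩
  rw [eLpNorm_indicator_eq_eLpNorm_restrict hs]
  refine (eLpNorm_le_eLpNorm_mul_rpow_measure_univ hp.le (hf i).restrict).trans ?_
  have h1 : eLpNorm (f i) p (μ.restrict s) ≤ ENNReal.ofReal R' :=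
    (eLpNorm_mono_measure _ Measure.restrict_le_self).trans <| (hR i).trans <|
      ENNReal.ofReal_le_ofReal (by rw [hR']; linarith [le_max_left R 0])
  have h2 : (μ.restrict s) Set.univ ^ (1 / (1 : ℝ≥0∞).toReal - 1 / p.toReal)
      ≤ ENNReal.ofReal (ε / R') := by
    rw [Measure.restrict_apply_univ, ENNReal.toReal_one, div_one, ← ha']
    refine (ENNReal.rpow_le_rpow hμ ha.le).trans_eq ?_
    rw [ENNReal.ofReal_rpow_of_pos (by positivity), ← Real.rpow_mul (by positivity),
      one_div_mul_cancel ha.ne', Real.rpow_one]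
  refine (mul_le_mul' h1 h2).trans_eq ?_
  rw [← ENNReal.ofReal_mul hR'0.le, mul_div_cancel₀ _ hR'0.ne']

variable [IsFiniteMeasure μ]

theorem memLp_exp_neg_half_posPart (u : Lp ℝ p μ) :
    MemLp (fun x => Real.exp (-(max (u x) 0) / 2)) 2 μ := by
  refine MemLp.of_bound (C := 1) ?_ (Eventually.of_forall fun x => ?_)
  · exact (Real.continuous_exp.measurable.comp_aemeasurable
      (((Lp.aestronglyMeasurable u).aemeasurable.max aemeasurable_const).neg.div_const
        2)).aestronglyMeasurable
  · rw [Real.norm_of_nonneg (Real.exp_pos _).le, Real.exp_le_one_iff]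
    have := le_max_right (u x) 0
    linarith

/-- The bounded function `exp (-u⁺ / 2)`, as an element of `L²`. For `u, v ≥ 0` its inner product
with `exp (-v / 2)` is the integral of `exp (-(u + v) / 2)`, which turns the convexity gap of
`u ↦ ∫ exp (-u)` into a squared distance. -/
noncomputable def expNegHalf (u : Lp ℝ p μ) : Lp ℝ 2 μ := (memLp_exp_neg_half_posPart u).toLp

theorem expNegHalf_ae (u : Lp ℝ p μ) :
    expNegHalf u =ᵐ[μ] fun x => Real.exp (-(max (u x) 0) / 2) :=
  (memLp_exp_neg_half_posPart u).coeFn_toLp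

theorem inner_expNegHalf {u v : Lp ℝ p μ} (hu : 0 ≤ u) (hv : 0 ≤ v) :
    inner ℝ (expNegHalf u) (expNegHalf v) = ‖expNegHalf ((2⁻¹ : ℝ) • (u + v))‖ ^ 2 := by
  rw [← real_inner_self_eq_norm_sq, L2.inner_def, L2.inner_def]
  refine integral_congr_ae ?_
  filter_upwards [expNegHalf_ae u, expNegHalf_ae v, expNegHalf_ae ((2⁻¹ : ℝ) • (u + v)),
    Lp.coeFn_smul (2⁻¹ : ℝ) (u + v), Lp.coeFn_add u v, (Lp.coeFn_nonneg u).2 hu,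
    (Lp.coeFn_nonneg v).2 hv] with x h1 h2 h3 h4 h5 h6 h7
  simp only [Pi.zero_apply] at h6 h7
  have h8 : (0 : ℝ) ≤ 2⁻¹ * (u x + v x) := by positivity
  simp only [h1, h2, h3, h4, h5, Pi.smul_apply, Pi.add_apply, smul_eq_mul, max_eq_left h6,
    max_eq_left h7, max_eq_left h8, RCLike.inner_apply, conj_trivial, ← Real.exp_add]
  congr 1
  ring

theorem norm_expNegHalf_sq_le (u : Lp ℝ p μ) : ‖expNegHalf u‖ ^ 2 ≤ μ.real Set.univ := by
  rw [← real_inner_self_eq_norm_sq, L2.inner_def]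
  refine (integral_mono_ae (L2.integrable_inner _ _) (integrable_const (1 : ℝ)) ?_).trans_eq
    (by simp)
  filter_upwards [expNegHalf_ae u] with x hx
  have h1 : Real.exp (-(max (u x) 0) / 2) ≤ 1 := by
    rw [Real.exp_le_one_iff]
    linarith [le_max_right (u x) 0]
  have h2 := (Real.exp_pos (-(max (u x) 0) / 2)).le
  simp only [hx, RCLike.inner_apply, conj_trivial]
  nlinarith

/-- A bounded sequence of non-negative `L^p` functions, `p > 1`, for which `exp (-u / 2)` converges
almost everywhere, converges almost everywhere and in `L¹` to an `L^p` function. Fatou's lemma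
keeps the limit finite, and the `L^p` bound gives uniform integrability. -/
theorem exists_tendsto_of_tendsto_expNegHalf (hp : 1 < p) {u : ℕ → Lp ℝ p μ} (hu : ∀ n, 0 ≤ u n)
    {R : ℝ} (hR : ∀ n, ‖u n‖ ≤ R) {w : Lp ℝ 2 μ}
    (hw : ∀ᵐ x ∂μ, Tendsto (fun n => expNegHalf (u n) x) atTop (𝓝 (w x))) :
    ∃ v : Lp ℝ p μ, (∀ᵐ x ∂μ, Tendsto (fun n => u n x) atTop (𝓝 (v x))) ∧
      Tendsto (fun n => eLpNorm (u n - v : X → ℝ) 1 μ) atTop (𝓝 0) := by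
  have hbd : ∀ n, eLpNorm (u n) p μ ≤ ENNReal.ofReal R := fun n => by
    rw [← ENNReal.ofReal_toReal (Lp.eLpNorm_ne_top (u n)), ← Lp.norm_def]
    exact ENNReal.ofReal_le_ofReal (hR n)
  have hbd1 : ∀ n, ∫⁻ x, ‖u n x‖ₑ ∂μ ≤ ENNReal.ofReal R *
      μ Set.univ ^ (1 / (1 : ℝ≥0∞).toReal - 1 / p.toReal) := fun n => by
    rw [← eLpNorm_one_eq_lintegral_enorm]
    exact (eLpNorm_le_eLpNorm_mul_rpow_measure_univ hp.le (Lp.aestronglyMeasurable _)).trans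
      (mul_le_mul' (hbd n) le_rfl)
  have hlim : ∀ᵐ x ∂μ, liminf (fun n => ‖u n x‖ₑ) atTop < ∞ := by
    refine ae_lt_top (.liminf fun n => (Lp.stronglyMeasurable (u n)).measurable.enorm) ?_
    refine ((lintegral_liminf_le' fun n =>
      (Lp.aestronglyMeasurable (u n)).enorm).trans_lt ?_).ne
    refine (liminf_le_of_le (by isBoundedDefault) fun b hb => ?_ : _ ≤ ENNReal.ofReal R *
      μ Set.univ ^ (1 / (1 : ℝ≥0∞).toReal - 1 / p.toReal)).trans_lt ?_
    · obtain ⟨n, hn⟩ := hb.exists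
      exact hn.trans (hbd1 n)
    · refine ENNReal.mul_lt_top ENNReal.ofReal_lt_top
        (ENNReal.rpow_lt_top_of_nonneg ?_ (measure_ne_top _ _))
      rcases eq_or_ne p ∞ with rfl | hpt
      · simp
      · have : 1 ≤ p.toReal := by
          simpa using (ENNReal.toReal_le_toReal ENNReal.one_ne_top hpt).2 hp.le
        simpa using inv_le_one_of_one_le₀ this
  have htend : ∀ᵐ x ∂μ, Tendsto (fun n => u n x) atTop (𝓝 (-2 * Real.log (w x))) := by
    filter_upwards [hw, hlim, ae_all_iff.2 fun n => expNegHalf_ae (u n),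
      ae_all_iff.2 fun n => (Lp.coeFn_nonneg (u n)).2 (hu n)] with x h1 h2 h3 h4
    have h5 : ∀ n, u n x = -2 * Real.log (expNegHalf (u n) x) := fun n => by
      have h6 : 0 ≤ u n x := h4 n
      rw [h3 n, Real.log_exp, max_eq_left h6]
      ring
    have hw0 : w x ≠ 0 := by
      intro h0
      rw [h0] at h1
      have h6 : Tendsto (fun n => u n x) atTop atTop := by
        simp only [h5]
        refine (Real.tendsto_log_nhdsGT_zero.comp
          (tendsto_nhdsWithin_iff.2 ⟨h1, Eventually.of_forall fun n => ?_⟩)).const_mul_atBot_of_neg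
          (by norm_num)
        rw [h3 n]
        exact Real.exp_pos _
      have h7 : Tendsto (fun n => ‖u n x‖ₑ) atTop (𝓝 ∞) := by
        have := ENNReal.tendsto_ofReal_atTop.comp h6
        refine this.congr fun n => ?_
        simp [Real.enorm_eq_ofReal (h4 n)]
      rw [h7.liminf_eq] at h2
      exact lt_irrefl _ h2
    simp only [h5]
    exact ((Real.continuousAt_log hw0).tendsto.comp h1).const_mul _
  have hmem : MemLp (fun x => -2 * Real.log (w x)) p μ := by
    refine ⟨((Real.measurable_log.comp_aemeasurable
      (Lp.aestronglyMeasurable w).aemeasurable).const_mul _).aestronglyMeasurable, ?_⟩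
    exact (Lp.eLpNorm_le_of_ae_tendsto (Eventually.of_forall hbd)
      (fun n => Lp.aestronglyMeasurable (u n)) htend).trans_lt ENNReal.ofReal_lt_top
  have htend' : ∀ᵐ x ∂μ, Tendsto (fun n => u n x) atTop (𝓝 ((hmem.toLp : Lp ℝ p μ) x)) := by
    filter_upwards [htend, hmem.coeFn_toLp] with x h1 h2
    rwa [h2]
  refine ⟨hmem.toLp, htend', ?_⟩
  exact tendsto_Lp_finite_of_tendsto_ae le_rfl ENNReal.one_ne_top
    (fun n => Lp.aestronglyMeasurable (u n)) ((Lp.memLp _).mono_exponent hp.le)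
    (unifIntegrable_one_of_eLpNorm_le hp (fun n => Lp.aestronglyMeasurable (u n)) hbd) htend'

theorem convexity_gap_expNegHalf {x y : Lp ℝ p μ × Lp ℝ 2 μ} (hx : 0 ≤ x.1) (hy : 0 ≤ y.1) :
    2⁻¹ * ‖expNegHalf x.1 - expNegHalf y.1‖ ^ 2 + 4⁻¹ * ‖x.2 - y.2‖ ^ 2 =
      2⁻¹ * ((‖expNegHalf x.1‖ ^ 2 + ‖x.2‖ ^ 2) + (‖expNegHalf y.1‖ ^ 2 + ‖y.2‖ ^ 2)) -
        (‖expNegHalf ((2⁻¹ : ℝ) • (x + y)).1‖ ^ 2 + ‖((2⁻¹ : ℝ) • (x + y)).2‖ ^ 2) := by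
  rw [Prod.smul_fst, Prod.fst_add, ← inner_expNegHalf hx hy, norm_sub_sq_real, norm_sub_sq_real,
    Prod.smul_snd, Prod.snd_add, norm_smul, mul_pow, norm_add_sq_real]
  norm_num
  ring

/-- A substitute for weak compactness: a decreasing sequence of non-empty, bounded,
midpoint-convex sets of pairs `(u, v)` with `0 ≤ u ∈ L^p`, `p > 1`, and `v ∈ L²` contains a
sequence of representatives `x n ∈ S n` converging almost everywhere, in `L¹` in the first component
and in `L²` in the second one. The representatives nearly minimise the strictly convex functional
`∫ exp (-u) + ‖v‖²` over `S n`, which makes them a Cauchy sequence. -/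
theorem exists_tendsto_of_antitone_midpoint (hp : 1 < p) {S : ℕ → Set (Lp ℝ p μ × Lp ℝ 2 μ)}
    (hanti : Antitone S) (hne : ∀ n, (S n).Nonempty)
    (hmid : ∀ n, ∀ x ∈ S n, ∀ y ∈ S n, (2⁻¹ : ℝ) • (x + y) ∈ S n)
    (hnonneg : ∀ x ∈ S 0, 0 ≤ x.1) {R : ℝ} (hR : ∀ x ∈ S 0, ‖x.1‖ ≤ R ∧ ‖x.2‖ ≤ R) :
    ∃ (x : ℕ → Lp ℝ p μ × Lp ℝ 2 μ) (u : Lp ℝ p μ) (v : Lp ℝ 2 μ), (∀ n, x n ∈ S n) ∧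
      (∀ᵐ a ∂μ, Tendsto (fun n => (x n).1 a) atTop (𝓝 (u a))) ∧
      Tendsto (fun n => eLpNorm ((x n).1 - u : X → ℝ) 1 μ) atTop (𝓝 0) ∧
      (∀ᵐ a ∂μ, Tendsto (fun n => (x n).2 a) atTop (𝓝 (v a))) ∧
      Tendsto (fun n => (x n).2) atTop (𝓝 v) := by
  set E : Lp ℝ p μ × Lp ℝ 2 μ → ℝ := fun x => ‖expNegHalf x.1‖ ^ 2 + ‖x.2‖ ^ 2 with hE
  have hE0 : ∀ x, 0 ≤ E x := fun x => by positivity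
  have hbddb : ∀ n, BddBelow (E '' S n) := fun n => ⟨0, by rintro _ ⟨x, -, rfl⟩; exact hE0 x⟩
  have hS0 : ∀ n, S n ⊆ S 0 := fun n => hanti (Nat.zero_le n)
  set d : ℕ → ℝ := fun n => sInf (E '' S n) with hd
  have hdmono : Monotone d := fun m n hmn =>
    csInf_le_csInf (hbddb m) ((hne n).image E) (Set.image_mono (hanti hmn))
  have hdle : ∀ n, ∀ x ∈ S n, d n ≤ E x := fun n x hx => csInf_le (hbddb n) ⟨x, hx, rfl⟩
  have hdbdd : BddAbove (Set.range d) := by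
    refine ⟨μ.real Set.univ + R ^ 2, ?_⟩
    rintro _ ⟨n, rfl⟩
    obtain ⟨x, hx⟩ := hne n
    refine (hdle n x hx).trans (add_le_add (norm_expNegHalf_sq_le _) ?_)
    exact pow_le_pow_left₀ (norm_nonneg _) (hR x (hS0 n hx)).2 2
  set D := ⨆ n, d n with hD
  have hdD : Tendsto d atTop (𝓝 D) := tendsto_atTop_ciSup hdmono hdbdd
  have hex : ∀ n, ∃ x ∈ S n, E x < d n + 1 / ((n : ℝ) + 1) := fun n => by
    obtain ⟨_, ⟨x, hx, rfl⟩, h⟩ := exists_lt_of_csInf_lt ((hne n).image E)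
      (lt_add_of_pos_right (d n) (by positivity : 0 < 1 / ((n : ℝ) + 1)))
    exact ⟨x, hx, h⟩
  choose x hxS hxE using hex
  set b : ℕ → ℝ := fun N => D - d N + 1 / ((N : ℝ) + 1) with hb
  have hb0 : Tendsto b atTop (𝓝 0) := by
    simpa [hb] using ((tendsto_const_nhds (x := D)).sub hdD).add
      (tendsto_one_div_add_atTop_nhds_zero_nat (𝕜 := ℝ))
  have hgap : ∀ n m N, N ≤ n → N ≤ m →
      2⁻¹ * ‖expNegHalf (x n).1 - expNegHalf (x m).1‖ ^ 2 + 4⁻¹ * ‖(x n).2 - (x m).2‖ ^ 2 ≤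
        b N := by
    intro n m N hn hm
    have hone : ∀ k, N ≤ k → E (x k) ≤ D + 1 / ((N : ℝ) + 1) := fun k hk => by
      have h1 : 1 / ((k : ℝ) + 1) ≤ 1 / ((N : ℝ) + 1) := by
        have : (N : ℝ) ≤ k := by exact_mod_cast hk
        exact one_div_le_one_div_of_le (by positivity) (by linarith)
      linarith [hxE k, le_ciSup hdbdd k]
    rw [convexity_gap_expNegHalf (hnonneg _ (hS0 _ (hxS n))) (hnonneg _ (hS0 _ (hxS m)))]
    have h3 := hdle N _ (hmid N _ (hanti hn (hxS n)) _ (hanti hm (hxS m)))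
    have h1 := hone n hn
    have h2 := hone m hm
    simp only [hE] at h1 h2 h3
    simp only [hb]
    linarith
  have hsq : Tendsto (fun N => Real.sqrt (4 * b N)) atTop (𝓝 0) := by
    simpa using (hb0.const_mul 4).sqrt
  have hc1 : CauchySeq fun n => expNegHalf (x n).1 := by
    refine cauchySeq_of_le_tendsto_0 _ (fun n m N hn hm => ?_) hsq
    rw [dist_eq_norm]
    refine Real.le_sqrt_of_sq_le ?_
    nlinarith [hgap n m N hn hm, sq_nonneg ‖(x n).2 - (x m).2‖,
      sq_nonneg ‖expNegHalf (x n).1 - expNegHalf (x m).1‖]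
  have hc2 : CauchySeq fun n => (x n).2 := by
    refine cauchySeq_of_le_tendsto_0 _ (fun n m N hn hm => ?_) hsq
    rw [dist_eq_norm]
    refine Real.le_sqrt_of_sq_le ?_
    nlinarith [hgap n m N hn hm, sq_nonneg ‖expNegHalf (x n).1 - expNegHalf (x m).1‖]
  obtain ⟨w, hw⟩ := cauchySeq_tendsto_of_complete hc1
  obtain ⟨v, hv⟩ := cauchySeq_tendsto_of_complete hc2
  obtain ⟨k, hk, hkw⟩ := (tendstoInMeasure_of_tendsto_Lp hw).exists_seq_tendsto_ae
  obtain ⟨l, hl, hlv⟩ :=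
    (tendstoInMeasure_of_tendsto_Lp (hv.comp hk.tendsto_atTop)).exists_seq_tendsto_ae
  have hkl : StrictMono (k ∘ l) := hk.comp hl
  obtain ⟨u, hu1, hu2⟩ := exists_tendsto_of_tendsto_expNegHalf hp
    (u := fun n => (x (k (l n))).1) (fun n => hnonneg _ (hS0 _ (hxS _)))
    (fun n => (hR _ (hS0 _ (hxS _))).1) (w := w)
    (hkw.mono fun a ha => ha.comp hl.tendsto_atTop)
  exact ⟨fun n => x (k (l n)), u, v, fun n => hanti (hkl.le_apply (x := n)) (hxS _), hu1, hu2, hlv,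
    hv.comp hkl.tendsto_atTop⟩

end Compactness

/-! ### The Kullback–Leibler divergence -/

section KullbackLeibler

theorem klIntegrand_zero_left {b : ℝ} : klIntegrand 0 b = ENNReal.ofReal b := by
  simp [klIntegrand]

theorem klIntegrand_of_pos {a b : ℝ} (hb : 0 < b) :
    klIntegrand a b = ENNReal.ofReal (b - a + a * Real.log (a / b)) := by
  simp [klIntegrand, hb.ne']

theorem affine_le_kl {a b s : ℝ} (ha : 0 ≤ a) (hb : 0 < b) :
    a * s - b * (Real.exp s - 1) ≤ b - a + a * Real.log (a / b) := by
  rcases ha.eq_or_lt with rfl | ha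
  · have := mul_nonneg hb.le (Real.exp_pos s).le
    simp
    linarith
  · -- `exp` lies above its tangent at `log (a / b)`
    have h1 := Real.add_one_le_exp (s - Real.log (a / b))
    rw [Real.exp_sub, Real.exp_log (by positivity), div_div_eq_mul_div,
      le_div_iff₀ ha] at h1
    nlinarith

/-- The integrand of the divergence is a supremum of affine functions of `(a, b)`: it is therefore
jointly convex and lower semicontinuous, also where it is infinite. -/
theorem klIntegrand_eq_iSup {a b : ℝ} (ha : 0 ≤ a) (hb : 0 ≤ b) :
    klIntegrand a b = ⨆ s : ℝ, ENNReal.ofReal (a * s - b * (Real.exp s - 1)) := by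
  rcases hb.eq_or_lt with rfl | hb
  · rcases ha.eq_or_lt with rfl | ha
    · simp [klIntegrand]
    · rw [klIntegrand, if_pos ⟨rfl, ha.ne'⟩]
      refine (iSup_eq_top.2 fun c hc => ⟨(c.toReal + 1) / a, ?_⟩).symm
      rw [zero_mul, sub_zero, mul_div_cancel₀ _ ha.ne']
      exact (ENNReal.lt_ofReal_iff_toReal_lt hc.ne).2 (lt_add_one _)
  · refine le_antisymm ?_ (iSup_le fun s => ?_)
    · rw [klIntegrand_of_pos hb]
      rcases ha.eq_or_lt with rfl | ha
      · -- the supremum is approached as `s → -∞`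
        refine le_of_tendsto (f := fun s : ℝ => ENNReal.ofReal (0 * s - b * (Real.exp s - 1)))
          (x := atBot) (b := _) ?_ (Eventually.of_forall fun s => le_iSup
            (fun s : ℝ => ENNReal.ofReal (0 * s - b * (Real.exp s - 1))) s)
        refine ENNReal.tendsto_ofReal ?_
        have := ((Real.tendsto_exp_atBot.sub_const 1).const_mul b).const_sub 0
        simpa using this
      · refine le_iSup_of_le (Real.log (a / b)) (ENNReal.ofReal_le_ofReal ?_)
        rw [Real.exp_log (by positivity)]
        have : b * (a / b) = a := by field_simp
        linarith
    · rw [klIntegrand_of_pos hb]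
      exact ENNReal.ofReal_le_ofReal (affine_le_kl ha hb)

theorem measurable_klIntegrand : Measurable (Function.uncurry klIntegrand) := by
  unfold klIntegrand Function.uncurry
  refine Measurable.ite ?_ measurable_const ?_
  · exact (measurable_snd (measurableSet_singleton (0 : ℝ))).inter
      (measurable_fst (measurableSet_singleton (0 : ℝ))).compl
  · fun_prop

theorem ofReal_half_add {x y : ℝ} :
    ENNReal.ofReal (2⁻¹ * (x + y)) ≤ 2⁻¹ * (ENNReal.ofReal x + ENNReal.ofReal y) := by
  rw [ENNReal.ofReal_mul (by norm_num), ENNReal.ofReal_inv_of_pos (by norm_num)]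
  simpa using mul_le_mul_right (ENNReal.ofReal_add_le (p := x) (q := y)) _

theorem klIntegrand_midpoint_le {a a' b b' : ℝ} (ha : 0 ≤ a) (ha' : 0 ≤ a') (hb : 0 ≤ b)
    (hb' : 0 ≤ b') :
    klIntegrand (2⁻¹ * (a + a')) (2⁻¹ * (b + b')) ≤
      2⁻¹ * (klIntegrand a b + klIntegrand a' b') := by
  rw [klIntegrand_eq_iSup (by positivity) (by positivity), klIntegrand_eq_iSup ha hb,
    klIntegrand_eq_iSup ha' hb']
  refine iSup_le fun s => ?_
  have : 2⁻¹ * (a + a') * s - 2⁻¹ * (b + b') * (Real.exp s - 1) =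
    2⁻¹ * ((a * s - b * (Real.exp s - 1)) + (a' * s - b' * (Real.exp s - 1))) := by ring
  rw [this]
  refine ofReal_half_add.trans (mul_le_mul_right (add_le_add ?_ ?_) _)
  · exact le_iSup (fun s : ℝ => ENNReal.ofReal (a * s - b * (Real.exp s - 1))) s
  · exact le_iSup (fun s : ℝ => ENNReal.ofReal (a' * s - b' * (Real.exp s - 1))) s

theorem klIntegrand_le_liminf {a b : ℝ} {u v : ℕ → ℝ} (hu : ∀ n, 0 ≤ u n) (hv : ∀ n, 0 ≤ v n)
    (hua : Tendsto u atTop (𝓝 a)) (hvb : Tendsto v atTop (𝓝 b)) :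
    klIntegrand a b ≤ liminf (fun n => klIntegrand (u n) (v n)) atTop := by
  rw [klIntegrand_eq_iSup (ge_of_tendsto' hua hu) (ge_of_tendsto' hvb hv)]
  refine iSup_le fun s => ?_
  have h : Tendsto (fun n => ENNReal.ofReal (u n * s - v n * (Real.exp s - 1))) atTop
      (𝓝 (ENNReal.ofReal (a * s - b * (Real.exp s - 1)))) :=
    ENNReal.tendsto_ofReal ((hua.mul_const _).sub (hvb.mul_const _))
  rw [← h.liminf_eq]
  refine liminf_le_liminf (Eventually.of_forall fun n => ?_)
  rw [klIntegrand_eq_iSup (hu n) (hv n)]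
  exact le_iSup (fun s : ℝ => ENNReal.ofReal (u n * s - v n * (Real.exp s - 1))) s

/-- Strict convexity of the divergence in its second argument, where the first one is positive. -/
theorem eq_of_klIntegrand_midpoint {a b b' : ℝ} (ha : 0 < a) (hb : 0 ≤ b) (hb' : 0 ≤ b')
    (h1 : klIntegrand a b ≠ ∞) (h2 : klIntegrand a b' ≠ ∞)
    (h : 2⁻¹ * (klIntegrand a b + klIntegrand a b') ≤ klIntegrand a (2⁻¹ * (b + b'))) :
    b = b' := by
  have hb0 : 0 < b := hb.lt_of_ne fun h => h1 (by rw [klIntegrand, if_pos ⟨h.symm, ha.ne'⟩])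
  have hb0' : 0 < b' := hb'.lt_of_ne fun h => h2 (by rw [klIntegrand, if_pos ⟨h.symm, ha.ne'⟩])
  have hnn : ∀ {b : ℝ}, 0 < b → 0 ≤ b - a + a * Real.log (a / b) := fun hb => by
    simpa using affine_le_kl (s := 0) ha.le hb
  have h2' : (2⁻¹ : ℝ≥0∞) = ENNReal.ofReal 2⁻¹ := by
    rw [ENNReal.ofReal_inv_of_pos (by norm_num)]; simp
  rw [klIntegrand_of_pos hb0, klIntegrand_of_pos hb0', klIntegrand_of_pos (by positivity),
    ← ENNReal.ofReal_add (hnn hb0) (hnn hb0'), h2', ← ENNReal.ofReal_mul (by norm_num),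
    ENNReal.ofReal_le_ofReal_iff (hnn (by positivity)), Real.log_div ha.ne' hb0.ne',
    Real.log_div ha.ne' hb0'.ne', Real.log_div ha.ne' (by positivity)] at h
  by_contra hne
  have hs : (2⁻¹ : ℝ) • Real.log b + (2⁻¹ : ℝ) • Real.log b' <
      Real.log ((2⁻¹ : ℝ) • b + (2⁻¹ : ℝ) • b') :=
    strictConcaveOn_log_Ioi.2 (Set.mem_Ioi.2 hb0) (Set.mem_Ioi.2 hb0') hne
      (by norm_num) (by norm_num) (by norm_num)
  simp only [smul_eq_mul, ← mul_add] at hs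
  have := mul_lt_mul_of_pos_left hs ha
  nlinarith

theorem hellinger_le_klIntegrand {a b : ℝ} (ha : 0 ≤ a) (hb : 0 ≤ b) :
    ENNReal.ofReal ((Real.sqrt a - Real.sqrt b) ^ 2) ≤ klIntegrand a b := by
  rcases hb.eq_or_lt with rfl | hb
  · rcases ha.eq_or_lt with rfl | ha
    · simp
    · rw [klIntegrand, if_pos ⟨rfl, ha.ne'⟩]; exact le_top
  rw [klIntegrand_of_pos hb]
  refine ENNReal.ofReal_le_ofReal ?_
  rcases ha.eq_or_lt with rfl | ha
  · simp [Real.sq_sqrt hb.le]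
  obtain ⟨s, hs, rfl⟩ : ∃ s, 0 < s ∧ s ^ 2 = a := ⟨√a, Real.sqrt_pos.2 ha, Real.sq_sqrt ha.le⟩
  obtain ⟨t, ht, rfl⟩ : ∃ t, 0 < t ∧ t ^ 2 = b := ⟨√b, Real.sqrt_pos.2 hb, Real.sq_sqrt hb.le⟩
  rw [Real.sqrt_sq hs.le, Real.sqrt_sq ht.le, ← div_pow, Real.log_pow]
  -- the claim is `log (t / s) ≤ t / s - 1`
  have h1 := Real.log_le_sub_one_of_pos (div_pos ht hs)
  rw [Real.log_div ht.ne' hs.ne', le_sub_iff_add_le, le_div_iff₀ hs] at h1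
  rw [Real.log_div hs.ne' ht.ne']
  push_cast
  nlinarith

variable {Ω : Set E3}

theorem klDivergence_ne_top {v g : E3 → ℝ} (h : klDivergence Ω v g ≠ ∞) :
    (0 ≤ᵐ[volOn Ω] v ∧ 0 ≤ᵐ[volOn Ω] g ∧ ∫ x, v x ∂(volOn Ω) = 1 ∧ ∫ x, g x ∂(volOn Ω) = 1) ∧
      klDivergence Ω v g = ∫⁻ x, klIntegrand (v x) (g x) ∂(volOn Ω) := by
  rw [klDivergence] at h ⊢
  split_ifs at h ⊢ with hc
  · exact ⟨hc, rfl⟩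
  · exact absurd rfl h

theorem lintegral_klIntegrand_le (v g : E3 → ℝ) :
    ∫⁻ x, klIntegrand (v x) (g x) ∂(volOn Ω) ≤ klDivergence Ω v g := by
  rw [klDivergence]
  split_ifs
  · exact le_rfl
  · exact le_top

theorem klDivergence_congr {v v' g g' : E3 → ℝ} (hv : v =ᵐ[volOn Ω] v') (hg : g =ᵐ[volOn Ω] g') :
    klDivergence Ω v g = klDivergence Ω v' g' := by
  have h1 : (0 ≤ᵐ[volOn Ω] v ↔ 0 ≤ᵐ[volOn Ω] v') :=
    ⟨fun h => h.trans hv.le, fun h => h.trans hv.symm.le⟩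
  have h2 : (0 ≤ᵐ[volOn Ω] g ↔ 0 ≤ᵐ[volOn Ω] g') :=
    ⟨fun h => h.trans hg.le, fun h => h.trans hg.symm.le⟩
  have h3 : ∫⁻ x, klIntegrand (v x) (g x) ∂(volOn Ω) =
      ∫⁻ x, klIntegrand (v' x) (g' x) ∂(volOn Ω) :=
    lintegral_congr_ae (by filter_upwards [hv, hg] with x h1 h2; rw [h1, h2])
  have h4 := integral_congr_ae hv
  have h5 := integral_congr_ae hg
  rw [klDivergence, klDivergence, h3, h4, h5]
  split_ifs with hc hc' hc'
  · rfl
  · exact absurd ⟨h1.1 hc.1, h2.1 hc.2.1, hc.2.2⟩ hc'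
  · exact absurd ⟨h1.2 hc'.1, h2.2 hc'.2.1, hc'.2.2⟩ hc
  · rfl

theorem klDivergence_midpoint_le {v v' g g' : E3 → ℝ} (hv : AEMeasurable v (volOn Ω))
    (hg : AEMeasurable g (volOn Ω)) :
    klDivergence Ω (fun x => 2⁻¹ * (v x + v' x)) (fun x => 2⁻¹ * (g x + g' x)) ≤
      2⁻¹ * (klDivergence Ω v g + klDivergence Ω v' g') := by
  by_cases h : klDivergence Ω v g = ∞
  · simp [h]
  by_cases h' : klDivergence Ω v' g' = ∞
  · simp [h']
  obtain ⟨⟨hv0, hg0, hv1, hg1⟩, h⟩ := klDivergence_ne_top h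
  obtain ⟨⟨hv0', hg0', hv1', hg1'⟩, h'⟩ := klDivergence_ne_top h'
  rw [h, h', ← lintegral_add_left' (f := fun x => klIntegrand (v x) (g x))
      (measurable_klIntegrand.comp_aemeasurable (hv.prodMk hg)),
    ← lintegral_const_mul' _ _ (by simp), klDivergence, if_pos]
  · refine lintegral_mono_ae ?_
    filter_upwards [hv0, hg0, hv0', hg0'] with x h1 h2 h3 h4
    exact klIntegrand_midpoint_le h1 h3 h2 h4
  · refine ⟨?_, ?_, ?_, ?_⟩
    · filter_upwards [hv0, hv0'] with x h1 h2
      simp only [Pi.zero_apply] at h1 h2 ⊢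
      positivity
    · filter_upwards [hg0, hg0'] with x h1 h2
      simp only [Pi.zero_apply] at h1 h2 ⊢
      positivity
    · rw [integral_const_mul, integral_add (integrable_of_integral_eq_one hv1)
        (integrable_of_integral_eq_one hv1'), hv1, hv1']
      norm_num
    · rw [integral_const_mul, integral_add (integrable_of_integral_eq_one hg1)
        (integrable_of_integral_eq_one hg1'), hg1, hg1']
      norm_num

theorem klDivergence_le_liminf {v g : E3 → ℝ} {u w : ℕ → E3 → ℝ}
    (hum : ∀ n, AEMeasurable (u n) (volOn Ω)) (hwm : ∀ n, AEMeasurable (w n) (volOn Ω))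
    (hu0 : ∀ n, 0 ≤ᵐ[volOn Ω] u n) (hw0 : ∀ n, 0 ≤ᵐ[volOn Ω] w n)
    (hu : ∀ᵐ x ∂(volOn Ω), Tendsto (fun n => u n x) atTop (𝓝 (v x)))
    (hw : ∀ᵐ x ∂(volOn Ω), Tendsto (fun n => w n x) atTop (𝓝 (g x)))
    (hui : Tendsto (fun n => ∫ x, u n x ∂(volOn Ω)) atTop (𝓝 (∫ x, v x ∂(volOn Ω))))
    (hwi : Tendsto (fun n => ∫ x, w n x ∂(volOn Ω)) atTop (𝓝 (∫ x, g x ∂(volOn Ω)))) :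
    klDivergence Ω v g ≤ liminf (fun n => klDivergence Ω (u n) (w n)) atTop := by
  by_cases htop : liminf (fun n => klDivergence Ω (u n) (w n)) atTop = ∞
  · rw [htop]; exact le_top
  have hfreq : ∃ᶠ n in atTop, klDivergence Ω (u n) (w n) < ∞ :=
    frequently_lt_of_liminf_lt (by isBoundedDefault) (lt_top_iff_ne_top.2 htop)
  have h1 : ∫ x, v x ∂(volOn Ω) = 1 := by
    by_contra hne
    obtain ⟨n, hn1, hn2⟩ := (hfreq.and_eventually (hui.eventually_ne hne)).exists
    exact hn2 (klDivergence_ne_top hn1.ne).1.2.2.1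
  have h2 : ∫ x, g x ∂(volOn Ω) = 1 := by
    by_contra hne
    obtain ⟨n, hn1, hn2⟩ := (hfreq.and_eventually (hwi.eventually_ne hne)).exists
    exact hn2 (klDivergence_ne_top hn1.ne).1.2.2.2
  have hu0' := ae_all_iff.2 hu0
  have hw0' := ae_all_iff.2 hw0
  have h3 : 0 ≤ᵐ[volOn Ω] v := by
    filter_upwards [hu, hu0'] with x h1 h2 using ge_of_tendsto' h1 h2
  have h4 : 0 ≤ᵐ[volOn Ω] g := by
    filter_upwards [hw, hw0'] with x h1 h2 using ge_of_tendsto' h1 h2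
  rw [klDivergence, if_pos ⟨h3, h4, h1, h2⟩]
  calc ∫⁻ x, klIntegrand (v x) (g x) ∂(volOn Ω)
      ≤ ∫⁻ x, liminf (fun n => klIntegrand (u n x) (w n x)) atTop ∂(volOn Ω) := by
        refine lintegral_mono_ae ?_
        filter_upwards [hu, hw, hu0', hw0'] with x h1 h2 h3 h4
        exact klIntegrand_le_liminf h3 h4 h1 h2
    _ ≤ liminf (fun n => ∫⁻ x, klIntegrand (u n x) (w n x) ∂(volOn Ω)) atTop :=
        lintegral_liminf_le' fun n =>
          measurable_klIntegrand.comp_aemeasurable ((hum n).prodMk (hwm n))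
    _ ≤ _ := liminf_le_liminf (Eventually.of_forall fun n => lintegral_klIntegrand_le _ _)

/-- A Pinsker-type inequality with a non-optimal constant, through the Hellinger distance:
`|v - g| = |√v - √g| (√v + √g)`, and `(√v - √g)²` is dominated by the divergence integrand. -/
theorem integral_abs_sub_le_of_klDivergence_le {v g : E3 → ℝ} {k : ℝ} (hk : 0 ≤ k)
    (h : klDivergence Ω v g ≤ ENNReal.ofReal k) :
    ∫ x, |v x - g x| ∂(volOn Ω) ≤ 2 * Real.sqrt k := by
  obtain ⟨⟨hv0, hg0, hv1, hg1⟩, heq⟩ := klDivergence_ne_top (h.trans_lt ENNReal.ofReal_lt_top).ne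
  have hvi := integrable_of_integral_eq_one hv1
  have hgi := integrable_of_integral_eq_one hg1
  have hvm := hvi.aestronglyMeasurable.aemeasurable
  have hgm := hgi.aestronglyMeasurable.aemeasurable
  have hs1 : AEStronglyMeasurable (fun x => √(v x)) (volOn Ω) := hvm.sqrt.aestronglyMeasurable
  have hs2 : AEStronglyMeasurable (fun x => √(g x)) (volOn Ω) := hgm.sqrt.aestronglyMeasurable
  have hm1 : MemLp (fun x => √(v x)) 2 (volOn Ω) := by
    refine (memLp_two_iff_integrable_sq hs1).2 (hvi.congr ?_)
    filter_upwards [hv0] with x hx using (Real.sq_sqrt hx).symm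
  have hm2 : MemLp (fun x => √(g x)) 2 (volOn Ω) := by
    refine (memLp_two_iff_integrable_sq hs2).2 (hgi.congr ?_)
    filter_upwards [hg0] with x hx using (Real.sq_sqrt hx).symm
  have hd : MemLp (fun x => |√(v x) - √(g x)|) 2 (volOn Ω) := (hm1.sub hm2).abs
  have ha : MemLp (fun x => √(v x) + √(g x)) 2 (volOn Ω) := hm1.add hm2
  have hholder := integral_mul_le_Lp_mul_Lq_of_nonneg (p := 2) (q := 2) (μ := volOn Ω)
    (f := fun x => |√(v x) - √(g x)|) (g := fun x => √(v x) + √(g x))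
    Real.HolderConjugate.two_two (Eventually.of_forall fun x => abs_nonneg _)
    (Eventually.of_forall fun x => add_nonneg (Real.sqrt_nonneg _) (Real.sqrt_nonneg _))
    (by simpa using hd) (by simpa using ha)
  have h1 : ∫ x, |v x - g x| ∂(volOn Ω) =
      ∫ x, |√(v x) - √(g x)| * (√(v x) + √(g x)) ∂(volOn Ω) := by
    refine integral_congr_ae ?_
    filter_upwards [hv0, hg0] with x h1 h2
    simp only [Pi.zero_apply] at h1 h2
    have h3 : v x - g x = (√(v x) - √(g x)) * (√(v x) + √(g x)) := by
      nlinarith [Real.sq_sqrt h1, Real.sq_sqrt h2]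
    rw [h3, abs_mul, abs_of_nonneg (add_nonneg (Real.sqrt_nonneg _) (Real.sqrt_nonneg _))]
  have h2 : ∫ x, |√(v x) - √(g x)| ^ (2 : ℝ) ∂(volOn Ω) ≤ k := by
    simp only [Real.rpow_two, sq_abs]
    rw [integral_eq_lintegral_of_nonneg_ae (f := fun x => (√(v x) - √(g x)) ^ 2)
      (Eventually.of_forall fun x => sq_nonneg _) ((hs1.sub hs2).pow 2)]
    refine ENNReal.toReal_le_of_le_ofReal hk (le_trans ?_ (heq.symm.le.trans h))
    refine lintegral_mono_ae ?_
    filter_upwards [hv0, hg0] with x h1 h2 using hellinger_le_klIntegrand h1 h2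
  have h3 : ∫ x, (√(v x) + √(g x)) ^ (2 : ℝ) ∂(volOn Ω) ≤ 4 := by
    have h4 : ∫ x, (2 * v x + 2 * g x) ∂(volOn Ω) = 4 := by
      rw [integral_add (hvi.const_mul 2) (hgi.const_mul 2), integral_const_mul,
        integral_const_mul, hv1, hg1]
      norm_num
    rw [← h4]
    refine integral_mono_ae ?_ ((hvi.const_mul 2).add (hgi.const_mul 2)) ?_
    · simpa using ha.integrable_sq
    · filter_upwards [hv0, hg0] with x h1 h2
      simp only [Pi.zero_apply] at h1 h2
      rw [Real.rpow_two]
      nlinarith [Real.sq_sqrt h1, Real.sq_sqrt h2, sq_nonneg (√(v x) - √(g x))]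
  rw [h1]
  refine hholder.trans ?_
  rw [← Real.sqrt_eq_rpow, ← Real.sqrt_eq_rpow, mul_comm]
  refine mul_le_mul ((Real.sqrt_le_sqrt h3).trans_eq ?_) (Real.sqrt_le_sqrt h2)
    (Real.sqrt_nonneg _) (by norm_num)
  rw [show (4 : ℝ) = 2 ^ 2 by norm_num]
  exact Real.sqrt_sq (by norm_num)

end KullbackLeibler

/-! ### Test fields supported in cones -/

section TestFields

theorem hasFDerivAt_integral_comp_sub {Q F : Type*} [MeasurableSpace Q] {ν : Measure Q}
    [NormedAddCommGroup F] [NormedSpace ℝ F] {w : Q → ℝ} {m : Q → E3} (hw : Integrable w ν)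
    (hm : AEMeasurable m ν) {φ : E3 → F} (hφ : ContDiff ℝ 1 φ) (hc : HasCompactSupport φ) (x : E3) :
    HasFDerivAt (fun x => ∫ q, w q • φ (x - m q) ∂ν) (∫ q, w q • fderiv ℝ φ (x - m q) ∂ν) x := by
  have hφ' : Continuous (fderiv ℝ φ) := hφ.continuous_fderiv one_ne_zero
  obtain ⟨C, hC⟩ := hc.exists_bound_of_continuous hφ.continuous
  obtain ⟨C', hC'⟩ := (hc.fderiv (𝕜 := ℝ)).exists_bound_of_continuous hφ'
  have hmeas : ∀ y, AEStronglyMeasurable (fun q => y - m q) ν := fun y =>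
    (aemeasurable_const.sub hm).aestronglyMeasurable
  refine hasFDerivAt_integral_of_dominated_of_fderiv_le (𝕜 := ℝ) (s := Set.univ)
    (F := fun x q => w q • φ (x - m q)) (F' := fun x q => w q • fderiv ℝ φ (x - m q))
    (bound := fun q => C' * ‖w q‖) univ_mem ?_ ?_ ?_ ?_ (hw.norm.const_mul C') ?_
  · exact Eventually.of_forall fun y =>
      hw.aestronglyMeasurable.smul (hφ.continuous.comp_aestronglyMeasurable (hmeas y))
  · exact hw.smul_bdd C (hφ.continuous.comp_aestronglyMeasurable (hmeas x))
      (Eventually.of_forall fun q => hC _)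
  · exact hw.aestronglyMeasurable.smul (hφ'.comp_aestronglyMeasurable (hmeas x))
  · refine Eventually.of_forall fun q y _ => ?_
    rw [norm_smul, mul_comm]
    exact mul_le_mul_of_nonneg_right (hC' _) (norm_nonneg _)
  · refine Eventually.of_forall fun q y _ => ?_
    have h1 : HasFDerivAt φ (fderiv ℝ φ (y - m q)) (y - m q) :=
      (hφ.differentiable one_ne_zero _).hasFDerivAt
    have h2 := h1.comp y ((hasFDerivAt_id y).sub_const (m q))
    exact h2.const_smul (w q)

theorem contDiff_integral_comp_sub {Q : Type*} [MeasurableSpace Q] {ν : Measure Q} {w : Q → ℝ}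
    {m : Q → E3} (hw : Integrable w ν) (hm : AEMeasurable m ν) {F : Type*} [NormedAddCommGroup F]
    [NormedSpace ℝ F] {φ : E3 → F} (hφ : ContDiff ℝ ((⊤ : ℕ∞) : WithTop ℕ∞) φ)
    (hc : HasCompactSupport φ) :
    ContDiff ℝ ((⊤ : ℕ∞) : WithTop ℕ∞) fun x => ∫ q, w q • φ (x - m q) ∂ν := by
  rw [contDiff_infty]
  intro n
  induction n generalizing F with
  | zero =>
    have h : Differentiable ℝ fun x => ∫ q, w q • φ (x - m q) ∂ν := fun x =>
      (hasFDerivAt_integral_comp_sub hw hm (hφ.of_le (by exact_mod_cast le_top))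
        hc x).differentiableAt
    exact contDiff_zero.2 h.continuous
  | succ n ih =>
    have h := hasFDerivAt_integral_comp_sub hw hm (hφ.of_le (by exact_mod_cast le_top)) hc
    have hfd : fderiv ℝ (fun x => ∫ q, w q • φ (x - m q) ∂ν) =
        fun x => ∫ q, w q • fderiv ℝ φ (x - m q) ∂ν := funext fun x => (h x).fderiv
    push_cast
    refine contDiff_succ_iff_fderiv.2 ⟨fun x => (h x).differentiableAt, by simp, ?_⟩
    rw [hfd]
    exact ih (contDiff_infty_iff_fderiv.1 hφ).2 (hc.fderiv (𝕜 := ℝ))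

theorem sum_apply_single (T : E3 →L[ℝ] ℝ) (v : E3) :
    ∑ i : Fin 3, v i * T (EuclideanSpace.single i 1) = T v := by
  have h : v = ∑ i : Fin 3, v i • EuclideanSpace.single i (1 : ℝ) := by
    ext j
    simp [Finset.sum_apply, Pi.single_apply]
  conv_rhs => rw [h]
  simp [map_sum]

/-- The product of Lebesgue measure on the closed ball of directions `b` with centre `b₀` and
radius `ε`, and of Lebesgue measure on the interval of times `t ∈ (0, 1]`. -/
noncomputable def coneMeasure (b₀ : E3) (ε : ℝ) : Measure (E3 × ℝ) :=
  (volume.restrict (Metric.closedBall b₀ ε)).prod (volume.restrict (Set.Ioc 0 1))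

instance (b₀ : E3) (ε : ℝ) : IsFiniteMeasure (volume.restrict (Metric.closedBall b₀ ε)) :=
  ⟨by simpa using (measure_closedBall_lt_top : volume (Metric.closedBall b₀ ε) < ∞)⟩

instance (b₀ : E3) (ε : ℝ) : IsFiniteMeasure (coneMeasure b₀ ε) := by
  unfold coneMeasure; infer_instance

/-- The average of `φ` over the truncated cones `x - t b`, not normalised. -/
noncomputable def coneAverage (b₀ : E3) (ε : ℝ) (φ : E3 → ℝ) (x : E3) : ℝ :=
  ∫ q, φ (x - q.2 • q.1) ∂(coneMeasure b₀ ε)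

/-- The vector field `x ↦ ∬ (1 - t) φ (x - t b) b db dt`, which transports `φ` along the segments
issuing from its support in the directions `b` of a ball. Its divergence is a multiple of `φ`
minus `coneAverage φ`; averaging over a ball of directions makes the field bounded in
terms of the `L^q` norm of `φ`, for `q > 3`. -/
noncomputable def coneField (b₀ : E3) (ε : ℝ) (φ : E3 → ℝ) (x : E3) : E3 :=
  WithLp.toLp 2 fun i => ∫ q, ((1 - q.2) * q.1 i) • φ (x - q.2 • q.1) ∂(coneMeasure b₀ ε)

theorem ae_mem_coneMeasure (b₀ : E3) (ε : ℝ) :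
    ∀ᵐ q ∂(coneMeasure b₀ ε), q.1 ∈ Metric.closedBall b₀ ε ∧ q.2 ∈ Set.Ioc (0 : ℝ) 1 := by
  rw [coneMeasure, Measure.prod_restrict]
  exact ae_restrict_mem (Metric.isClosed_closedBall.measurableSet.prod measurableSet_Ioc)

theorem abs_coord_le (b₀ : E3) {ε : ℝ} {b : E3} (hb : b ∈ Metric.closedBall b₀ ε) (i : Fin 3) :
    |b i| ≤ ‖b₀‖ + ε := by
  have h1 : ‖b i‖ ≤ ‖b‖ := PiLp.norm_apply_le b i
  have h2 := norm_le_norm_add_norm_sub' b b₀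
  rw [mem_closedBall_iff_norm] at hb
  rw [← Real.norm_eq_abs]
  linarith

theorem integrable_coneWeight (b₀ : E3) (ε : ℝ) (i : Fin 3) :
    Integrable (fun q : E3 × ℝ => (1 - q.2) * q.1 i) (coneMeasure b₀ ε) := by
  refine Integrable.of_bound (C := ‖b₀‖ + ε) (by fun_prop) ?_
  filter_upwards [ae_mem_coneMeasure b₀ ε] with q hq
  rw [norm_mul, Real.norm_eq_abs, Real.norm_eq_abs]
  have h1 : |1 - q.2| ≤ 1 := by
    rw [abs_le]; constructor <;> linarith [hq.2.1, hq.2.2]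
  have h2 := abs_coord_le b₀ hq.1 i
  nlinarith [abs_nonneg (q.1 i), abs_nonneg (1 - q.2)]

theorem measurable_coneMap : Measurable fun q : E3 × ℝ => q.2 • q.1 := by fun_prop

variable {b₀ : E3} {ε : ℝ} {φ : E3 → ℝ}

theorem contDiff_coneField (hφ : ContDiff ℝ ((⊤ : ℕ∞) : WithTop ℕ∞) φ) (hc : HasCompactSupport φ) :
    ContDiff ℝ ((⊤ : ℕ∞) : WithTop ℕ∞) (coneField b₀ ε φ) := by
  rw [contDiff_euclidean]
  exact fun i => contDiff_integral_comp_sub (integrable_coneWeight b₀ ε i)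
    measurable_coneMap.aemeasurable hφ hc

theorem continuous_comp_coneMap (hφ : Continuous φ) (x : E3) :
    Continuous fun q : E3 × ℝ => φ (x - q.2 • q.1) := by fun_prop

theorem integrable_comp_coneMap (hφ : Continuous φ) (hc : HasCompactSupport φ) (x : E3) :
    Integrable (fun q : E3 × ℝ => φ (x - q.2 • q.1)) (coneMeasure b₀ ε) := by
  obtain ⟨C, hC⟩ := hc.exists_bound_of_continuous hφ
  exact Integrable.of_bound (C := C) (continuous_comp_coneMap hφ x).aestronglyMeasurable
    (Eventually.of_forall fun q => hC _)

theorem divergence_coneField (hφ : ContDiff ℝ ((⊤ : ℕ∞) : WithTop ℕ∞) φ) (hc : HasCompactSupport φ)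
    (x : E3) : divergence (coneField b₀ ε φ) x =
      volume.real (Metric.closedBall b₀ ε) * φ x - coneAverage b₀ ε φ x := by
  have hφ1 : ContDiff ℝ 1 φ := hφ.of_le (by exact_mod_cast le_top)
  have hφ' : Continuous (fderiv ℝ φ) := hφ1.continuous_fderiv one_ne_zero
  obtain ⟨C', hC'⟩ := (hc.fderiv (𝕜 := ℝ)).exists_bound_of_continuous hφ'
  have hder : ∀ i, HasFDerivAt (fun x => coneField b₀ ε φ x i)
      (∫ q, ((1 - q.2) * q.1 i) • fderiv ℝ φ (x - q.2 • q.1) ∂(coneMeasure b₀ ε)) x := fun i =>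
    hasFDerivAt_integral_comp_sub (integrable_coneWeight b₀ ε i)
      measurable_coneMap.aemeasurable hφ1 hc x
  have hint : ∀ i : Fin 3, Integrable (fun q : E3 × ℝ =>
      ((1 - q.2) * q.1 i) • fderiv ℝ φ (x - q.2 • q.1)) (coneMeasure b₀ ε) := fun i =>
    (integrable_coneWeight b₀ ε i).smul_bdd C'
      (f := fun q : E3 × ℝ => fderiv ℝ φ (x - q.2 • q.1))
      (Continuous.aestronglyMeasurable (by fun_prop)) (Eventually.of_forall fun q => hC' _)
  have hdiff : DifferentiableAt ℝ (coneField b₀ ε φ) x :=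
    (contDiff_coneField hφ hc).differentiable (by simp) x
  have hcoord : ∀ i : Fin 3, fderiv ℝ (coneField b₀ ε φ) x (EuclideanSpace.single i 1) i =
      ∫ q, (1 - q.2) * (q.1 i * fderiv ℝ φ (x - q.2 • q.1) (EuclideanSpace.single i 1))
        ∂(coneMeasure b₀ ε) := fun i => by
    have h1 :=
      ((EuclideanSpace.proj (𝕜 := ℝ) i).hasFDerivAt.comp x hdiff.hasFDerivAt).unique (hder i)
    have h2 := congrArg (fun T : E3 →L[ℝ] ℝ => T (EuclideanSpace.single i 1)) h1
    simp only [ContinuousLinearMap.comp_apply] at h2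
    refine Eq.trans h2 ?_
    rw [ContinuousLinearMap.integral_apply (hint i)]
    refine integral_congr_ae (Eventually.of_forall fun q => ?_)
    simp [mul_assoc]
  have hint2 : ∀ i : Fin 3, Integrable (fun q : E3 × ℝ => (1 - q.2) *
      (q.1 i * fderiv ℝ φ (x - q.2 • q.1) (EuclideanSpace.single i 1))) (coneMeasure b₀ ε) :=
    fun i => ((hint i).apply_continuousLinearMap (EuclideanSpace.single i 1)).congr
      (Eventually.of_forall fun q => by simp [mul_assoc])
  have hsum : (fun q : E3 × ℝ => (1 - q.2) * fderiv ℝ φ (x - q.2 • q.1) q.1) =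
      fun q => ∑ i : Fin 3, (1 - q.2) *
        (q.1 i * fderiv ℝ φ (x - q.2 • q.1) (EuclideanSpace.single i 1)) := by
    ext q
    rw [← Finset.mul_sum, sum_apply_single]
  have hint3 : Integrable (fun q : E3 × ℝ => (1 - q.2) * fderiv ℝ φ (x - q.2 • q.1) q.1)
      (coneMeasure b₀ ε) := by
    rw [hsum]
    exact integrable_finsetSum _ fun i _ => hint2 i
  have hφi := integrable_comp_coneMap (b₀ := b₀) (ε := ε) hφ.continuous hc x
  simp only [divergence, hcoord]
  rw [← integral_finsetSum _ fun i _ => hint2 i, ← hsum, coneAverage, eq_sub_iff_add_eq,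
    ← integral_add hint3 hφi, coneMeasure,
    integral_prod (fun q : E3 × ℝ => (1 - q.2) * fderiv ℝ φ (x - q.2 • q.1) q.1 +
      φ (x - q.2 • q.1)) (hint3.add hφi)]
  have hinner : ∀ b : E3, ∫ t in Set.Ioc (0 : ℝ) 1,
      ((1 - t) * fderiv ℝ φ (x - t • b) b + φ (x - t • b)) = φ x := fun b => by
    have hd : ∀ t : ℝ, HasDerivAt (fun t : ℝ => -((1 - t) * φ (x - t • b)))
        ((1 - t) * fderiv ℝ φ (x - t • b) b + φ (x - t • b)) t := fun t => by
      have h1 : HasDerivAt (fun t : ℝ => x - t • b) (-b) t := by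
        simpa using ((hasDerivAt_id t).smul_const b).const_sub x
      have h2 := ((hφ1.differentiable one_ne_zero _).hasFDerivAt).comp_hasDerivAt t h1
      have h3 := (((hasDerivAt_id t).const_sub 1).mul h2).neg
      refine h3.congr_deriv ?_
      simp
    rw [← intervalIntegral.integral_of_le zero_le_one,
      intervalIntegral.integral_eq_sub_of_hasDerivAt (fun t _ => hd t)
        (Continuous.intervalIntegrable (by fun_prop) _ _)]
    simp
  simp only [hinner]
  simp [measureReal_def]

theorem coneAverage_abs_le {p q : ℝ} (hpq : p.HolderConjugate q) (hq : 3 < q) (hφ : Continuous φ)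
    (hc : HasCompactSupport φ) (x : E3) :
    coneAverage b₀ ε (fun y => |φ y|) x ≤
      (volume.real (Metric.closedBall b₀ ε) ^ (1 / p) *
        ∫ t in Set.Ioc (0 : ℝ) 1, t ^ (-(3 / q))) * (∫ y, |φ y| ^ q) ^ (1 / q) := by
  have hq0 : 0 < q := by linarith
  have hca : HasCompactSupport fun y => |φ y| := hc.comp_left abs_zero
  have hint := integrable_comp_coneMap (b₀ := b₀) (ε := ε) hφ.abs hca x
  rw [coneAverage, coneMeasure, integral_prod_symm _ (by simpa only [coneMeasure] using hint)]
  have hr : IntegrableOn (fun t : ℝ => t ^ (-(3 / q))) (Set.Ioc 0 1) := by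
    rw [← intervalIntegrable_iff_integrableOn_Ioc_of_le zero_le_one]
    refine intervalIntegral.intervalIntegrable_rpow' ?_
    rw [neg_lt_neg_iff, div_lt_one hq0]
    exact hq
  rw [mul_right_comm, ← integral_const_mul]
  refine setIntegral_mono_on ?_ (hr.const_mul _) measurableSet_Ioc fun t ht => ?_
  · have := hint.swap.integral_prod_left (μ := volume.restrict (Set.Ioc (0 : ℝ) 1))
    exact this
  · have ht0 : 0 < t := ht.1
    have hcont : Continuous fun b : E3 => |φ (x - t • b)| := by fun_prop
    -- Hölder's inequality on the ball of directions
    have hholder := integral_mul_le_Lp_mul_Lq_of_nonneg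
      (μ := volume.restrict (Metric.closedBall b₀ ε)) hpq (f := fun _ => (1 : ℝ))
      (g := fun b => |φ (x - t • b)|) (Eventually.of_forall fun _ => zero_le_one)
      (Eventually.of_forall fun _ => abs_nonneg _) (memLp_const 1) (by
        obtain ⟨C, hC⟩ := hc.exists_bound_of_continuous hφ
        exact MemLp.of_bound hcont.aestronglyMeasurable C
          (Eventually.of_forall fun b => by simpa using hC _))
    simp only [one_mul, Real.one_rpow, integral_const, smul_eq_mul, mul_one,
      measureReal_restrict_apply_univ] at hholder
    refine hholder.trans ?_
    have hscale : ∫ b : E3, |φ (x - t • b)| ^ q = (t ^ 3)⁻¹ * ∫ y, |φ y| ^ q := by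
      have h1 := Measure.integral_comp_smul (volume : Measure E3) (fun y => |φ (x - y)| ^ q) t
      rw [h1, integral_sub_left_eq_self (fun y => |φ y| ^ q) volume x]
      simp [abs_of_pos ht0]
    have hN : 0 ≤ ∫ y, |φ y| ^ q := integral_nonneg fun y => by positivity
    have hle : ∫ b in Metric.closedBall b₀ ε, |φ (x - t • b)| ^ q ≤
        (t ^ 3)⁻¹ * ∫ y, |φ y| ^ q := by
      rw [← hscale]
      refine setIntegral_le_integral ?_ (Eventually.of_forall fun b => by positivity)
      refine Continuous.integrable_of_hasCompactSupport ?_ ?_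
      · exact hcont.rpow_const fun _ => Or.inr hq0.le
      · have h2 : HasCompactSupport fun y => |φ y| ^ q :=
          hc.comp_left (g := fun r => |r| ^ q) (by simp [hq0.ne'])
        exact h2.comp_homeomorph ((Homeomorph.smulOfNeZero t ht0.ne').trans (Homeomorph.subLeft x))
    rw [mul_assoc]
    refine mul_le_mul_of_nonneg_left ?_ (by positivity)
    refine (Real.rpow_le_rpow (integral_nonneg fun b => by positivity) hle (by positivity)).trans_eq
      ?_
    rw [Real.mul_rpow (by positivity) hN, mul_comm]
    congr 1
    rw [← Real.rpow_natCast, ← Real.rpow_neg ht0.le, ← Real.rpow_mul ht0.le]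
    congr 1
    push_cast
    ring

theorem norm_coneField_le (hφ : Continuous φ) (hc : HasCompactSupport φ) (x : E3) :
    ‖coneField b₀ ε φ x‖ ≤ 3 * (‖b₀‖ + |ε|) * coneAverage b₀ ε (fun y => |φ y|) x := by
  have hca : HasCompactSupport fun y => |φ y| := hc.comp_left abs_zero
  have hcoord : ∀ i : Fin 3, ‖coneField b₀ ε φ x i‖ ≤
      (‖b₀‖ + |ε|) * coneAverage b₀ ε (fun y => |φ y|) x := fun i => by
    rw [coneAverage, ← integral_const_mul]
    refine norm_integral_le_of_norm_le ((integrable_comp_coneMap hφ.abs hca x).const_mul _) ?_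
    filter_upwards [ae_mem_coneMeasure b₀ ε] with q hq
    rw [norm_smul, norm_mul, Real.norm_eq_abs, Real.norm_eq_abs, Real.norm_eq_abs]
    refine mul_le_mul_of_nonneg_right ?_ (abs_nonneg _)
    have h1 : |1 - q.2| ≤ 1 := by
      rw [abs_le]; constructor <;> linarith [hq.2.1, hq.2.2]
    have h2 := abs_coord_le b₀ hq.1 i
    nlinarith [abs_nonneg (q.1 i), abs_nonneg (1 - q.2), le_abs_self ε]
  have h1 : ‖coneField b₀ ε φ x‖ ≤ ∑ i : Fin 3, ‖coneField b₀ ε φ x i‖ := by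
    have h : coneField b₀ ε φ x =
        ∑ i : Fin 3, coneField b₀ ε φ x i • EuclideanSpace.single i (1 : ℝ) := by
      ext j
      simp [Finset.sum_apply, Pi.single_apply]
    conv_lhs => rw [h]
    refine (norm_sum_le _ _).trans (Finset.sum_le_sum fun i _ => ?_)
    simp [norm_smul]
  refine h1.trans ((Finset.sum_le_sum fun i _ => hcoord i).trans_eq ?_)
  simp
  ring

theorem support_coneField_subset : Function.support (coneField b₀ ε φ) ⊆
    (fun q : E3 × E3 × ℝ => q.1 + q.2.2 • q.2.1) ''
      (tsupport φ ×ˢ Metric.closedBall b₀ ε ×ˢ Set.Icc (0 : ℝ) 1) := by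
  intro x hx
  by_contra hne
  refine hx ?_
  have h : ∀ i : Fin 3, coneField b₀ ε φ x i = 0 := fun i => by
    refine integral_eq_zero_of_ae ?_
    filter_upwards [ae_mem_coneMeasure b₀ ε] with q hq
    have : φ (x - q.2 • q.1) = 0 := by
      by_contra h0
      exact hne ⟨(x - q.2 • q.1, q.1, q.2), ⟨subset_tsupport _ h0, hq.1, hq.2.1.le, hq.2.2⟩,
        by simp⟩
    simp [this]
  ext i
  simpa using h i

theorem isCompact_coneImage (hc : HasCompactSupport φ) :
    IsCompact ((fun q : E3 × E3 × ℝ => q.1 + q.2.2 • q.2.1) ''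
      (tsupport φ ×ˢ Metric.closedBall b₀ ε ×ˢ Set.Icc (0 : ℝ) 1)) :=
  (hc.isCompact.prod ((isCompact_closedBall b₀ ε).prod isCompact_Icc)).image (by fun_prop)

theorem hasCompactSupport_coneField (hc : HasCompactSupport φ) :
    HasCompactSupport (coneField b₀ ε φ) :=
  HasCompactSupport.of_support_subset_isCompact (isCompact_coneImage hc) support_coneField_subset

theorem tsupport_coneField_subset {U Ω : Set E3} (hc : HasCompactSupport φ) (hU : tsupport φ ⊆ U)
    (h : ∀ y ∈ U, ∀ b ∈ Metric.closedBall b₀ ε, ∀ t ∈ Set.Icc (0 : ℝ) 1, y + t • b ∈ Ω) :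
    tsupport (coneField b₀ ε φ) ⊆ Ω := by
  refine (closure_minimal support_coneField_subset (isCompact_coneImage hc).isClosed).trans ?_
  rintro _ ⟨⟨y, b, t⟩, ⟨hy, hb, ht⟩, rfl⟩
  exact h y (hU hy) b hb t ht

end TestFields

/-! ### Norms in `L^p` by duality -/

section Duality

/-- On an open set of finite measure, `L^q` functions, `q < ∞`, are limits in `L^q` of smooth
functions with compact support inside the set. -/
theorem exists_contDiff_tsupport_subset_eLpNorm_sub_le {U : Set E3} (hU : IsOpen U)
    (hUfin : volume U ≠ ∞) {q : ℝ≥0∞} (hq : 1 ≤ q) (hq' : q ≠ ∞) {f : E3 → ℝ}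
    (hf : MemLp f q (volume.restrict U)) {ε : ℝ} (hε : 0 < ε) :
    ∃ φ : E3 → ℝ, ContDiff ℝ ((⊤ : ℕ∞) : WithTop ℕ∞) φ ∧ HasCompactSupport φ ∧ tsupport φ ⊆ U ∧
      eLpNorm (f - φ) q (volume.restrict U) ≤ ENNReal.ofReal ε := by
  obtain ⟨g, hgc, hgs, hfg⟩ := hf.exist_eLpNorm_sub_le hq' hq (half_pos hε)
  have hg : MemLp g q (volume.restrict U) := hgs.continuous.memLp_of_hasCompactSupport hgc
  obtain ⟨δ, hδ, hδg⟩ := hg.eLpNorm_indicator_le hq hq' (half_pos hε)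
  obtain ⟨K, hKU, hK, hKδ⟩ := hU.measurableSet.exists_isCompact_sdiff_lt hUfin
    (ENNReal.ofReal_pos.2 hδ).ne'
  obtain ⟨K', hK', hKK', hK'U⟩ := exists_compact_between hK hU hKU
  obtain ⟨η, hη, hη01, hηs, hη1⟩ := exists_contMDiff_support_eq_eq_one_iff (n := ⊤)
    (modelWithCornersSelf ℝ E3) isOpen_interior hK.isClosed hKK'
  have hηts : tsupport η ⊆ K' := by
    rw [tsupport, hηs]
    exact closure_minimal interior_subset hK'.isClosed
  have hηg : tsupport (fun x => η x * g x) ⊆ K' :=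
    (tsupport_mul_subset_left (f := η) (g := g)).trans hηts
  refine ⟨fun x => η x * g x, hη.contDiff.mul hgs, ?_, hηg.trans hK'U, ?_⟩
  · exact HasCompactSupport.of_support_subset_isCompact hK' ((subset_tsupport _).trans hηg)
  · have hsplit : (f - fun x => η x * g x) = (f - g) + fun x => (1 - η x) * g x := by
      ext x; simp; ring
    have hmeas : AEStronglyMeasurable (fun x => (1 - η x) * g x) (volume.restrict U) :=
      ((continuous_const.sub hη.contDiff.continuous).mul hgs.continuous).aestronglyMeasurable
    rw [hsplit]
    refine (eLpNorm_add_le (hf.aestronglyMeasurable.sub hg.aestronglyMeasurable) hmeas hq).trans ?_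
    rw [← add_halves ε, ENNReal.ofReal_add (half_pos hε).le (half_pos hε).le]
    refine add_le_add hfg (le_trans ?_ (hδg Kᶜ hK.measurableSet.compl ?_))
    · refine eLpNorm_mono fun x => ?_
      by_cases hx : x ∈ K
      · rw [(hη1 x).1 hx]; simp
      · rw [Set.indicator_of_mem (Set.mem_compl hx), norm_mul]
        have h01 := hη01 ⟨x, rfl⟩
        refine mul_le_of_le_one_left (norm_nonneg _) ?_
        rw [Real.norm_eq_abs, abs_le]
        constructor <;> linarith [h01.1, h01.2]
    · rw [Measure.restrict_apply hK.measurableSet.compl, Set.inter_comm, ← Set.sdiff_eq]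
      exact hKδ.le

theorem toReal_eLpNorm_eq_integral {X : Type*} [MeasurableSpace X] {μ : Measure X} {q : ℝ}
    (hq : 0 < q) {f : X → ℝ} (hf : MemLp f (ENNReal.ofReal q) μ) :
    (eLpNorm f (ENNReal.ofReal q) μ).toReal = (∫ x, |f x| ^ q ∂μ) ^ (1 / q) := by
  have h0 : ENNReal.ofReal q ≠ 0 := (ENNReal.ofReal_pos.2 hq).ne'
  rw [hf.eLpNorm_eq_integral_rpow_norm h0 ENNReal.ofReal_ne_top, ENNReal.toReal_ofReal hq.le,
    ENNReal.toReal_ofReal (Real.rpow_nonneg (integral_nonneg fun x => by positivity) _), one_div]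
  simp

theorem integral_mul_le_toReal_eLpNorm {X : Type*} [MeasurableSpace X] {μ : Measure X} {p q : ℝ}
    (hpq : p.HolderConjugate q) {f g : X → ℝ} (hf : MemLp f (ENNReal.ofReal p) μ)
    (hg : MemLp g (ENNReal.ofReal q) μ) :
    ∫ x, f x * g x ∂μ ≤
      (eLpNorm f (ENNReal.ofReal p) μ).toReal * (eLpNorm g (ENNReal.ofReal q) μ).toReal := by
  rw [toReal_eLpNorm_eq_integral hpq.pos hf, toReal_eLpNorm_eq_integral hpq.symm.pos hg]
  have h := integral_mul_le_Lp_mul_Lq_of_nonneg hpq (Eventually.of_forall fun x => abs_nonneg (f x))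
    (Eventually.of_forall fun x => abs_nonneg (g x)) hf.abs hg.abs
  refine (le_trans ?_ h)
  have hle : ∀ x, f x * g x ≤ |f x| * |g x| := fun x => by
    rw [← abs_mul]; exact le_abs_self _
  by_cases hi : Integrable (fun x => f x * g x) μ
  · refine integral_mono hi ?_ hle
    simpa [abs_mul] using hi.abs
  · rw [integral_undef hi]
    exact integral_nonneg fun x => by positivity

/-- The `L^p` norm of a non-negative function is controlled by testing against smooth functions
with compact support, normalised in the dual `L^q` norm. -/
theorem integral_rpow_le_of_forall_contDiff {U : Set E3} (hU : IsOpen U) (hUfin : volume U ≠ ∞)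
    {p q : ℝ} (hpq : p.HolderConjugate q) {u : E3 → ℝ}
    (hu : MemLp u (ENNReal.ofReal p) (volume.restrict U)) (hu0 : 0 ≤ᵐ[volume.restrict U] u) {M : ℝ}
    (hM0 : 0 ≤ M)
    (hM : ∀ φ : E3 → ℝ, ContDiff ℝ ((⊤ : ℕ∞) : WithTop ℕ∞) φ → HasCompactSupport φ →
      tsupport φ ⊆ U → ∫ x in U, u x * φ x ≤ M * (∫ x, |φ x| ^ q) ^ (1 / q)) :
    ∫ x in U, u x ^ p ≤ M ^ p := by
  set μ : Measure E3 := volume.restrict U with hμ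
  have hp := hpq.lt
  have hq0 := hpq.symm.pos
  have hp1 : 0 < p - 1 := by linarith
  set f : E3 → ℝ := fun x => ‖u x‖ ^ (p - 1) with hf
  have hqe : ENNReal.ofReal p / ENNReal.ofReal (p - 1) = ENNReal.ofReal q := by
    rw [← ENNReal.ofReal_div_of_pos hp1, hpq.conjugate_eq]
  have hfmem : MemLp f (ENNReal.ofReal q) μ := by
    have := hu.norm_rpow_div (ENNReal.ofReal (p - 1))
    rwa [hqe, ENNReal.toReal_ofReal hp1.le] at this
  set I := ∫ x, u x ^ p ∂μ with hI
  have hI0 : 0 ≤ I := integral_nonneg_of_ae (hu0.mono fun x hx => Real.rpow_nonneg hx _)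
  have hfN : (eLpNorm f (ENNReal.ofReal q) μ).toReal = I ^ (1 / q) := by
    rw [toReal_eLpNorm_eq_integral hq0 hfmem]
    congr 1
    refine integral_congr_ae (hu0.mono fun x hx => ?_)
    simp only [Pi.zero_apply] at hx
    simp only [hf, Real.norm_of_nonneg hx]
    rw [abs_of_nonneg (by positivity), ← Real.rpow_mul hx, hpq.sub_one_mul_conj]
  have huf : ∫ x, u x * f x ∂μ = I := by
    refine integral_congr_ae (hu0.mono fun x hx => ?_)
    simp only [Pi.zero_apply] at hx
    simp only [hf, Real.norm_of_nonneg hx]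
    rcases hx.eq_or_lt with h | h
    · rw [← h, Real.zero_rpow hpq.ne_zero, zero_mul]
    · rw [← Real.rpow_one_add' h.le (by linarith)]
      congr 1; ring
  have hint : ∀ {g : E3 → ℝ}, MemLp g (ENNReal.ofReal q) μ → Integrable (fun x => u x * g x) μ :=
    fun hg => haveI := hpq.ennrealOfReal; hu.integrable_mul hg
  have hq1 : 1 ≤ ENNReal.ofReal q := by
    rw [← ENNReal.ofReal_one]; exact ENNReal.ofReal_le_ofReal hpq.symm.lt.le
  have key : ∀ ε : ℝ, 0 < ε →
      I ≤ M * I ^ (1 / q) + ε * (M + (eLpNorm u (ENNReal.ofReal p) μ).toReal) := by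
    intro ε hε
    obtain ⟨φ, hφ, hφc, hφU, hφε⟩ := exists_contDiff_tsupport_subset_eLpNorm_sub_le hU hUfin
      hq1 ENNReal.ofReal_ne_top hfmem hε
    have hφm : MemLp φ (ENNReal.ofReal q) μ := hφ.continuous.memLp_of_hasCompactSupport hφc
    have h1 : (∫ x, |φ x| ^ q) = ∫ x, |φ x| ^ q ∂μ := by
      rw [hμ, setIntegral_eq_integral_of_forall_compl_eq_zero]
      intro x hx
      have : φ x = 0 := by
        by_contra h
        exact hx (hφU (subset_tsupport _ h))
      rw [this, abs_zero, Real.zero_rpow hq0.ne']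
    have h2 := hM φ hφ hφc hφU
    rw [h1, ← toReal_eLpNorm_eq_integral hq0 hφm] at h2
    have hε' : (eLpNorm (f - φ) (ENNReal.ofReal q) μ).toReal ≤ ε :=
      ENNReal.toReal_le_of_le_ofReal hε.le hφε
    have h3 : (eLpNorm φ (ENNReal.ofReal q) μ).toReal ≤ I ^ (1 / q) + ε := by
      have h4 : eLpNorm φ (ENNReal.ofReal q) μ ≤
          eLpNorm f (ENNReal.ofReal q) μ + eLpNorm (f - φ) (ENNReal.ofReal q) μ := by
        have h5 : φ = f - (f - φ) := by simp
        conv_lhs => rw [h5]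
        exact eLpNorm_sub_le hfmem.1 (hfmem.sub hφm).1 hq1
      have h6 := ENNReal.toReal_mono (ENNReal.add_ne_top.2 ⟨hfmem.eLpNorm_ne_top,
        (hfmem.sub hφm).eLpNorm_ne_top⟩) h4
      rw [ENNReal.toReal_add hfmem.eLpNorm_ne_top (hfmem.sub hφm).eLpNorm_ne_top, hfN] at h6
      linarith
    have h7 := integral_mul_le_toReal_eLpNorm hpq hu (hfmem.sub hφm)
    have h8 : I = ∫ x, u x * φ x ∂μ + ∫ x, u x * (f - φ) x ∂μ := by
      rw [← huf, ← integral_add (hint hφm) (hint (hfmem.sub hφm))]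
      refine integral_congr_ae (Eventually.of_forall fun x => ?_)
      simp only [Pi.sub_apply]; ring
    have h9 := mul_le_mul_of_nonneg_left h3 hM0
    have h10 := mul_le_mul_of_nonneg_left hε'
      (ENNReal.toReal_nonneg : 0 ≤ (eLpNorm u (ENNReal.ofReal p) μ).toReal)
    linarith
  have hlim : I ≤ M * I ^ (1 / q) := by
    set B := M + (eLpNorm u (ENNReal.ofReal p) μ).toReal with hB
    have hB0 : 0 ≤ B := add_nonneg hM0 ENNReal.toReal_nonneg
    refine le_of_forall_pos_le_add fun ε hε => (key (ε / (B + 1)) (by positivity)).trans ?_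
    have : ε / (B + 1) * B ≤ ε := by
      rw [div_mul_eq_mul_div, div_le_iff₀ (by positivity)]
      nlinarith
    linarith
  rcases hI0.eq_or_lt with h0 | h0
  · rw [← h0]; positivity
  · have h1 : I = I ^ (1 / p) * I ^ (1 / q) := by
      rw [← Real.rpow_add h0, one_div, one_div, hpq.inv_add_inv_eq_one, Real.rpow_one]
    have h2 : I ^ (1 / p) ≤ M := by
      have h3 : 0 < I ^ (1 / q) := by positivity
      refine le_of_mul_le_mul_right ?_ h3
      rw [← h1]
      exact hlim
    calc I = (I ^ (1 / p)) ^ p := by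
          rw [← Real.rpow_mul hI0, one_div_mul_cancel hpq.ne_zero, Real.rpow_one]
      _ ≤ M ^ p := Real.rpow_le_rpow (by positivity) h2 hpq.nonneg

end Duality

/-! ### The local `L^p` estimate by the total variation -/

section TotalVariation

variable {Ω : Set E3} {p : ℝ≥0∞}

theorem divergence_const_smul {ξ : E3 → E3} (hξ : Differentiable ℝ ξ) (c : ℝ) (x : E3) :
    divergence (fun y => c • ξ y) x = c * divergence ξ x := by
  simp only [divergence, Finset.mul_sum]
  refine Finset.sum_congr rfl fun i _ => ?_
  rw [show (fun y => c • ξ y) = c • ξ from rfl, fderiv_const_smul (hξ x)]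
  simp

theorem integral_mul_divergence_le {u : Lp ℝ p (volOn Ω)} (hu : totalVariation u ≠ ∞)
    {ξ : E3 → E3} (hξ : ContDiff ℝ ((⊤ : ℕ∞) : WithTop ℕ∞) ξ) (hc : HasCompactSupport ξ)
    (hΩ : tsupport ξ ⊆ Ω) {K : ℝ} (hK : ∀ x, ‖ξ x‖ ≤ K) :
    ∫ x, u x * divergence ξ x ∂(volOn Ω) ≤ K * (totalVariation u).toReal := by
  have hK0 : 0 ≤ K := (norm_nonneg _).trans (hK 0)
  rcases hK0.eq_or_lt with rfl | hK0
  · have : ξ = fun _ => 0 := funext fun x => norm_le_zero_iff.1 (hK x)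
    simp [this, divergence]
  · have hsub : Function.support (fun y => K⁻¹ • ξ y) ⊆ Function.support ξ := fun x hx h0 =>
      hx (by simp [h0])
    have hts : tsupport (fun y => K⁻¹ • ξ y) ⊆ tsupport ξ := closure_mono hsub
    have h := le_iSup_of_le (f := fun ξ : E3 → E3 =>
      ⨆ (_ : ContDiff ℝ ((⊤ : ℕ∞) : WithTop ℕ∞) ξ) (_ : HasCompactSupport ξ) (_ : tsupport ξ ⊆ Ω)
      (_ : ∀ x, ‖ξ x‖ ≤ 1), ENNReal.ofReal (∫ x, u x * divergence ξ x ∂(volOn Ω)))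
      (fun y => K⁻¹ • ξ y) (le_iSup_of_le (hξ.const_smul K⁻¹) (le_iSup_of_le
        (HasCompactSupport.of_support_subset_isCompact hc (hsub.trans (subset_tsupport _)))
        (le_iSup_of_le (hts.trans hΩ) (le_iSup_of_le (fun x => by
          rw [norm_smul, Real.norm_of_nonneg (by positivity), inv_mul_le_iff₀ hK0, mul_one]
          exact hK x) le_rfl))))
    have h2 := (ENNReal.ofReal_le_iff_le_toReal hu).1 h
    simp only [divergence_const_smul (hξ.differentiable (by simp))] at h2
    simp only [mul_left_comm _ K⁻¹, integral_const_mul] at h2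
    rwa [inv_mul_le_iff₀ hK0] at h2

/-- The local estimate of `BV` functions in `L^p`, `p < 3 / 2`, on a set `U` such that the segments
issuing from `U` in the directions of a ball stay in `Ω`: tested against `φ`, it follows from
the total variation tested against `coneField φ`. -/
theorem exists_integral_rpow_le_of_cone [Fact (1 ≤ p)] (hΩ : IsBoundedLipschitzDomain Ω)
    (hp : 1 < p) (hp' : p < 3 / 2) {U : Set E3} (hU : IsOpen U) {b₀ : E3} {ε : ℝ} (hε : 0 < ε)
    (hUΩ : ∀ y ∈ U, ∀ b ∈ Metric.closedBall b₀ ε, ∀ t ∈ Set.Icc (0 : ℝ) 1, y + t • b ∈ Ω) :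
    ∃ M, 0 ≤ M ∧ ∀ u : Lp ℝ p (volOn Ω), 0 ≤ u → totalVariation u ≠ ∞ →
      ∫ x in U, u x ^ p.toReal ≤
        (M * ((totalVariation u).toReal + ∫ x, ‖u x‖ ∂(volOn Ω))) ^ p.toReal := by
  have hpt : p ≠ ∞ := (hp'.trans_le le_top).ne
  have hr1 : 1 < p.toReal := by
    simpa using (ENNReal.toReal_lt_toReal ENNReal.one_ne_top hpt).2 hp
  have hr2 : p.toReal < 3 / 2 := by
    have := (ENNReal.toReal_lt_toReal hpt (by finiteness)).2 hp'
    simpa using this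
  set r := p.toReal with hr
  have hpr : p = ENNReal.ofReal r := (ENNReal.ofReal_toReal hpt).symm
  have hpq : r.HolderConjugate r.conjExponent := Real.HolderConjugate.conjExponent hr1
  set q := r.conjExponent with hq
  have hq3 : 3 < q := by
    rw [hq, Real.conjExponent, lt_div_iff₀ (by linarith)]
    linarith
  have hb₀ : b₀ ∈ Metric.closedBall b₀ ε := Metric.mem_closedBall_self hε.le
  have hUsub : U ⊆ Ω := fun y hy => by
    simpa using hUΩ y hy b₀ hb₀ 0 (by simp)
  have hUfin : volume U ≠ ∞ :=
    ((measure_mono hUsub).trans_lt hΩ.isBounded.measure_lt_top).ne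
  set V := volume.real (Metric.closedBall b₀ ε) with hV
  have hV0 : 0 < V := by
    refine ENNReal.toReal_pos ?_ measure_closedBall_lt_top.ne
    exact (Metric.measure_closedBall_pos volume b₀ hε).ne'
  set A := V ^ (1 / r) * ∫ t in Set.Ioc (0 : ℝ) 1, t ^ (-(3 / q)) with hA
  have hA0 : 0 ≤ A := mul_nonneg (by positivity)
    (setIntegral_nonneg measurableSet_Ioc fun t ht => Real.rpow_nonneg ht.1.le _)
  set B := 3 * (‖b₀‖ + |ε|) with hB
  have hB0 : 0 ≤ B := by positivity
  refine ⟨V⁻¹ * (A * (B + 1)), by positivity, fun u hu hTV => ?_⟩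
  have hres : (volOn Ω).restrict U = volume.restrict U :=
    Measure.restrict_restrict_of_subset hUsub
  have hui := integrable_of_Lp hΩ u
  have hu0 : 0 ≤ᵐ[volume.restrict U] u :=
    ae_mono (Measure.restrict_mono hUsub le_rfl) ((Lp.coeFn_nonneg u).2 hu)
  have hint0 : 0 ≤ ∫ x, ‖u x‖ ∂(volOn Ω) := integral_nonneg fun x => norm_nonneg _
  set T := (totalVariation u).toReal with hT
  have hT0 : 0 ≤ T := ENNReal.toReal_nonneg
  refine integral_rpow_le_of_forall_contDiff hU hUfin hpq ?_ hu0 (by positivity)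
    fun φ hφ hc hφU => ?_
  · rw [← hpr]
    exact (Lp.memLp u).mono_measure (Measure.restrict_mono hUsub le_rfl)
  set N := (∫ x, |φ x| ^ q) ^ (1 / q) with hN
  have hN0 : 0 ≤ N := Real.rpow_nonneg (integral_nonneg fun x => by positivity) _
  have havg : ∀ x, coneAverage b₀ ε (fun y => |φ y|) x ≤ A * N := fun x =>
    coneAverage_abs_le hpq hq3 hφ.continuous hc x
  have hfield : ∀ x, ‖coneField b₀ ε φ x‖ ≤ B * (A * N) := fun x =>
    (norm_coneField_le hφ.continuous hc x).trans (mul_le_mul_of_nonneg_left (havg x) hB0)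
  have h1 := integral_mul_divergence_le hTV (contDiff_coneField hφ hc)
    (hasCompactSupport_coneField hc) (tsupport_coneField_subset hc hφU hUΩ) hfield
  have hφU' : ∫ x in U, u x * φ x = ∫ x, u x * φ x ∂(volOn Ω) := by
    rw [← hres, setIntegral_eq_integral_of_forall_compl_eq_zero]
    intro x hx
    have : φ x = 0 := by
      by_contra h
      exact hx (hφU (subset_tsupport _ h))
    rw [this, mul_zero]
  obtain ⟨C, hC⟩ := hc.exists_bound_of_continuous hφ.continuous
  have hφi : Integrable (fun x => u x * φ x) (volOn Ω) :=
    hui.mul_bdd (c := C) hφ.continuous.aestronglyMeasurable (Eventually.of_forall hC)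
  have hca : ∀ x, ‖coneAverage b₀ ε φ x‖ ≤ A * N := fun x =>
    (norm_integral_le_integral_norm _).trans (havg x)
  have hcm : Continuous (coneAverage b₀ ε φ) := by
    have := contDiff_integral_comp_sub (ν := coneMeasure b₀ ε) (integrable_const (1 : ℝ))
      measurable_coneMap.aemeasurable hφ hc
    simp only [one_smul] at this
    exact this.continuous
  have hci : Integrable (fun x => u x * coneAverage b₀ ε φ x) (volOn Ω) :=
    hui.mul_bdd (c := A * N) hcm.aestronglyMeasurable (Eventually.of_forall hca)
  have h2 : ∫ x, u x * coneAverage b₀ ε φ x ∂(volOn Ω) ≤ A * N * ∫ x, ‖u x‖ ∂(volOn Ω) := by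
    rw [← integral_const_mul]
    refine integral_mono hci (hui.norm.const_mul _) fun x => ?_
    refine (le_abs_self _).trans ?_
    rw [abs_mul, mul_comm]
    exact mul_le_mul_of_nonneg_right (hca x) (abs_nonneg _)
  have h3 : ∫ x, u x * divergence (coneField b₀ ε φ) x ∂(volOn Ω) =
      V * ∫ x, u x * φ x ∂(volOn Ω) - ∫ x, u x * coneAverage b₀ ε φ x ∂(volOn Ω) := by
    rw [← integral_const_mul, ← integral_sub (hφi.const_mul V) hci]
    refine integral_congr_ae (Eventually.of_forall fun x => ?_)
    simp only [divergence_coneField hφ hc x]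
    ring
  rw [h3] at h1
  rw [hφU', mul_assoc, mul_assoc, le_inv_mul_iff₀ hV0]
  have h4 : 0 ≤ A * N := by positivity
  have h5 := mul_nonneg (mul_nonneg h4 hB0) hint0
  have h6 := mul_nonneg h4 hT0
  nlinarith

end TotalVariation

/-! ### The interior cone property and the global `L^p` estimate -/

section Coercivity

variable {Ω : Set E3} {p : ℝ≥0∞}

/-- The uniform interior cone condition of Lipschitz domains, in the form needed for cone fields:
near each point of the closure, a common ball of directions leads from `Ω` into `Ω`. -/
theorem IsBoundedLipschitzDomain.exists_cone (hΩ : IsBoundedLipschitzDomain Ω) {x₀ : E3}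
    (hx₀ : x₀ ∈ closure Ω) : ∃ r > 0, ∃ (b₀ : E3) (ε : ℝ), 0 < ε ∧
      ∀ y ∈ Ω ∩ Metric.ball x₀ r, ∀ b ∈ Metric.closedBall b₀ ε, ∀ t ∈ Set.Icc (0 : ℝ) 1,
        y + t • b ∈ Ω := by
  by_cases hx : x₀ ∈ Ω
  · obtain ⟨R, hR, hball⟩ := Metric.isOpen_iff.1 hΩ.isOpen x₀ hx
    refine ⟨R / 2, by positivity, 0, R / 2, by positivity, fun y hy b hb t ht => hball ?_⟩
    have h1 : ‖y - x₀‖ < R / 2 := mem_ball_iff_norm.1 hy.2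
    have h2 : ‖b‖ ≤ R / 2 := mem_closedBall_zero_iff.1 hb
    have h3 : ‖t • b‖ ≤ ‖b‖ := by
      rw [norm_smul, Real.norm_of_nonneg ht.1]
      exact mul_le_of_le_one_left (norm_nonneg _) ht.2
    rw [mem_ball_iff_norm, add_sub_right_comm]
    exact (norm_add_le _ _).trans_lt (by linarith)
  · have hfr : x₀ ∈ frontier Ω := by
      rw [frontier, hΩ.isOpen.interior_eq]; exact ⟨hx₀, hx⟩
    obtain ⟨e, φ, κ, hφ, hev⟩ := hΩ.lipschitz_boundary x₀ hfr
    obtain ⟨R, hR, hball⟩ := Metric.eventually_nhds_iff_ball.1 hev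
    have hκ : (0 : ℝ) ≤ κ := κ.2
    set ε : ℝ := R / (4 * (2 + 2 * κ)) with hε
    have hε0 : 0 < ε := by positivity
    -- the directions point downwards, steeper than the graph of `φ`
    set h : ℝ := ε * (1 + 2 * κ) with hh
    have hh0 : 0 ≤ h := by positivity
    set b₀ : E3 := e.symm (EuclideanSpace.single 2 (-h)) with hb₀
    refine ⟨R / 2, by positivity, b₀, ε, hε0, fun y hy b hb t ht => ?_⟩
    have hy1 : ‖y - x₀‖ < R / 2 := mem_ball_iff_norm.1 hy.2
    have hb1 : ‖b - b₀‖ ≤ ε := mem_closedBall_iff_norm.1 hb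
    have hb0n : ‖b₀‖ = h := by
      rw [hb₀, LinearIsometryEquiv.norm_map, PiLp.norm_single, norm_neg,
        Real.norm_of_nonneg hh0]
    have hbn : ‖b‖ ≤ R / 4 := by
      have h1 := norm_le_norm_add_norm_sub' b b₀
      have h2 : h + ε = R / 4 := by
        rw [hh, hε]; field_simp; ring
      linarith
    have htb : ‖t • b‖ ≤ ‖b‖ := by
      rw [norm_smul, Real.norm_of_nonneg ht.1]
      exact mul_le_of_le_one_left (norm_nonneg _) ht.2
    have hyball : y ∈ Metric.ball x₀ R := mem_ball_iff_norm.2 (by linarith)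
    have hzball : y + t • b ∈ Metric.ball x₀ R := by
      rw [mem_ball_iff_norm, add_sub_right_comm]
      exact (norm_add_le _ _).trans_lt (by linarith)
    have hyφ := (hball y hyball).1 hy.1
    refine (hball _ hzball).2 ?_
    have hcoord : ∀ i, |(e b - EuclideanSpace.single 2 (-h) : E3) i| ≤ ε := fun i => by
      have h1 : e b - EuclideanSpace.single 2 (-h) = e (b - b₀) := by
        rw [map_sub, hb₀, LinearIsometryEquiv.apply_symm_apply]
      rw [h1, ← Real.norm_eq_abs]
      exact (PiLp.norm_apply_le _ i).trans ((e.norm_map _).le.trans hb1)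
    have hc0 : |e b 0| ≤ ε := by simpa using hcoord 0
    have hc1 : |e b 1| ≤ ε := by simpa using hcoord 1
    have hc2 : e b 2 ≤ -h + ε := by
      have := (abs_le.1 (hcoord 2)).2
      simp at this
      linarith
    simp only [map_add, map_smul, PiLp.add_apply, PiLp.smul_apply, smul_eq_mul]
    have hlip := hφ.dist_le_mul !₂[e y 0, e y 1] !₂[e y 0 + t * e b 0, e y 1 + t * e b 1]
    have hdist : dist (!₂[e y 0, e y 1] : EuclideanSpace ℝ (Fin 2))
        !₂[e y 0 + t * e b 0, e y 1 + t * e b 1] ≤ t * (2 * ε) := by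
      rw [EuclideanSpace.dist_eq]
      refine Real.sqrt_le_iff.2 ⟨by have := ht.1; positivity, ?_⟩
      simp only [Fin.sum_univ_two, Matrix.cons_val_zero, Matrix.cons_val_one, Real.dist_eq,
        sub_add_cancel_left, sq_abs, neg_sq]
      have h1 := sq_le_sq' (abs_le.1 hc0).1 (abs_le.1 hc0).2
      have h2 := sq_le_sq' (abs_le.1 hc1).1 (abs_le.1 hc1).2
      nlinarith [sq_nonneg t, sq_nonneg ε]
    rw [Real.dist_eq] at hlip
    have h3 := (abs_le.1 hlip).2
    have h4 := mul_le_mul_of_nonneg_left hdist hκ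
    have h5 := mul_le_mul_of_nonneg_left hc2 ht.1
    have h6 : t * (-h + ε) + κ * (t * (2 * ε)) = 0 := by rw [hh]; ring
    linarith

/-- Non-negative `BV` functions on a bounded Lipschitz domain of `ℝ³` are controlled in `L^p`,
`1 < p < 3 / 2`, by their total variation and their `L¹` norm. -/
theorem exists_norm_le_totalVariation_add [Fact (1 ≤ p)] (hΩ : IsBoundedLipschitzDomain Ω)
    (hp : 1 < p) (hp' : p < 3 / 2) :
    ∃ C, 0 ≤ C ∧ ∀ u : Lp ℝ p (volOn Ω), 0 ≤ u → totalVariation u ≠ ∞ →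
      ‖u‖ ≤ C * ((totalVariation u).toReal + ∫ x, ‖u x‖ ∂(volOn Ω)) := by
  have hpt : p ≠ ∞ := (hp'.trans_le le_top).ne
  have hr1 : 1 < p.toReal := by
    simpa using (ENNReal.toReal_lt_toReal ENNReal.one_ne_top hpt).2 hp
  set r := p.toReal with hr
  have hr0 : 0 < r := by linarith
  have hpr : p = ENNReal.ofReal r := (ENNReal.ofReal_toReal hpt).symm
  have hloc : ∀ x ∈ closure Ω, ∃ ρ > 0, ∃ M, 0 ≤ M ∧ ∀ u : Lp ℝ p (volOn Ω), 0 ≤ u →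
      totalVariation u ≠ ∞ → ∫ x in Ω ∩ Metric.ball x ρ, u x ^ r ≤
        (M * ((totalVariation u).toReal + ∫ x, ‖u x‖ ∂(volOn Ω))) ^ r := fun x hx => by
    obtain ⟨ρ, hρ, b₀, ε, hε, hcone⟩ := hΩ.exists_cone hx
    exact ⟨ρ, hρ, exists_integral_rpow_le_of_cone hΩ hp hp'
      (hΩ.isOpen.inter Metric.isOpen_ball) hε hcone⟩
  choose! ρ hρ M hM0 hM using hloc
  obtain ⟨s, hs, hcover⟩ := hΩ.isBounded.isCompact_closure.elim_nhds_subcover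
    (fun x => Metric.ball x (ρ x)) fun x hx => Metric.ball_mem_nhds x (hρ x hx)
  refine ⟨(∑ x ∈ s, M x ^ r) ^ (1 / r), Real.rpow_nonneg (Finset.sum_nonneg fun x hx =>
    Real.rpow_nonneg (hM0 x (hs x hx)) _) _, fun u hu hTV => ?_⟩
  set S := (totalVariation u).toReal + ∫ x, ‖u x‖ ∂(volOn Ω) with hS
  have hS0 : 0 ≤ S := add_nonneg ENNReal.toReal_nonneg (integral_nonneg fun x => norm_nonneg _)
  have hsum0 : 0 ≤ ∑ x ∈ s, M x ^ r :=
    Finset.sum_nonneg fun x hx => Real.rpow_nonneg (hM0 x (hs x hx)) _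
  have hu0 := (Lp.coeFn_nonneg u).2 hu
  have huL : MemLp u (ENNReal.ofReal r) (volOn Ω) := hpr ▸ Lp.memLp u
  have hui : Integrable (fun x => u x ^ r) (volOn Ω) := by
    have := huL.integrable_norm_rpow (ENNReal.ofReal_pos.2 hr0).ne' ENNReal.ofReal_ne_top
    rw [ENNReal.toReal_ofReal hr0.le] at this
    refine this.congr (hu0.mono fun x hx => ?_)
    simp only [Pi.zero_apply] at hx
    simp only [Real.norm_of_nonneg hx]
  have hmeas : ∀ x, MeasurableSet (Metric.ball x (ρ x)) := fun x => measurableSet_ball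
  have hle : ∫ x, u x ^ r ∂(volOn Ω) ≤ (∑ x ∈ s, M x ^ r) * S ^ r := by
    calc ∫ x, u x ^ r ∂(volOn Ω)
        ≤ ∫ y, ∑ x ∈ s, (Metric.ball x (ρ x)).indicator (fun y => u y ^ r) y ∂(volOn Ω) := by
          refine integral_mono_ae hui
            (integrable_finsetSum _ fun x _ => hui.indicator (hmeas x)) ?_
          filter_upwards [hu0, ae_restrict_mem hΩ.isOpen.measurableSet] with y hy hyΩ
          obtain ⟨x, hxs, hyx⟩ := Set.mem_iUnion₂.1 (hcover (subset_closure hyΩ))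
          have h1 : ∀ x ∈ s, 0 ≤ (Metric.ball x (ρ x)).indicator (fun y => u y ^ r) y :=
            fun x _ => Set.indicator_apply_nonneg fun _ => Real.rpow_nonneg hy _
          refine le_trans ?_ (Finset.single_le_sum h1 hxs)
          rw [Set.indicator_of_mem hyx]
      _ = ∑ x ∈ s, ∫ y in Ω ∩ Metric.ball x (ρ x), u y ^ r := by
          rw [integral_finsetSum _ fun x _ => hui.indicator (hmeas x)]
          refine Finset.sum_congr rfl fun x _ => ?_
          rw [integral_indicator (hmeas x), Measure.restrict_restrict (hmeas x), Set.inter_comm]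
      _ ≤ ∑ x ∈ s, M x ^ r * S ^ r := Finset.sum_le_sum fun x hx => by
          rw [← Real.mul_rpow (hM0 x (hs x hx)) hS0]
          exact hM x (hs x hx) u hu hTV
      _ = _ := (Finset.sum_mul _ _ _).symm
  have hnorm : ‖u‖ = (∫ x, u x ^ r ∂(volOn Ω)) ^ (1 / r) := by
    have h1 := toReal_eLpNorm_eq_integral hr0 huL
    rw [← hpr, ← Lp.norm_def] at h1
    rw [h1]
    congr 1
    refine integral_congr_ae (hu0.mono fun x hx => ?_)
    simp only [Pi.zero_apply] at hx
    simp only [abs_of_nonneg hx]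
  have hint0 : 0 ≤ ∫ x, u x ^ r ∂(volOn Ω) :=
    integral_nonneg_of_ae (hu0.mono fun x hx => Real.rpow_nonneg hx _)
  rw [hnorm]
  refine (Real.rpow_le_rpow hint0 hle (by positivity)).trans_eq ?_
  rw [Real.mul_rpow hsum0 (Real.rpow_nonneg hS0 _), ← Real.rpow_mul hS0,
    mul_one_div_cancel hr0.ne', Real.rpow_one]

end Coercivity

/-! ### Functions of zero total variation -/

section ZeroVariation

variable {Ω : Set E3} {p : ℝ≥0∞}

theorem integral_mul_divergence_eq_zero {u : Lp ℝ p (volOn Ω)} (hu : totalVariation u = 0)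
    {ξ : E3 → E3} (hξ : ContDiff ℝ ((⊤ : ℕ∞) : WithTop ℕ∞) ξ) (hc : HasCompactSupport ξ)
    (hΩ : tsupport ξ ⊆ Ω) : ∫ x, u x * divergence ξ x ∂(volOn Ω) = 0 := by
  have hu' : totalVariation u ≠ ∞ := by simp [hu]
  obtain ⟨K, hK⟩ := hc.exists_bound_of_continuous hξ.continuous
  have h1 := integral_mul_divergence_le hu' hξ hc hΩ hK
  have hsub : Function.support (fun y => (-1 : ℝ) • ξ y) ⊆ Function.support ξ := fun x hx h0 =>
    hx (by simp [h0])
  have h2 := integral_mul_divergence_le hu' (hξ.const_smul (-1 : ℝ))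
    (HasCompactSupport.of_support_subset_isCompact hc (hsub.trans (subset_tsupport _)))
    ((closure_mono hsub).trans hΩ) (K := K) fun x => by simpa using hK x
  simp only [divergence_const_smul (hξ.differentiable (by simp)), hu, neg_mul, one_mul, mul_neg,
    integral_neg, ENNReal.toReal_zero, mul_zero] at h1 h2
  linarith

/-- Mollifications of a function of zero total variation are constant on balls, because their
gradients are integrals of the function against divergences of test fields. -/
theorem exists_mollification_eq_const {u : Lp ℝ p (volOn Ω)} (hui : Integrable u (volOn Ω))
    (hu : totalVariation u = 0) {x₀ : E3} {r : ℝ} (hball : Metric.ball x₀ (2 * r) ⊆ Ω)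
    {ψ : E3 → ℝ} (hψ : ContDiff ℝ ((⊤ : ℕ∞) : WithTop ℕ∞) ψ) {ρ : ℝ} (hρ : ρ < r)
    (hψρ : tsupport ψ ⊆ Metric.closedBall 0 ρ) :
    ∃ c : ℝ, ∀ b ∈ Metric.ball x₀ r, ∫ x, u x • ψ (b - x) ∂(volOn Ω) = c := by
  have hψc : HasCompactSupport ψ := (isCompact_closedBall 0 ρ).of_isClosed_subset
    (isClosed_tsupport ψ) hψρ
  have hψ1 : ContDiff ℝ 1 ψ := hψ.of_le (by exact_mod_cast le_top)
  have hd := hasFDerivAt_integral_comp_sub (m := fun x : E3 => x) hui aemeasurable_id hψ1 hψc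
  refine Metric.isOpen_ball.exists_is_const_of_fderiv_eq_zero
    (convex_ball x₀ r).isPreconnected (𝕜 := ℝ)
    (fun b _ => (hd b).differentiableAt.differentiableWithinAt) fun b hb => ?_
  rw [(hd b).fderiv]
  ext v
  obtain ⟨C', hC'⟩ := (hψc.fderiv (𝕜 := ℝ)).exists_bound_of_continuous
    (hψ1.continuous_fderiv one_ne_zero)
  have hψ' : Continuous (fderiv ℝ ψ) := hψ1.continuous_fderiv one_ne_zero
  have hint : Integrable (fun x => u x • fderiv ℝ ψ (b - x)) (volOn Ω) :=
    hui.smul_bdd C' (f := fun x => fderiv ℝ ψ (b - x))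
      (Continuous.aestronglyMeasurable (by fun_prop)) (Eventually.of_forall fun x => hC' _)
  rw [ContinuousLinearMap.integral_apply hint]
  set ξ : E3 → E3 := fun x => ψ (b - x) • v with hξ
  have hξd : ContDiff ℝ ((⊤ : ℕ∞) : WithTop ℕ∞) ξ :=
    (hψ.comp (contDiff_const.sub contDiff_id)).smul contDiff_const
  have hξs : Function.support ξ ⊆ Metric.closedBall b ρ := fun x hx => by
    have h1 : ψ (b - x) ≠ 0 := fun h0 => hx (by simp [hξ, h0])
    have h2 := hψρ (subset_tsupport _ h1)
    rw [mem_closedBall_zero_iff] at h2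
    rw [mem_closedBall_iff_norm, norm_sub_rev]
    exact h2
  have hξt : tsupport ξ ⊆ Metric.closedBall b ρ :=
    closure_minimal hξs Metric.isClosed_closedBall
  have hbΩ : Metric.closedBall b ρ ⊆ Ω := fun x hx => hball <| by
    rw [mem_closedBall_iff_norm] at hx
    rw [mem_ball_iff_norm] at hb ⊢
    have := norm_sub_le_norm_sub_add_norm_sub x b x₀
    linarith
  have h0 := integral_mul_divergence_eq_zero hu hξd
    ((isCompact_closedBall b ρ).of_isClosed_subset (isClosed_tsupport ξ) hξt) (hξt.trans hbΩ)
  have hdiv : ∀ x, divergence ξ x = -(fderiv ℝ ψ (b - x) v) := fun x => by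
    have h1 : HasFDerivAt ξ ((-(fderiv ℝ ψ (b - x))).smulRight v) x := by
      have h2 : HasFDerivAt (fun y : E3 => b - y) (-ContinuousLinearMap.id ℝ E3) x :=
        (hasFDerivAt_id x).const_sub b
      have h3 := ((hψ1.differentiable one_ne_zero (b - x)).hasFDerivAt).comp x h2
      refine (h3.smul_const v).congr_fderiv ?_
      ext w
      simp
    simp only [divergence, h1.fderiv, ContinuousLinearMap.smulRight_apply,
      PiLp.smul_apply, smul_eq_mul]
    rw [← sum_apply_single (fderiv ℝ ψ (b - x)) v, ← Finset.sum_neg_distrib]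
    refine Finset.sum_congr rfl fun i _ => ?_
    simp [mul_comm]
  simp only [hdiv, mul_neg, integral_neg, neg_eq_zero] at h0
  simpa using h0

theorem exists_seq_contDiffBump {r : ℝ} (hr : 0 < r) :
    ∃ β : ℕ → ContDiffBump (0 : E3), Tendsto (fun n => (β n).rOut) atTop (𝓝 0) ∧
      (∀ n, (β n).rOut ≤ 2 * (β n).rIn) ∧ ∀ n, (β n).rOut < r := by
  have h0 : ∀ n : ℕ, 0 < r / (2 * ((n : ℝ) + 1)) := fun n => by positivity
  refine ⟨fun n => ⟨r / (2 * ((n : ℝ) + 1)) / 2, r / (2 * ((n : ℝ) + 1)), half_pos (h0 n),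
    half_lt_self (h0 n)⟩, ?_, fun n => ?_, fun n => ?_⟩
  · have h1 := (tendsto_one_div_add_atTop_nhds_zero_nat (𝕜 := ℝ)).const_mul (r / 2)
    rw [mul_zero] at h1
    refine h1.congr fun n => ?_
    simp only
    field_simp
  · simp only
    linarith
  · simp only
    rw [div_lt_iff₀ (by positivity)]
    nlinarith [(Nat.cast_nonneg n : (0 : ℝ) ≤ n)]

theorem exists_ae_eq_const_on_ball {u : Lp ℝ p (volOn Ω)} (hui : Integrable u (volOn Ω))
    (hΩ : MeasurableSet Ω) (hu : totalVariation u = 0) {x₀ : E3} {r : ℝ} (hr : 0 < r)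
    (hball : Metric.ball x₀ (2 * r) ⊆ Ω) :
    ∃ c : ℝ, ∀ᵐ x ∂(volume.restrict (Metric.ball x₀ r)), u x = c := by
  set g : E3 → ℝ := Ω.indicator u with hg
  have hgi : Integrable g volume := (integrable_indicator_iff hΩ).2 hui
  obtain ⟨β, hβ, hβ2, hβr⟩ := exists_seq_contDiffBump hr
  have hconv := ContDiffBump.ae_convolution_tendsto_right_of_locallyIntegrable (μ := volume) hβ
    (Eventually.of_forall hβ2) hgi.locallyIntegrable
  have hψc : ∀ n, ∃ c : ℝ, ∀ b ∈ Metric.ball x₀ r,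
      convolution ((β n).normed volume) g (ContinuousLinearMap.lsmul ℝ ℝ) volume b = c :=
    fun n => by
    obtain ⟨c, hc⟩ := exists_mollification_eq_const hui hu hball
      (ψ := (β n).normed volume) (β n).contDiff_normed (hβr n) (β n).tsupport_normed_eq.le
    refine ⟨c, fun b hb => ?_⟩
    rw [convolution_lsmul_swap, ← hc b hb, ← integral_indicator hΩ]
    refine integral_congr_ae (Eventually.of_forall fun x => ?_)
    by_cases hx : x ∈ Ω <;> simp [hg, hx, mul_comm]
  choose c hc using hψc
  have hsub : Metric.ball x₀ r ⊆ Ω := (Metric.ball_subset_ball (by linarith)).trans hball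
  have htend : ∀ᵐ x ∂(volume.restrict (Metric.ball x₀ r)), Tendsto c atTop (𝓝 (u x)) := by
    filter_upwards [ae_restrict_of_ae hconv, ae_restrict_mem measurableSet_ball] with x hx hxb
    rw [hg, Set.indicator_of_mem (hsub hxb)] at hx
    exact hx.congr fun n => hc n x hxb
  have hne : (ae (volume.restrict (Metric.ball x₀ r))).NeBot := by
    rw [ae_neBot, Ne, Measure.restrict_eq_zero]
    exact (Metric.measure_ball_pos volume x₀ hr).ne'
  obtain ⟨x₁, hx₁⟩ := htend.exists
  exact ⟨u x₁, htend.mono fun x hx => tendsto_nhds_unique hx hx₁⟩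

/-- A function of zero total variation on a domain is constant. -/
theorem exists_ae_eq_const_of_totalVariation_eq_zero [Fact (1 ≤ p)]
    (hΩ : IsBoundedLipschitzDomain Ω) {u : Lp ℝ p (volOn Ω)} (hu : totalVariation u = 0) :
    ∃ c : ℝ, ∀ᵐ x ∂(volOn Ω), u x = c := by
  have hloc : ∀ x ∈ Ω, ∃ r > 0, Metric.ball x r ⊆ Ω ∧
      ∃ c : ℝ, ∀ᵐ y ∂(volume.restrict (Metric.ball x r)), u y = c := fun x hx => by
    obtain ⟨R, hR, hball⟩ := Metric.isOpen_iff.1 hΩ.isOpen x hx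
    refine ⟨R / 2, half_pos hR, (Metric.ball_subset_ball (by linarith)).trans hball,
      exists_ae_eq_const_on_ball (integrable_of_Lp hΩ u) hΩ.isOpen.measurableSet hu
        (half_pos hR) ?_⟩
    rwa [mul_div_cancel₀ R two_ne_zero]
  choose! r hr hrΩ c hc using hloc
  have hsame : ∀ x ∈ Ω, ∀ y ∈ Metric.ball x (r x), c y = c x := fun x hx y hy => by
    have hyΩ := hrΩ x hx hy
    have hopen : IsOpen (Metric.ball x (r x) ∩ Metric.ball y (r y)) :=
      Metric.isOpen_ball.inter Metric.isOpen_ball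
    have hne : (ae (volume.restrict (Metric.ball x (r x) ∩ Metric.ball y (r y)))).NeBot := by
      rw [ae_neBot, Ne, Measure.restrict_eq_zero]
      exact (hopen.measure_pos (μ := volume) ⟨y, hy, Metric.mem_ball_self (hr y hyΩ)⟩).ne'
    obtain ⟨z, hz1, hz2⟩ := ((ae_restrict_of_ae_restrict_of_subset Set.inter_subset_left
      (hc x hx)).and (ae_restrict_of_ae_restrict_of_subset Set.inter_subset_right
      (hc y hyΩ))).exists
    rw [← hz1, ← hz2]
  obtain ⟨x₀, hx₀⟩ := hΩ.isConnected.nonempty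
  have hopen : ∀ P : ℝ → Prop, IsOpen {x | x ∈ Ω ∧ P (c x)} := fun P =>
    Metric.isOpen_iff.2 fun x hx => ⟨r x, hr x hx.1, fun y hy =>
      ⟨hrΩ x hx.1 hy, by rw [hsame x hx.1 y hy]; exact hx.2⟩⟩
  have hall : Ω ⊆ {x | x ∈ Ω ∧ c x = c x₀} := by
    refine hΩ.isConnected.isPreconnected.subset_left_of_subset_union (hopen (· = c x₀))
      (hopen (· ≠ c x₀)) ?_ ?_ ⟨x₀, hx₀, hx₀, rfl⟩
    · exact Set.disjoint_left.2 fun x hx hx' => hx'.2 hx.2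
    · intro x hx
      by_cases h : c x = c x₀
      · exact Or.inl ⟨hx, h⟩
      · exact Or.inr ⟨hx, h⟩
  refine ⟨c x₀, ?_⟩
  rw [ae_restrict_iff' hΩ.isOpen.measurableSet]
  refine measure_null_of_locally_null _ fun x hx => ?_
  have hxΩ : x ∈ Ω := by
    by_contra h
    exact hx fun h' => absurd h' h
  refine ⟨_, inter_mem_nhdsWithin _ (Metric.ball_mem_nhds x (hr x hxΩ)), ?_⟩
  have h1 := (ae_restrict_iff' measurableSet_ball).1 (hc x hxΩ)
  refine measure_mono_null (fun y hy => ?_) h1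
  intro h2
  refine hy.1 fun _ => ?_
  rw [h2 hy.2]
  exact (hall hxΩ).2

end ZeroVariation

/-! ### Lower semicontinuity and convexity -/

section Closedness

variable {Ω : Set E3} {p : ℝ≥0∞}

theorem tendsto_integral_mul_of_tendsto_eLpNorm_one {X : Type*} [MeasurableSpace X] {μ : Measure X}
    {u : ℕ → X → ℝ} {v φ : X → ℝ} (hu : ∀ n, Integrable (u n) μ) (hv : Integrable v μ)
    (h : Tendsto (fun n => eLpNorm (u n - v) 1 μ) atTop (𝓝 0)) (hφ : AEStronglyMeasurable φ μ)
    {C : ℝ} (hC : ∀ x, ‖φ x‖ ≤ C) :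
    Tendsto (fun n => ∫ x, u n x * φ x ∂μ) atTop (𝓝 (∫ x, v x * φ x ∂μ)) := by
  refine tendsto_integral_of_L1' _ (hv.aestronglyMeasurable.mul hφ) (Eventually.of_forall fun n =>
    (hu n).mul_bdd hφ (Eventually.of_forall hC)) ?_
  have h1 := ENNReal.Tendsto.const_mul h (a := ENNReal.ofReal C) (Or.inr ENNReal.ofReal_ne_top)
  rw [mul_zero] at h1
  refine tendsto_of_tendsto_of_tendsto_of_le_of_le tendsto_const_nhds h1 (fun n => zero_le)
    fun n => ?_
  refine eLpNorm_le_mul_eLpNorm_of_ae_le_mul (g := u n - v) (Eventually.of_forall fun x => ?_) 1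
  have h2 : u n x * φ x - v x * φ x = φ x * (u n x - v x) := by ring
  show ‖u n x * φ x - v x * φ x‖ ≤ C * ‖u n x - v x‖
  rw [h2, norm_mul]
  exact mul_le_mul_of_nonneg_right (hC x) (norm_nonneg _)

theorem continuous_divergence {ξ : E3 → E3} (hξ : ContDiff ℝ ((⊤ : ℕ∞) : WithTop ℕ∞) ξ) :
    Continuous (divergence ξ) := by
  have h : Continuous (fderiv ℝ ξ) := hξ.continuous_fderiv (by simp)
  unfold divergence
  fun_prop

theorem exists_divergence_bound {ξ : E3 → E3} (hξ : ContDiff ℝ ((⊤ : ℕ∞) : WithTop ℕ∞) ξ)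
    (hc : HasCompactSupport ξ) : ∃ C, ∀ x, ‖divergence ξ x‖ ≤ C := by
  refine HasCompactSupport.exists_bound_of_continuous (f := divergence ξ) ?_
    (continuous_divergence hξ)
  refine HasCompactSupport.of_support_subset_isCompact (hc.fderiv (𝕜 := ℝ)) fun x hx => ?_
  refine subset_tsupport _ fun h0 => hx ?_
  simp [divergence, h0]

theorem integral_mul_divergence_le_totalVariation (u : Lp ℝ p (volOn Ω)) {ξ : E3 → E3}
    (hξ : ContDiff ℝ ((⊤ : ℕ∞) : WithTop ℕ∞) ξ) (hc : HasCompactSupport ξ) (hΩ : tsupport ξ ⊆ Ω)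
    (h1 : ∀ x, ‖ξ x‖ ≤ 1) :
    ENNReal.ofReal (∫ x, u x * divergence ξ x ∂(volOn Ω)) ≤ totalVariation u :=
  le_iSup_of_le (f := fun ξ : E3 → E3 =>
    ⨆ (_ : ContDiff ℝ ((⊤ : ℕ∞) : WithTop ℕ∞) ξ) (_ : HasCompactSupport ξ) (_ : tsupport ξ ⊆ Ω)
    (_ : ∀ x, ‖ξ x‖ ≤ 1), ENNReal.ofReal (∫ x, u x * divergence ξ x ∂(volOn Ω))) ξ
    (le_iSup_of_le hξ (le_iSup_of_le hc (le_iSup_of_le hΩ (le_iSup_of_le h1 le_rfl))))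

theorem totalVariation_le_liminf [Fact (1 ≤ p)] (hΩ : IsBoundedLipschitzDomain Ω)
    {w : ℕ → Lp ℝ p (volOn Ω)} {u : Lp ℝ p (volOn Ω)}
    (h : Tendsto (fun n => eLpNorm (w n - u : E3 → ℝ) 1 (volOn Ω)) atTop (𝓝 0)) :
    totalVariation u ≤ liminf (fun n => totalVariation (w n)) atTop := by
  refine iSup_le fun ξ => iSup_le fun hξ => iSup_le fun hc => iSup_le fun hs => iSup_le fun h1 => ?_
  obtain ⟨C, hC⟩ := exists_divergence_bound hξ hc
  have h2 := ENNReal.tendsto_ofReal (tendsto_integral_mul_of_tendsto_eLpNorm_one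
    (fun n => integrable_of_Lp hΩ (w n)) (integrable_of_Lp hΩ u) h
    (continuous_divergence hξ).aestronglyMeasurable hC)
  rw [← h2.liminf_eq]
  exact liminf_le_liminf (Eventually.of_forall fun n =>
    integral_mul_divergence_le_totalVariation (w n) hξ hc hs h1)

theorem totalVariation_smul_le (u : Lp ℝ p (volOn Ω)) {c : ℝ} (hc : 0 ≤ c) :
    totalVariation (c • u) ≤ ENNReal.ofReal c * totalVariation u := by
  refine iSup_le fun ξ => iSup_le fun hξ => iSup_le fun hs => iSup_le fun hΩ => iSup_le fun h1 => ?_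
  have h : ∫ x, (c • u : Lp ℝ p (volOn Ω)) x * divergence ξ x ∂(volOn Ω) =
      c * ∫ x, u x * divergence ξ x ∂(volOn Ω) := by
    rw [← integral_const_mul]
    refine integral_congr_ae ((Lp.coeFn_smul c u).mono fun x hx => ?_)
    simp only [hx, Pi.smul_apply, smul_eq_mul, mul_assoc]
  rw [h, ENNReal.ofReal_mul hc]
  exact mul_le_mul_right (integral_mul_divergence_le_totalVariation u hξ hs hΩ h1) _

theorem totalVariation_midpoint_le [Fact (1 ≤ p)] (hΩ : IsBoundedLipschitzDomain Ω)
    (u w : Lp ℝ p (volOn Ω)) : totalVariation ((2⁻¹ : ℝ) • (u + w)) ≤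
      2⁻¹ * (totalVariation u + totalVariation w) := by
  refine iSup_le fun ξ => iSup_le fun hξ => iSup_le fun hs => iSup_le fun hΩ' =>
    iSup_le fun h1 => ?_
  obtain ⟨C, hC⟩ := exists_divergence_bound hξ hs
  have hint : ∀ v : Lp ℝ p (volOn Ω), Integrable (fun x => v x * divergence ξ x) (volOn Ω) :=
    fun v => (integrable_of_Lp hΩ v).mul_bdd (continuous_divergence hξ).aestronglyMeasurable
      (Eventually.of_forall hC)
  have h : ∫ x, ((2⁻¹ : ℝ) • (u + w) : Lp ℝ p (volOn Ω)) x * divergence ξ x ∂(volOn Ω) =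
      2⁻¹ * (∫ x, u x * divergence ξ x ∂(volOn Ω) + ∫ x, w x * divergence ξ x ∂(volOn Ω)) := by
    rw [← integral_add (hint u) (hint w), ← integral_const_mul]
    refine integral_congr_ae ?_
    filter_upwards [Lp.coeFn_smul (2⁻¹ : ℝ) (u + w), Lp.coeFn_add u w] with x hx hx'
    simp only [hx, hx', Pi.smul_apply, Pi.add_apply, smul_eq_mul]
    ring
  rw [h]
  exact ofReal_half_add.trans (mul_le_mul_right (add_le_add
    (integral_mul_divergence_le_totalVariation u hξ hs hΩ' h1)
    (integral_mul_divergence_le_totalVariation w hξ hs hΩ' h1)) _)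

theorem lightSheetKernel_nonneg (K : LightSheetKernels) (x y : E3) : 0 ≤ lightSheetKernel K x y :=
  mul_nonneg (K.l_nonneg _) (K.h_nonneg _)

theorem nonneg_midpoint {X : Type*} [MeasurableSpace X] {μ : Measure X} {u w : Lp ℝ p μ}
    (hu : 0 ≤ u) (hw : 0 ≤ w) : 0 ≤ (2⁻¹ : ℝ) • (u + w) := by
  rw [← Lp.coeFn_nonneg] at hu hw ⊢
  filter_upwards [Lp.coeFn_smul (2⁻¹ : ℝ) (u + w), Lp.coeFn_add u w, hu, hw] with x h1 h2 h3 h4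
  simp only [Pi.zero_apply] at h3 h4
  simp only [h1, h2, Pi.smul_apply, Pi.add_apply, Pi.zero_apply, smul_eq_mul]
  positivity

theorem nonneg_of_ae_tendsto {X : Type*} [MeasurableSpace X] {μ : Measure X} {w : ℕ → Lp ℝ p μ}
    {u : Lp ℝ p μ} (hw : ∀ n, 0 ≤ w n)
    (h : ∀ᵐ x ∂μ, Tendsto (fun n => w n x) atTop (𝓝 (u x))) : 0 ≤ u := by
  rw [← Lp.coeFn_nonneg]
  filter_upwards [h, ae_all_iff.2 fun n => (Lp.coeFn_nonneg (w n)).2 (hw n)] with x h1 h2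
  exact ge_of_tendsto' h1 h2

theorem integral_norm_eq_integral {X : Type*} [MeasurableSpace X] {μ : Measure X} {u : Lp ℝ p μ}
    (hu : 0 ≤ u) : ∫ x, ‖u x‖ ∂μ = ∫ x, u x ∂μ :=
  integral_congr_ae (((Lp.coeFn_nonneg u).2 hu).mono fun _ hx => Real.norm_of_nonneg hx)

variable [Fact (1 ≤ p)]

theorem forwardOperator_nonneg (K : LightSheetKernels) (hΩ : IsBoundedLipschitzDomain Ω)
    {u : Lp ℝ p (volOn Ω)} (hu : 0 ≤ u) : 0 ≤ forwardOperator K hΩ u := by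
  rw [← Lp.coeFn_nonneg]
  filter_upwards [forwardOperator_apply_ae K hΩ u] with x hx
  rw [hx, lightSheet_eq K hΩ.isOpen.measurableSet]
  refine integral_nonneg_of_ae (((Lp.coeFn_nonneg u).2 hu).mono fun y hy => ?_)
  exact mul_nonneg (lightSheetKernel_nonneg K x y) hy

theorem tendsto_forwardOperator (K : LightSheetKernels) (hΩ : IsBoundedLipschitzDomain Ω)
    {w : ℕ → Lp ℝ p (volOn Ω)} {u : Lp ℝ p (volOn Ω)}
    (h : Tendsto (fun n => eLpNorm (w n - u : E3 → ℝ) 1 (volOn Ω)) atTop (𝓝 0)) {R : ℝ}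
    (hR : ∀ n, ‖w n‖ ≤ R) :
    (∀ᵐ x ∂(volOn Ω), Tendsto (fun n => forwardOperator K hΩ (w n) x) atTop
      (𝓝 (forwardOperator K hΩ u x))) ∧
    Tendsto (fun n => ∫ x, forwardOperator K hΩ (w n) x ∂(volOn Ω)) atTop
      (𝓝 (∫ x, forwardOperator K hΩ u x ∂(volOn Ω))) := by
  have := hΩ.isFiniteMeasure
  obtain ⟨C, hC0, hC⟩ := exists_lightSheetKernel_bound K
  obtain ⟨c, hc0, hc⟩ := exists_integral_norm_le (p := p) hΩ
  have hae := ae_all_iff.2 fun n => forwardOperator_apply_ae K hΩ (w n)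
  have hpt : ∀ᵐ x ∂(volOn Ω), Tendsto (fun n => forwardOperator K hΩ (w n) x) atTop
      (𝓝 (forwardOperator K hΩ u x)) := by
    filter_upwards [hae, forwardOperator_apply_ae K hΩ u] with x h1 h2
    simp only [h1, h2, lightSheet_eq K hΩ.isOpen.measurableSet]
    simp only [mul_comm (lightSheetKernel K x _)]
    exact tendsto_integral_mul_of_tendsto_eLpNorm_one (fun n => integrable_of_Lp hΩ (w n))
      (integrable_of_Lp hΩ u) h
      ((measurable_lightSheetKernel K).comp measurable_prodMk_left).aestronglyMeasurable (hC x)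
  refine ⟨hpt, tendsto_integral_of_dominated_convergence (fun _ => C * (c * R))
    (fun n => Lp.aestronglyMeasurable _) (integrable_const _) (fun n => ?_) hpt⟩
  filter_upwards [forwardOperator_apply_ae K hΩ (w n)] with x hx
  rw [hx]
  refine (norm_lightSheet_le K hΩ hC (w n) x).trans (mul_le_mul_of_nonneg_left ?_ hC0)
  exact (hc (w n)).trans (mul_le_mul_of_nonneg_left (hR n) hc0)

theorem tendsto_integral_of_tendsto_Lp (hΩ : IsBoundedLipschitzDomain Ω)
    {w : ℕ → Lp ℝ p (volOn Ω)} {u : Lp ℝ p (volOn Ω)} (h : Tendsto w atTop (𝓝 u)) :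
    Tendsto (fun n => ∫ x, w n x ∂(volOn Ω)) atTop (𝓝 (∫ x, u x ∂(volOn Ω))) := by
  obtain ⟨c, hc0, hc⟩ := exists_integral_norm_le (p := p) hΩ
  rw [tendsto_iff_dist_tendsto_zero] at h ⊢
  have h1 := h.const_mul c
  rw [mul_zero] at h1
  refine squeeze_zero (fun n => dist_nonneg) (fun n => ?_) h1
  rw [dist_eq_norm, dist_eq_norm, ← integral_sub (integrable_of_Lp hΩ _) (integrable_of_Lp hΩ _)]
  refine le_trans (le_of_eq ?_) ((norm_integral_le_integral_norm _).trans (hc (w n - u)))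
  congr 1
  exact integral_congr_ae ((Lp.coeFn_sub (w n) u).symm)

end Closedness

/-! ### A Poincaré inequality with the forward operator -/

section Poincare

variable {Ω : Set E3} {p : ℝ≥0∞} [Fact (1 ≤ p)]

theorem integral_forwardOperator_smul_add (K : LightSheetKernels) (hΩ : IsBoundedLipschitzDomain Ω)
    (c : ℝ) (u w : Lp ℝ p (volOn Ω)) :
    ∫ x, forwardOperator K hΩ (c • (u + w)) x ∂(volOn Ω) =
      c * (∫ x, forwardOperator K hΩ u x ∂(volOn Ω) +
        ∫ x, forwardOperator K hΩ w x ∂(volOn Ω)) := by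
  rw [map_smul, map_add, ← integral_add (integrable_of_Lp hΩ _) (integrable_of_Lp hΩ _),
    ← integral_const_mul]
  refine integral_congr_ae ?_
  filter_upwards [Lp.coeFn_smul c (forwardOperator K hΩ u + forwardOperator K hΩ w),
    Lp.coeFn_add (forwardOperator K hΩ u) (forwardOperator K hΩ w)] with x h1 h2
  simp only [h1, h2, Pi.smul_apply, Pi.add_apply, smul_eq_mul]

theorem integral_smul_add (hΩ : IsBoundedLipschitzDomain Ω) (c : ℝ) (u w : Lp ℝ p (volOn Ω)) :
    ∫ x, (c • (u + w) : Lp ℝ p (volOn Ω)) x ∂(volOn Ω) =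
      c * (∫ x, u x ∂(volOn Ω) + ∫ x, w x ∂(volOn Ω)) := by
  rw [← integral_add (integrable_of_Lp hΩ _) (integrable_of_Lp hΩ _), ← integral_const_mul]
  refine integral_congr_ae ?_
  filter_upwards [Lp.coeFn_smul c (u + w), Lp.coeFn_add u w] with x h1 h2
  simp only [h1, h2, Pi.smul_apply, Pi.add_apply, smul_eq_mul]

/-- If the kernel annihilates a positive constant, it annihilates every function. -/
theorem forwardOperator_eq_zero_of_const (K : LightSheetKernels) (hΩ : IsBoundedLipschitzDomain Ω)
    {u : Lp ℝ p (volOn Ω)} {c : ℝ} (hc : 0 < c) (hu : ∀ᵐ x ∂(volOn Ω), u x = c)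
    (hLu : ∫ x, forwardOperator K hΩ u x ∂(volOn Ω) ≤ 0) (w : Lp ℝ p (volOn Ω)) :
    ∫ x, forwardOperator K hΩ w x ∂(volOn Ω) = 0 := by
  have := hΩ.isFiniteMeasure
  have hu0 : 0 ≤ u := (Lp.coeFn_nonneg u).1 (hu.mono fun x hx => by rw [hx]; exact hc.le)
  have hL0 := (Lp.coeFn_nonneg _).2 (forwardOperator_nonneg K hΩ hu0)
  have h0 : ∫ x, forwardOperator K hΩ u x ∂(volOn Ω) = 0 := hLu.antisymm (integral_nonneg_of_ae hL0)
  have h1 := (integral_eq_zero_iff_of_nonneg_ae hL0 (integrable_of_Lp hΩ _)).1 h0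
  obtain ⟨C, hC0, hC⟩ := exists_lightSheetKernel_bound K
  refine integral_eq_zero_of_ae ?_
  filter_upwards [h1, forwardOperator_apply_ae K hΩ u, forwardOperator_apply_ae K hΩ w]
    with x h2 h3 h4
  have hki : Integrable (fun y => lightSheetKernel K x y) (volOn Ω) :=
    Integrable.of_bound ((measurable_lightSheetKernel K).comp
      measurable_prodMk_left).aestronglyMeasurable C (Eventually.of_forall (hC x))
  have h5 : ∫ y, lightSheetKernel K x y ∂(volOn Ω) = 0 := by
    rw [h3, lightSheet_eq K hΩ.isOpen.measurableSet] at h2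
    have h6 : ∫ y, lightSheetKernel K x y * u y ∂(volOn Ω) =
        (∫ y, lightSheetKernel K x y ∂(volOn Ω)) * c := by
      rw [← integral_mul_const]
      exact integral_congr_ae (hu.mono fun y hy => by simp only [hy])
    rw [h6] at h2
    exact (mul_eq_zero.1 h2).resolve_right hc.ne'
  have h6 := (integral_eq_zero_iff_of_nonneg (fun y => lightSheetKernel_nonneg K x y) hki).1 h5
  rw [h4, lightSheet_eq K hΩ.isOpen.measurableSet]
  exact integral_eq_zero_of_ae (h6.mono fun y hy => by simp [hy])

/-- A Poincaré inequality for non-negative functions, in which the forward operator replaces the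
mean value. If it failed, functions of integral one with vanishing total variation and
vanishing image would converge to a positive constant with zero image. -/
theorem exists_integral_le_totalVariation_add (K : LightSheetKernels)
    (hΩ : IsBoundedLipschitzDomain Ω) (hp : 1 < p) (hp' : p < 3 / 2) {v : Lp ℝ p (volOn Ω)}
    (hv : ∫ x, forwardOperator K hΩ v x ∂(volOn Ω) ≠ 0) :
    ∃ C, 0 ≤ C ∧ ∀ u : Lp ℝ p (volOn Ω), 0 ≤ u → totalVariation u ≠ ∞ →
      ∫ x, u x ∂(volOn Ω) ≤
        C * ((totalVariation u).toReal + ∫ x, forwardOperator K hΩ u x ∂(volOn Ω)) := by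
  have := hΩ.isFiniteMeasure
  by_contra! hcon
  obtain ⟨C, hC0, hC⟩ := exists_norm_le_totalVariation_add (p := p) hΩ hp hp'
  set L := forwardOperator (p := p) K hΩ with hL
  have hLnn : ∀ u : Lp ℝ p (volOn Ω), 0 ≤ u → 0 ≤ ∫ x, L u x ∂(volOn Ω) := fun u hu =>
    integral_nonneg_of_ae ((Lp.coeFn_nonneg _).2 (forwardOperator_nonneg K hΩ hu))
  set S : ℕ → Set (Lp ℝ p (volOn Ω) × Lp ℝ 2 (volOn Ω)) := fun n =>
    {x | x.2 = 0 ∧ 0 ≤ x.1 ∧ ∫ y, x.1 y ∂(volOn Ω) = 1 ∧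
      totalVariation x.1 ≤ ENNReal.ofReal (1 / ((n : ℝ) + 1)) ∧
      ∫ y, L x.1 y ∂(volOn Ω) ≤ 1 / ((n : ℝ) + 1)} with hS
  have hanti : Antitone S := fun m n hmn x hx => by
    have h1 : 1 / ((n : ℝ) + 1) ≤ 1 / ((m : ℝ) + 1) := by
      have : (m : ℝ) ≤ n := by exact_mod_cast hmn
      exact one_div_le_one_div_of_le (by positivity) (by linarith)
    exact ⟨hx.1, hx.2.1, hx.2.2.1, hx.2.2.2.1.trans (ENNReal.ofReal_le_ofReal h1),
      hx.2.2.2.2.trans h1⟩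
  have hne : ∀ n, (S n).Nonempty := fun n => by
    obtain ⟨u, hu0, huT, hu⟩ := hcon ((n : ℝ) + 1) (by positivity)
    set I := ∫ x, u x ∂(volOn Ω) with hI
    have hT0 : 0 ≤ (totalVariation u).toReal := ENNReal.toReal_nonneg
    have hLu := hLnn u hu0
    have hI0 : 0 < I := lt_of_le_of_lt (by positivity) hu
    have hT : I⁻¹ * (totalVariation u).toReal ≤ 1 / ((n : ℝ) + 1) := by
      rw [inv_mul_le_iff₀ hI0, mul_one_div, le_div_iff₀ (by positivity)]
      nlinarith [(Nat.cast_nonneg n : (0 : ℝ) ≤ n)]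
    have hLI : I⁻¹ * ∫ x, L u x ∂(volOn Ω) ≤ 1 / ((n : ℝ) + 1) := by
      rw [inv_mul_le_iff₀ hI0, mul_one_div, le_div_iff₀ (by positivity)]
      nlinarith [(Nat.cast_nonneg n : (0 : ℝ) ≤ n)]
    refine ⟨(I⁻¹ • u, 0), rfl, ?_, ?_, ?_, ?_⟩
    · rw [← Lp.coeFn_nonneg] at hu0 ⊢
      filter_upwards [hu0, Lp.coeFn_smul I⁻¹ u] with x h1 h2
      rw [h2]
      exact mul_nonneg (by positivity) h1
    · rw [integral_congr_ae (Lp.coeFn_smul I⁻¹ u)]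
      simp only [Pi.smul_apply, smul_eq_mul]
      rw [integral_const_mul, inv_mul_cancel₀ hI0.ne']
    · refine (totalVariation_smul_le u (by positivity)).trans ?_
      rw [← ENNReal.ofReal_toReal huT, ← ENNReal.ofReal_mul (by positivity)]
      exact ENNReal.ofReal_le_ofReal hT
    · simp only [map_smul]
      rw [integral_congr_ae (Lp.coeFn_smul I⁻¹ (L u))]
      simp only [Pi.smul_apply, smul_eq_mul]
      rwa [integral_const_mul]
  have hmid : ∀ n, ∀ x ∈ S n, ∀ y ∈ S n, (2⁻¹ : ℝ) • (x + y) ∈ S n := by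
    rintro n x ⟨hx1, hx2, hx3, hx4, hx5⟩ y ⟨hy1, hy2, hy3, hy4, hy5⟩
    refine ⟨?_, ?_, ?_, ?_, ?_⟩
    · simp [hx1, hy1]
    · exact nonneg_midpoint hx2 hy2
    · refine (integral_smul_add hΩ _ _ _).trans ?_
      rw [hx3, hy3]; norm_num
    · refine (totalVariation_midpoint_le hΩ _ _).trans ?_
      refine (mul_le_mul_right (add_le_add hx4 hy4) _).trans_eq ?_
      rw [← two_mul, ← mul_assoc, ENNReal.inv_mul_cancel (by simp) (by simp), one_mul]
    · refine (integral_forwardOperator_smul_add K hΩ _ _ _).trans_le ?_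
      linarith
  have hTone : ∀ x ∈ S 0, totalVariation x.1 ≤ 1 := fun x hx => by simpa using hx.2.2.2.1
  have hbd : ∀ x ∈ S 0, ‖x.1‖ ≤ C * 2 ∧ ‖x.2‖ ≤ C * 2 := fun x hx => by
    have hT1 := hTone x hx
    refine ⟨(hC x.1 hx.2.1 (hT1.trans_lt ENNReal.one_lt_top).ne).trans ?_, ?_⟩
    · refine mul_le_mul_of_nonneg_left ?_ hC0
      rw [integral_norm_eq_integral hx.2.1, hx.2.2.1]
      have := ENNReal.toReal_mono ENNReal.one_ne_top hT1
      rw [ENNReal.toReal_one] at this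
      linarith
    · rw [hx.1, norm_zero]
      positivity
  obtain ⟨x, u, _, hxS, hxu, hx1, -, -⟩ := exists_tendsto_of_antitone_midpoint hp hanti hne hmid
    (fun x hx => hx.2.1) hbd
  have hu0 : 0 ≤ u := nonneg_of_ae_tendsto (fun n => (hxS n).2.1) hxu
  have hT : totalVariation u = 0 := by
    refine le_antisymm ((totalVariation_le_liminf hΩ hx1).trans ?_) zero_le
    have h1 : Tendsto (fun n : ℕ => ENNReal.ofReal (1 / ((n : ℝ) + 1))) atTop (𝓝 0) := by
      simpa using ENNReal.tendsto_ofReal (tendsto_one_div_add_atTop_nhds_zero_nat (𝕜 := ℝ))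
    rw [← h1.liminf_eq]
    exact liminf_le_liminf (Eventually.of_forall fun n => (hxS n).2.2.2.1)
  have hI : ∫ y, u y ∂(volOn Ω) = 1 := by
    have h1 := tendsto_integral_of_L1' _ (Lp.aestronglyMeasurable u)
      (Eventually.of_forall fun n => integrable_of_Lp hΩ (x n).1) hx1
    refine tendsto_nhds_unique h1 ?_
    simp only [(hxS _).2.2.1]
    exact tendsto_const_nhds
  have hLu : ∫ y, L u y ∂(volOn Ω) ≤ 0 :=
    le_of_tendsto_of_tendsto' (tendsto_forwardOperator K hΩ hx1
      (fun n => (hbd _ (hanti (Nat.zero_le n) (hxS n))).1)).2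
      (tendsto_one_div_add_atTop_nhds_zero_nat (𝕜 := ℝ)) fun n => (hxS n).2.2.2.2
  obtain ⟨c, hc⟩ := exists_ae_eq_const_of_totalVariation_eq_zero hΩ hT
  have hc0 : 0 < c := by
    rw [integral_congr_ae hc, integral_const, smul_eq_mul] at hI
    by_contra! h
    have := mul_nonpos_of_nonneg_of_nonpos
      (measureReal_nonneg : 0 ≤ (volOn Ω).real Set.univ) h
    linarith
  exact hv (forwardOperator_eq_zero_of_const K hΩ hc0 hc hLu v)

end Poincare

/-! ### Existence of minimisers -/

section Existence

/-- Superadditivity of the lower limit in `[0, ∞]`. -/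
theorem liminf_add_liminf_le_liminf_add (a b : ℕ → ℝ≥0∞) :
    liminf a atTop + liminf b atTop ≤ liminf (fun n => a n + b n) atTop := by
  simp only [liminf_eq_iSup_iInf_of_nat]
  have hmono : ∀ c : ℕ → ℝ≥0∞, Monotone fun n => ⨅ i ≥ n, c i := fun c m n hmn =>
    le_iInf₂ fun i hi => iInf₂_le i (hmn.trans hi)
  rw [ENNReal.iSup_add_iSup_of_monotone (hmono a) (hmono b)]
  exact iSup_mono fun n => le_iInf₂ fun i hi => add_le_add (iInf₂_le i hi) (iInf₂_le i hi)

variable {Ω : Set E3} {p : ℝ≥0∞}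

/-- The functional `½ ‖f - v‖² + D_KL(v, g)` whose infimum over `v ≥ 0` is the fidelity. -/
noncomputable def splitEnergy (g : E3 → ℝ) (f v : Lp ℝ 2 (volOn Ω)) : ℝ≥0∞ :=
  ENNReal.ofReal (1 / 2 * ‖f - v‖ ^ 2) + klDivergence Ω v g

theorem fidelity_le_splitEnergy (g : E3 → ℝ) (f : Lp ℝ 2 (volOn Ω)) {v : Lp ℝ 2 (volOn Ω)}
    (hv : 0 ≤ v) : fidelity g f ≤ splitEnergy g f v :=
  iInf₂_le v hv

theorem exists_splitEnergy_lt {g : E3 → ℝ} {f : Lp ℝ 2 (volOn Ω)} {c : ℝ≥0∞}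
    (h : fidelity g f < c) : ∃ v : Lp ℝ 2 (volOn Ω), 0 ≤ v ∧ splitEnergy g f v < c := by
  simp only [fidelity, iInf_lt_iff] at h
  obtain ⟨v, hv, h⟩ := h
  exact ⟨v, hv, h⟩

theorem splitEnergy_le_liminf (hΩ : IsBoundedLipschitzDomain Ω) (f : Lp ℝ 2 (volOn Ω))
    {g : E3 → ℝ} {w : ℕ → E3 → ℝ} {v : Lp ℝ 2 (volOn Ω)} {z : ℕ → Lp ℝ 2 (volOn Ω)}
    (hwm : ∀ n, AEMeasurable (w n) (volOn Ω)) (hw0 : ∀ n, 0 ≤ᵐ[volOn Ω] w n)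
    (hw : ∀ᵐ x ∂(volOn Ω), Tendsto (fun n => w n x) atTop (𝓝 (g x)))
    (hwi : Tendsto (fun n => ∫ x, w n x ∂(volOn Ω)) atTop (𝓝 (∫ x, g x ∂(volOn Ω))))
    (hz0 : ∀ n, 0 ≤ z n) (hz : ∀ᵐ x ∂(volOn Ω), Tendsto (fun n => z n x) atTop (𝓝 (v x)))
    (hzv : Tendsto z atTop (𝓝 v)) :
    splitEnergy g f v ≤ liminf (fun n => splitEnergy (w n) f (z n)) atTop := by
  refine le_trans (add_le_add ?_ ?_) (liminf_add_liminf_le_liminf_add _ _)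
  · have h : Tendsto (fun n => ENNReal.ofReal (1 / 2 * ‖f - z n‖ ^ 2)) atTop
        (𝓝 (ENNReal.ofReal (1 / 2 * ‖f - v‖ ^ 2))) :=
      ENNReal.tendsto_ofReal ((((tendsto_const_nhds.sub hzv).norm).pow 2).const_mul _)
    exact h.liminf_eq.ge
  · exact klDivergence_le_liminf (fun n => (Lp.aestronglyMeasurable (z n)).aemeasurable) hwm
      (fun n => (Lp.coeFn_nonneg _).2 (hz0 n)) hw0 hz hw (tendsto_integral_of_tendsto_Lp hΩ hzv) hwi

/-- Midpoint convexity with the gap coming from the parallelogram identity. -/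
theorem splitEnergy_midpoint_add_le {g g' : E3 → ℝ} (hg : AEMeasurable g (volOn Ω))
    (f v v' : Lp ℝ 2 (volOn Ω)) :
    splitEnergy (fun x => 2⁻¹ * (g x + g' x)) f ((2⁻¹ : ℝ) • (v + v')) +
        ENNReal.ofReal (1 / 8 * ‖v - v'‖ ^ 2) ≤
      2⁻¹ * (splitEnergy g f v + splitEnergy g' f v') := by
  have hkl : klDivergence Ω ((2⁻¹ : ℝ) • (v + v') : Lp ℝ 2 (volOn Ω))
      (fun x => 2⁻¹ * (g x + g' x)) ≤ 2⁻¹ * (klDivergence Ω v g + klDivergence Ω v' g') := by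
    refine le_trans (le_of_eq (klDivergence_congr ?_ (ae_eq_refl _)))
      (klDivergence_midpoint_le (Lp.aestronglyMeasurable v).aemeasurable hg)
    filter_upwards [Lp.coeFn_smul (2⁻¹ : ℝ) (v + v'), Lp.coeFn_add v v'] with x h1 h2
    simp only [h1, h2, Pi.smul_apply, Pi.add_apply, smul_eq_mul]
  have hpar : 1 / 2 * ‖f - (2⁻¹ : ℝ) • (v + v')‖ ^ 2 + 1 / 8 * ‖v - v'‖ ^ 2 =
      2⁻¹ * (1 / 2 * ‖f - v‖ ^ 2 + 1 / 2 * ‖f - v'‖ ^ 2) := by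
    have h1 := parallelogram_law_with_norm ℝ (f - v) (f - v')
    have h2 : f - (2⁻¹ : ℝ) • (v + v') = (2⁻¹ : ℝ) • ((f - v) + (f - v')) := by module
    have h3 : v - v' = -((f - v) - (f - v')) := by abel
    rw [h2, h3, norm_smul, norm_neg, Real.norm_of_nonneg (by norm_num)]
    linarith
  calc _ = ENNReal.ofReal (2⁻¹ * (1 / 2 * ‖f - v‖ ^ 2 + 1 / 2 * ‖f - v'‖ ^ 2)) +
        klDivergence Ω ((2⁻¹ : ℝ) • (v + v') : Lp ℝ 2 (volOn Ω))
          (fun x => 2⁻¹ * (g x + g' x)) := by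
        rw [← hpar, ENNReal.ofReal_add (by positivity) (by positivity), splitEnergy]
        ring
    _ ≤ _ := add_le_add ofReal_half_add hkl
    _ = _ := by simp only [splitEnergy]; ring

variable [Fact (1 ≤ p)]

theorem forwardOperator_midpoint_ae (K : LightSheetKernels) (hΩ : IsBoundedLipschitzDomain Ω)
    (u u' : Lp ℝ p (volOn Ω)) : forwardOperator K hΩ ((2⁻¹ : ℝ) • (u + u')) =ᵐ[volOn Ω]
      fun x => 2⁻¹ * (forwardOperator K hΩ u x + forwardOperator K hΩ u' x) := by
  rw [map_smul, map_add]
  filter_upwards [Lp.coeFn_smul (2⁻¹ : ℝ) (forwardOperator K hΩ u + forwardOperator K hΩ u'),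
    Lp.coeFn_add (forwardOperator K hΩ u) (forwardOperator K hΩ u')] with x h1 h2
  simp only [h1, h2, Pi.smul_apply, Pi.add_apply, smul_eq_mul]

theorem splitEnergy_forwardOperator_midpoint_add_le (K : LightSheetKernels)
    (hΩ : IsBoundedLipschitzDomain Ω) (f v v' : Lp ℝ 2 (volOn Ω)) (u u' : Lp ℝ p (volOn Ω)) :
    splitEnergy (forwardOperator K hΩ ((2⁻¹ : ℝ) • (u + u'))) f ((2⁻¹ : ℝ) • (v + v')) +
        ENNReal.ofReal (1 / 8 * ‖v - v'‖ ^ 2) ≤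
      2⁻¹ * (splitEnergy (forwardOperator K hΩ u) f v +
        splitEnergy (forwardOperator K hΩ u') f v') := by
  refine le_trans (le_of_eq ?_) (splitEnergy_midpoint_add_le
    (Lp.aestronglyMeasurable (forwardOperator K hΩ u)).aemeasurable f v v')
  rw [splitEnergy, splitEnergy, klDivergence_congr (ae_eq_refl _)
    (forwardOperator_midpoint_ae K hΩ u u')]

theorem half_add_self (m : ℝ≥0∞) : 2⁻¹ * (m + m) = m := by
  rw [← two_mul, ← mul_assoc, ENNReal.inv_mul_cancel (by simp) (by simp), one_mul]

theorem norm_le_of_splitEnergy_le {g : E3 → ℝ} {f v : Lp ℝ 2 (volOn Ω)} {m : ℝ} (hm : 0 ≤ m)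
    (h : splitEnergy g f v ≤ ENNReal.ofReal m) : ‖f - v‖ ≤ √(2 * m) := by
  have h1 := (ENNReal.ofReal_le_ofReal_iff hm).1 (le_self_add.trans h)
  refine Real.le_sqrt_of_sq_le ?_
  linarith

/-- Coercivity of the regularised energy on non-negative functions: a finite divergence fixes the
mass of `L u`, which together with the total variation controls the norm of `u`. -/
theorem exists_norm_le_of_splitEnergy_ne_top (K : LightSheetKernels)
    (hΩ : IsBoundedLipschitzDomain Ω) (hp : 1 < p) (hp' : p < 3 / 2) {v₀ : Lp ℝ p (volOn Ω)}
    (hv₀ : ∫ x, forwardOperator K hΩ v₀ x ∂(volOn Ω) ≠ 0) :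
    ∃ C, 0 ≤ C ∧ ∀ (u : Lp ℝ p (volOn Ω)) (f v : Lp ℝ 2 (volOn Ω)), 0 ≤ u →
      totalVariation u ≠ ∞ → splitEnergy (forwardOperator K hΩ u) f v ≠ ∞ →
      ‖u‖ ≤ C * ((totalVariation u).toReal + 1) := by
  obtain ⟨C₁, hC₁, h₁⟩ := exists_norm_le_totalVariation_add (p := p) hΩ hp hp'
  obtain ⟨C₂, hC₂, h₂⟩ := exists_integral_le_totalVariation_add K hΩ hp hp' hv₀
  refine ⟨C₁ * (1 + C₂), by positivity, fun u f v hu hT hE => (h₁ u hu hT).trans ?_⟩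
  have hkl : klDivergence Ω v (forwardOperator K hΩ u) ≠ ∞ :=
    ne_top_of_le_ne_top hE le_add_self
  have h3 := h₂ u hu hT
  rw [(klDivergence_ne_top hkl).1.2.2.2] at h3
  rw [integral_norm_eq_integral hu, mul_assoc]
  have : 0 ≤ (totalVariation u).toReal := ENNReal.toReal_nonneg
  exact mul_le_mul_of_nonneg_left (by nlinarith) hC₁

/-- The direct method, with an additional bound on the fidelity and a convex constraint `A`.
Compactness is replaced by a diagonal choice in the decreasing convex sublevel sets. -/
theorem exists_splitEnergy_le (K : LightSheetKernels)
    (hΩ : IsBoundedLipschitzDomain Ω) (hp : 1 < p) (hp' : p < 3 / 2) {v₀ : Lp ℝ p (volOn Ω)}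
    (hv₀ : ∫ x, forwardOperator K hΩ v₀ x ∂(volOn Ω) ≠ 0) {A : Set (Lp ℝ p (volOn Ω))}
    (hA : ∀ u ∈ A, ∀ w ∈ A, (2⁻¹ : ℝ) • (u + w) ∈ A)
    (hA' : ∀ (w : ℕ → Lp ℝ p (volOn Ω)) (u : Lp ℝ p (volOn Ω)), (∀ n, w n ∈ A) →
      (∀ᵐ x ∂(volOn Ω), Tendsto (fun n => w n x) atTop (𝓝 (u x))) → u ∈ A)
    (f : Lp ℝ 2 (volOn Ω)) {β : ℝ} (hβ : 0 < β) {m t : ℝ≥0∞} (hm : m ≠ ∞)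
    (h : ∀ ε : ℝ, 0 < ε → ∃ u ∈ A, 0 ≤ u ∧
      fidelity (forwardOperator K hΩ u) f + ENNReal.ofReal β * totalVariation u ≤
        m + ENNReal.ofReal ε ∧
      fidelity (forwardOperator K hΩ u) f ≤ t + ENNReal.ofReal ε) :
    ∃ u ∈ A, ∃ v : Lp ℝ 2 (volOn Ω), 0 ≤ u ∧ 0 ≤ v ∧
      splitEnergy (forwardOperator K hΩ u) f v + ENNReal.ofReal β * totalVariation u ≤ m ∧
      splitEnergy (forwardOperator K hΩ u) f v ≤ t := by
  have := hΩ.isFiniteMeasure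
  obtain ⟨C, hC0, hC⟩ := exists_norm_le_of_splitEnergy_ne_top K hΩ hp hp' hv₀
  set L := forwardOperator (p := p) K hΩ with hL
  set e : ℕ → ℝ≥0∞ := fun n => ENNReal.ofReal (1 / ((n : ℝ) + 1)) with he
  have he_anti : Antitone e := fun i j hij => by
    have : (i : ℝ) ≤ j := by exact_mod_cast hij
    exact ENNReal.ofReal_le_ofReal (one_div_le_one_div_of_le (by positivity) (by linarith))
  have he0 : Tendsto e atTop (𝓝 0) := by
    rw [← ENNReal.ofReal_zero]
    exact ENNReal.tendsto_ofReal (tendsto_one_div_add_atTop_nhds_zero_nat (𝕜 := ℝ))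
  set S : ℕ → Set (Lp ℝ p (volOn Ω) × Lp ℝ 2 (volOn Ω)) := fun n =>
    {x | x.1 ∈ A ∧ 0 ≤ x.1 ∧ 0 ≤ x.2 ∧
      splitEnergy (L x.1) f x.2 + ENNReal.ofReal β * totalVariation x.1 ≤ m + e n ∧
      splitEnergy (L x.1) f x.2 ≤ t + e n} with hS
  have hanti : Antitone S := fun i j hij x hx =>
    ⟨hx.1, hx.2.1, hx.2.2.1, hx.2.2.2.1.trans (add_le_add_right (he_anti hij) _),
      hx.2.2.2.2.trans (add_le_add_right (he_anti hij) _)⟩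
  have hne : ∀ n, (S n).Nonempty := fun n => by
    set ε : ℝ := 2⁻¹ * (1 / ((n : ℝ) + 1)) with hε
    have hε0 : 0 < ε := by positivity
    have hee : ENNReal.ofReal ε + ENNReal.ofReal ε = e n := by
      rw [← ENNReal.ofReal_add hε0.le hε0.le, he]
      congr 1
      rw [hε]; ring
    obtain ⟨u, huA, hu0, h1, h2⟩ := h ε hε0
    have hfin : fidelity (L u) f ≠ ∞ :=
      ne_top_of_le_ne_top (ENNReal.add_ne_top.2 ⟨hm, ENNReal.ofReal_ne_top⟩) (le_self_add.trans h1)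
    obtain ⟨v, hv0, hv⟩ := exists_splitEnergy_lt (ENNReal.lt_add_right hfin
      (ENNReal.ofReal_pos.2 hε0).ne')
    refine ⟨(u, v), huA, hu0, hv0, ?_, ?_⟩
    · refine (add_le_add_left hv.le _).trans ?_
      rw [add_right_comm, ← hee, ← add_assoc]
      exact add_le_add_left h1 _
    · refine hv.le.trans ?_
      rw [← hee, ← add_assoc]
      exact add_le_add_left h2 _
  have hmid : ∀ n, ∀ x ∈ S n, ∀ y ∈ S n, (2⁻¹ : ℝ) • (x + y) ∈ S n := by
    rintro n x ⟨hx1, hx2, hx3, hx4, hx5⟩ y ⟨hy1, hy2, hy3, hy4, hy5⟩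
    have hsp := le_self_add.trans
      (splitEnergy_forwardOperator_midpoint_add_le K hΩ f x.2 y.2 x.1 y.1)
    have htv := totalVariation_midpoint_le hΩ x.1 y.1
    refine ⟨hA _ hx1 _ hy1, nonneg_midpoint hx2 hy2, nonneg_midpoint hx3 hy3, ?_, ?_⟩
    · refine (add_le_add hsp (mul_le_mul_right htv _)).trans ?_
      refine le_trans (le_of_eq ?_) ((mul_le_mul_right (add_le_add hx4 hy4) 2⁻¹).trans_eq
        (half_add_self _))
      ring
    · exact hsp.trans ((mul_le_mul_right (add_le_add hx5 hy5) 2⁻¹).trans_eq (half_add_self _))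
  set M : ℝ := (m + e 0).toReal with hM
  have hMtop : m + e 0 ≠ ∞ := ENNReal.add_ne_top.2 ⟨hm, ENNReal.ofReal_ne_top⟩
  have hM' : m + e 0 = ENNReal.ofReal M := (ENNReal.ofReal_toReal hMtop).symm
  have hM0 : 0 ≤ M := ENNReal.toReal_nonneg
  have hbd : ∀ x ∈ S 0, ‖x.1‖ ≤ C * (M / β + 1) + (‖f‖ + √(2 * M)) ∧
      ‖x.2‖ ≤ C * (M / β + 1) + (‖f‖ + √(2 * M)) := by
    rintro x ⟨hx1, hx2, hx3, hx4, hx5⟩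
    rw [hM'] at hx4
    have hT : ENNReal.ofReal β * totalVariation x.1 ≤ ENNReal.ofReal M := le_add_self.trans hx4
    have hE : splitEnergy (L x.1) f x.2 ≤ ENNReal.ofReal M := le_self_add.trans hx4
    have hTtop : totalVariation x.1 ≠ ∞ := fun htop => by
      rw [htop, ENNReal.mul_top (ENNReal.ofReal_pos.2 hβ).ne'] at hT
      exact ENNReal.ofReal_ne_top (top_le_iff.1 hT)
    have hTle : (totalVariation x.1).toReal ≤ M / β := by
      rw [le_div_iff₀ hβ, mul_comm]
      have := ENNReal.toReal_le_of_le_ofReal hM0 hT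
      rwa [ENNReal.toReal_mul, ENNReal.toReal_ofReal hβ.le] at this
    have h1 := hC x.1 f x.2 hx2 hTtop (ne_top_of_le_ne_top ENNReal.ofReal_ne_top hE)
    have h2 := norm_le_of_splitEnergy_le hM0 hE
    have h3 : ‖x.2‖ ≤ ‖f‖ + ‖f - x.2‖ := by
      have := norm_sub_norm_le x.2 f
      rw [norm_sub_rev] at this
      linarith
    have h4 : C * ((totalVariation x.1).toReal + 1) ≤ C * (M / β + 1) := by gcongr
    have h5 : 0 ≤ C * (M / β + 1) := by positivity
    have h6 : 0 ≤ ‖f‖ + √(2 * M) := by positivity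
    constructor <;> linarith
  obtain ⟨x, u, v, hxS, hxu, hx1, hxv, hx2⟩ := exists_tendsto_of_antitone_midpoint hp hanti hne
    hmid (fun x hx => hx.2.1) hbd
  have hLw := tendsto_forwardOperator K hΩ hx1
    (fun n => (hbd _ (hanti (Nat.zero_le n) (hxS n))).1)
  have hE : splitEnergy (L u) f v ≤ liminf (fun n => splitEnergy (L (x n).1) f (x n).2) atTop :=
    splitEnergy_le_liminf hΩ f (fun n => (Lp.aestronglyMeasurable _).aemeasurable)
      (fun n => (Lp.coeFn_nonneg _).2 (forwardOperator_nonneg K hΩ (hxS n).2.1)) hLw.1 hLw.2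
      (fun n => (hxS n).2.2.1) hxv hx2
  have hTV : ENNReal.ofReal β * totalVariation u ≤
      liminf (fun n => ENNReal.ofReal β * totalVariation (x n).1) atTop := by
    rw [ENNReal.liminf_const_mul_of_ne_top ENNReal.ofReal_ne_top]
    exact mul_le_mul_right (totalVariation_le_liminf hΩ hx1) _
  have hlim : ∀ c : ℝ≥0∞, liminf (fun n => c + e n) atTop = c := fun c => by
    have := (tendsto_const_nhds (x := c)).add he0
    rw [add_zero] at this
    exact this.liminf_eq
  refine ⟨u, hA' _ u (fun n => (hxS n).1) hxu, v, nonneg_of_ae_tendsto (fun n => (hxS n).2.1) hxu,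
    nonneg_of_ae_tendsto (fun n => (hxS n).2.2.1) hxv, ?_, ?_⟩
  · refine (add_le_add hE hTV).trans ((liminf_add_liminf_le_liminf_add _ _).trans ?_)
    rw [← hlim m]
    exact liminf_le_liminf (Eventually.of_forall fun n => (hxS n).2.2.2.1)
  · rw [← hlim t]
    exact hE.trans (liminf_le_liminf (Eventually.of_forall fun n => (hxS n).2.2.2.2))

theorem exists_splitEnergy_eq_fidelity (K : LightSheetKernels)
    (hΩ : IsBoundedLipschitzDomain Ω) (hp : 1 < p) (hp' : p < 3 / 2) {v₀ : Lp ℝ p (volOn Ω)}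
    (hv₀ : ∫ x, forwardOperator K hΩ v₀ x ∂(volOn Ω) ≠ 0) (f : Lp ℝ 2 (volOn Ω))
    {u : Lp ℝ p (volOn Ω)} (hu : 0 ≤ u) (hT : totalVariation u ≠ ∞)
    (hF : fidelity (forwardOperator K hΩ u) f ≠ ∞) :
    ∃ v : Lp ℝ 2 (volOn Ω), 0 ≤ v ∧
      splitEnergy (forwardOperator K hΩ u) f v = fidelity (forwardOperator K hΩ u) f := by
  obtain ⟨w, hw, v, -, hv, -, hle⟩ := exists_splitEnergy_le K hΩ hp hp' hv₀ (A := {u})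
    (m := fidelity (forwardOperator K hΩ u) f + ENNReal.ofReal 1 * totalVariation u)
    (t := fidelity (forwardOperator K hΩ u) f)
    (fun w hw w' hw' => by
      rw [Set.mem_singleton_iff] at hw hw' ⊢
      rw [hw, hw']
      module)
    (fun w u' hw h => Lp.ext <| by
      filter_upwards [h] with x hx
      simp only [Set.mem_singleton_iff.1 (hw _)] at hx
      exact tendsto_nhds_unique hx tendsto_const_nhds)
    f one_pos
    (ENNReal.add_ne_top.2 ⟨hF, ENNReal.mul_ne_top ENNReal.ofReal_ne_top hT⟩)
    (fun ε hε => ⟨u, rfl, hu, le_self_add, le_self_add⟩)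
  rw [Set.mem_singleton_iff.1 hw] at hle
  exact ⟨v, hv, hle.antisymm (fidelity_le_splitEnergy _ f hv)⟩

theorem exists_isRegularisedSolution (K : LightSheetKernels)
    (hΩ : IsBoundedLipschitzDomain Ω) (hp : 1 < p) (hp' : p < 3 / 2) {v₀ : Lp ℝ p (volOn Ω)}
    (hv₀ : ∫ x, forwardOperator K hΩ v₀ x ∂(volOn Ω) ≠ 0) (f : Lp ℝ 2 (volOn Ω))
    {u : Lp ℝ p (volOn Ω)} (hu : 0 ≤ u) (hT : totalVariation u ≠ ∞)
    (hF : fidelity (forwardOperator K hΩ u) f ≠ ∞) {β : ℝ} (hβ : 0 < β) :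
    ∃ w : Lp ℝ p (volOn Ω), IsRegularisedSolution (forwardOperator K hΩ) f β w := by
  set J : Lp ℝ p (volOn Ω) → ℝ≥0∞ := fun w =>
    fidelity (forwardOperator K hΩ w) f + ENNReal.ofReal β * totalVariation w with hJ
  set m : ℝ≥0∞ := ⨅ (w : Lp ℝ p (volOn Ω)) (_ : 0 ≤ w), J w with hm
  have hmtop : m ≠ ∞ := ne_top_of_le_ne_top
    (ENNReal.add_ne_top.2 ⟨hF, ENNReal.mul_ne_top ENNReal.ofReal_ne_top hT⟩) (iInf₂_le u hu)
  obtain ⟨w, -, v, hw, hv, hle, -⟩ := exists_splitEnergy_le K hΩ hp hp' hv₀ (A := Set.univ)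
    (m := m) (t := ∞) (fun _ _ _ _ => trivial) (fun _ _ _ _ => trivial) f hβ hmtop fun ε hε => by
      have hlt : m < m + ENNReal.ofReal ε :=
        ENNReal.lt_add_right hmtop (ENNReal.ofReal_pos.2 hε).ne'
      conv_lhs at hlt => rw [hm]
      simp only [iInf_lt_iff] at hlt
      obtain ⟨w, hw, hlt⟩ := hlt
      exact ⟨w, trivial, hw, hlt.le, by simp⟩
  exact ⟨w, hw, fun w' hw' => (add_le_add_left (fidelity_le_splitEnergy _ f hv) _).trans
    (hle.trans (iInf₂_le w' hw'))⟩

end Existence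

/-! ### Uniqueness of the fidelity -/

section Uniqueness

variable {Ω : Set E3} {p : ℝ≥0∞}

/-- If the divergence is affine along the segment from `g` to `g'`, it takes the same value at
both ends: `g = g'` where `v > 0`, and where `v = 0` the integrand is `g`, respectively `g'`,
which contribute the same mass. -/
theorem klDivergence_eq_of_midpoint {v g g' : E3 → ℝ} (h : klDivergence Ω v g ≠ ∞)
    (h' : klDivergence Ω v g' ≠ ∞)
    (hmid : 2⁻¹ * (klDivergence Ω v g + klDivergence Ω v g') ≤
      klDivergence Ω v fun x => 2⁻¹ * (g x + g' x)) :
    klDivergence Ω v g = klDivergence Ω v g' := by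
  obtain ⟨⟨hv0, hg0, hv1, hg1⟩, heq⟩ := klDivergence_ne_top h
  obtain ⟨⟨-, hg0', -, hg1'⟩, heq'⟩ := klDivergence_ne_top h'
  have hvm := (integrable_of_integral_eq_one hv1).aestronglyMeasurable.aemeasurable
  have hgi := integrable_of_integral_eq_one hg1
  have hgi' := integrable_of_integral_eq_one hg1'
  have hgm := hgi.aestronglyMeasurable.aemeasurable
  have hgm' := hgi'.aestronglyMeasurable.aemeasurable
  have hk : ∀ {w : E3 → ℝ}, AEMeasurable w (volOn Ω) →
      AEMeasurable (fun x => klIntegrand (v x) (w x)) (volOn Ω) := fun hw =>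
    measurable_klIntegrand.comp_aemeasurable (hvm.prodMk hw)
  have hmm : AEMeasurable (fun x => 2⁻¹ * (g x + g' x)) (volOn Ω) := (hgm.add hgm').const_mul _
  have hle : ∀ᵐ x ∂(volOn Ω), klIntegrand (v x) (2⁻¹ * (g x + g' x)) ≤
      2⁻¹ * (klIntegrand (v x) (g x) + klIntegrand (v x) (g' x)) := by
    filter_upwards [hv0, hg0, hg0'] with x h1 h2 h3
    have h4 := klIntegrand_midpoint_le h1 h1 h2 h3
    rwa [← two_mul, ← mul_assoc, inv_mul_cancel₀ (two_ne_zero' ℝ), one_mul] at h4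
  have hsum : ∫⁻ x, 2⁻¹ * (klIntegrand (v x) (g x) + klIntegrand (v x) (g' x)) ∂(volOn Ω) =
      2⁻¹ * (klDivergence Ω v g + klDivergence Ω v g') := by
    rw [lintegral_const_mul' _ _ (by simp), lintegral_add_left' (hk hgm), heq, heq']
  have hmidtop : 2⁻¹ * (klDivergence Ω v g + klDivergence Ω v g') ≠ ∞ :=
    ENNReal.mul_ne_top (by simp) (ENNReal.add_ne_top.2 ⟨h, h'⟩)
  have hle2 : klDivergence Ω v (fun x => 2⁻¹ * (g x + g' x)) =
      ∫⁻ x, klIntegrand (v x) (2⁻¹ * (g x + g' x)) ∂(volOn Ω) := by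
    refine (klDivergence_ne_top (ne_top_of_le_ne_top hmidtop ?_)).2
    have h1 := klDivergence_midpoint_le (v' := v) (g' := g') hvm hgm
    refine le_trans (le_of_eq (klDivergence_congr (Eventually.of_forall fun x => ?_)
      (ae_eq_refl _))) h1
    ring
  have hae := ae_eq_of_ae_le_of_lintegral_le hle (hle2 ▸ ne_top_of_le_ne_top hmidtop
    (hle2 ▸ (lintegral_mono_ae hle).trans_eq hsum))
    (((hk hgm).add (hk hgm')).const_mul _) (hsum.trans_le (hle2 ▸ hmid))
  have hfin := ae_lt_top' (hk hgm) (heq ▸ h)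
  have hfin' := ae_lt_top' (hk hgm') (heq' ▸ h')
  have hone : ∀ {w : E3 → ℝ}, Integrable w (volOn Ω) → 0 ≤ᵐ[volOn Ω] w →
      ∫ x, w x ∂(volOn Ω) = 1 → ∫⁻ x, ENNReal.ofReal (w x) ∂(volOn Ω) = 1 := fun hw hw0 hw1 => by
    rw [← ofReal_integral_eq_lintegral_ofReal hw hw0, hw1, ENNReal.ofReal_one]
  -- exchanging the masses makes the two integrands agree also where `v = 0`
  have hex : ∫⁻ x, (klIntegrand (v x) (g x) + ENNReal.ofReal (g' x)) ∂(volOn Ω) =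
      ∫⁻ x, (klIntegrand (v x) (g' x) + ENNReal.ofReal (g x)) ∂(volOn Ω) := by
    refine lintegral_congr_ae ?_
    filter_upwards [hae, hfin, hfin', hv0, hg0, hg0'] with x h1 h2 h3 h4 h5 h6
    rcases h4.eq_or_lt with h7 | h7
    · simp only [Pi.zero_apply] at h7
      rw [← h7, klIntegrand_zero_left, klIntegrand_zero_left, add_comm]
    · rw [eq_of_klIntegrand_midpoint h7 h5 h6 h2.ne h3.ne h1.ge]
  rw [lintegral_add_left' (hk hgm), lintegral_add_left' (hk hgm'), hone hgi hg0 hg1,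
    hone hgi' hg0' hg1', ← heq, ← heq'] at hex
  exact (ENNReal.add_left_inj ENNReal.one_ne_top).1 hex

variable [Fact (1 ≤ p)]

/-- All regularised solutions for one parameter have the same fidelity. The inner minimisers `v`
agree by strict convexity of the squared norm, and then `D_KL(v, ·)` is affine on the segment
between the two images. -/
theorem fidelity_eq_of_isRegularisedSolution (K : LightSheetKernels)
    (hΩ : IsBoundedLipschitzDomain Ω) (hp : 1 < p) (hp' : p < 3 / 2) {v₀ : Lp ℝ p (volOn Ω)}
    (hv₀ : ∫ x, forwardOperator K hΩ v₀ x ∂(volOn Ω) ≠ 0) {f : Lp ℝ 2 (volOn Ω)} {β : ℝ}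
    (hβ : 0 < β) {u u' : Lp ℝ p (volOn Ω)}
    (hu : IsRegularisedSolution (forwardOperator K hΩ) f β u)
    (hu' : IsRegularisedSolution (forwardOperator K hΩ) f β u')
    (hfin : fidelity (forwardOperator K hΩ u) f + ENNReal.ofReal β * totalVariation u ≠ ∞) :
    fidelity (forwardOperator K hΩ u) f = fidelity (forwardOperator K hΩ u') f := by
  set L := forwardOperator (p := p) K hΩ with hL
  have hE := (hu.2 u' hu'.1).antisymm (hu'.2 u hu.1)
  have hTtop : ∀ {w : Lp ℝ p (volOn Ω)},
      fidelity (L w) f + ENNReal.ofReal β * totalVariation w ≠ ∞ → totalVariation w ≠ ∞ :=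
    fun h htop => h (by rw [htop, ENNReal.mul_top (ENNReal.ofReal_pos.2 hβ).ne', add_top])
  have hT := hTtop hfin
  have hT' := hTtop (hE ▸ hfin)
  have hF := (ENNReal.add_ne_top.1 hfin).1
  have hF' := (ENNReal.add_ne_top.1 (hE ▸ hfin)).1
  obtain ⟨v, hv0, hv⟩ := exists_splitEnergy_eq_fidelity K hΩ hp hp' hv₀ f hu.1 hT hF
  obtain ⟨v', hv0', hv'⟩ := exists_splitEnergy_eq_fidelity K hΩ hp hp' hv₀ f hu'.1 hT' hF'
  rw [← hL] at hv hv'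
  have hmidE : fidelity (L u) f + ENNReal.ofReal β * totalVariation u ≤
      splitEnergy (L ((2⁻¹ : ℝ) • (u + u'))) f ((2⁻¹ : ℝ) • (v + v')) +
        2⁻¹ * (ENNReal.ofReal β * totalVariation u + ENNReal.ofReal β * totalVariation u') := by
    refine (hu.2 _ (nonneg_midpoint hu.1 hu'.1)).trans (add_le_add
      (fidelity_le_splitEnergy _ f (nonneg_midpoint hv0 hv0')) ?_)
    refine (mul_le_mul_right (totalVariation_midpoint_le hΩ u u') _).trans_eq ?_
    ring
  have havg : fidelity (L u) f + ENNReal.ofReal β * totalVariation u =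
      2⁻¹ * (splitEnergy (L u) f v + splitEnergy (L u') f v') +
        2⁻¹ * (ENNReal.ofReal β * totalVariation u + ENNReal.ofReal β * totalVariation u') := by
    rw [hv, hv', ← mul_add, add_add_add_comm, ← hE, half_add_self]
  have hTVfin : 2⁻¹ * (ENNReal.ofReal β * totalVariation u +
      ENNReal.ofReal β * totalVariation u') ≠ ∞ :=
    ENNReal.mul_ne_top (by simp) (ENNReal.add_ne_top.2
      ⟨ENNReal.mul_ne_top ENNReal.ofReal_ne_top hT, ENNReal.mul_ne_top ENNReal.ofReal_ne_top hT'⟩)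
  rw [havg, ENNReal.add_le_add_iff_right hTVfin] at hmidE
  have hgap := splitEnergy_forwardOperator_midpoint_add_le K hΩ f v v' u u'
  have hsfin : splitEnergy (L ((2⁻¹ : ℝ) • (u + u'))) f ((2⁻¹ : ℝ) • (v + v')) ≠ ∞ := by
    refine ne_top_of_le_ne_top ?_ (le_self_add.trans hgap)
    rw [← hL, hv, hv']
    exact ENNReal.mul_ne_top (by simp) (ENNReal.add_ne_top.2 ⟨hF, hF'⟩)
  obtain rfl : v = v' := by
    have h1 := hgap.trans hmidE
    rw [← hL] at h1
    have h2 := (ENNReal.add_le_add_iff_left (c := 0) hsfin).1 (h1.trans_eq (add_zero _).symm)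
    have h3 := ENNReal.ofReal_eq_zero.1 (nonpos_iff_eq_zero.1 h2)
    have h4 : ‖v - v'‖ = 0 := by nlinarith [norm_nonneg (v - v'), sq_nonneg ‖v - v'‖]
    exact sub_eq_zero.1 (norm_eq_zero.1 h4)
  have hvv : (2⁻¹ : ℝ) • (v + v) = v := by module
  rw [hvv] at hmidE
  rw [← hv, ← hv']
  simp only [splitEnergy] at hmidE hv hv' ⊢
  have hkl := (ENNReal.add_ne_top.1 (hv ▸ hF)).2
  have hkl' := (ENNReal.add_ne_top.1 (hv' ▸ hF')).2
  rw [add_add_add_comm, mul_add, half_add_self,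
    ENNReal.add_le_add_iff_left ENNReal.ofReal_ne_top,
    klDivergence_congr (ae_eq_refl (v : E3 → ℝ)) (forwardOperator_midpoint_ae K hΩ u u')] at hmidE
  rw [klDivergence_eq_of_midpoint hkl hkl' hmidE]

end Uniqueness

/-! ### The discrepancy principle and the convergence rate -/

section Rates

variable {Ω : Set E3}

/-- The fidelity dominates the square of the `L¹` distance, up to a constant. -/
theorem exists_integral_abs_sub_le_of_fidelity_le (hΩ : IsBoundedLipschitzDomain Ω) :
    ∃ C, 0 ≤ C ∧ ∀ (g f : Lp ℝ 2 (volOn Ω)) (k : ℝ), 0 < k → fidelity g f ≤ ENNReal.ofReal k →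
      ∫ x, |f x - g x| ∂(volOn Ω) ≤ C * √k := by
  obtain ⟨c, hc0, hc⟩ := exists_integral_norm_le (p := 2) hΩ
  refine ⟨2 * c + 4, by positivity, fun g f k hk h => ?_⟩
  obtain ⟨v, -, hv⟩ := exists_splitEnergy_lt (h.trans_lt
    ((ENNReal.ofReal_lt_ofReal_iff (by positivity)).2 (by linarith : k < 2 * k)))
  have hvn := norm_le_of_splitEnergy_le (by positivity) hv.le
  have hvk := integral_abs_sub_le_of_klDivergence_le (by positivity) (le_add_self.trans hv.le)
  have h4 : √(2 * (2 * k)) = 2 * √k := by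
    rw [show 2 * (2 * k) = 2 ^ 2 * k by ring, Real.sqrt_mul (by norm_num),
      Real.sqrt_sq (by norm_num)]
  have h2 : √(2 * k) ≤ 2 * √k := by
    rw [← h4]
    exact Real.sqrt_le_sqrt (by linarith)
  rw [h4] at hvn
  have hint : ∀ a b : Lp ℝ 2 (volOn Ω), Integrable (fun x => |a x - b x|) (volOn Ω) := fun a b =>
    ((integrable_of_Lp hΩ a).sub (integrable_of_Lp hΩ b)).abs
  have hfv : ∫ x, |f x - v x| ∂(volOn Ω) ≤ c * ‖f - v‖ := by
    refine le_trans (le_of_eq (integral_congr_ae ?_)) (hc (f - v))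
    filter_upwards [Lp.coeFn_sub f v] with x hx
    rw [hx, Pi.sub_apply, Real.norm_eq_abs]
  calc ∫ x, |f x - g x| ∂(volOn Ω)
      ≤ ∫ x, (|f x - v x| + |v x - g x|) ∂(volOn Ω) :=
        integral_mono (hint f g) ((hint f v).add (hint v g)) fun x => abs_sub_le _ _ _
    _ = ∫ x, |f x - v x| ∂(volOn Ω) + ∫ x, |v x - g x| ∂(volOn Ω) :=
        integral_add (hint f v) (hint v g)
    _ ≤ c * (2 * √k) + 2 * (2 * √k) :=
        add_le_add (hfv.trans (mul_le_mul_of_nonneg_left hvn hc0))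
          (hvk.trans (mul_le_mul_of_nonneg_left h2 (by norm_num)))
    _ = (2 * c + 4) * √k := by ring

variable {p : ℝ≥0∞} [Fact (1 ≤ p)]

theorem abs_adjointApply_le (hΩ : IsBoundedLipschitzDomain Ω)
    (L : Lp ℝ p (volOn Ω) →L[ℝ] Lp ℝ 2 (volOn Ω)) (m : Lp ℝ ∞ (volOn Ω)) (u w : Lp ℝ p (volOn Ω)) :
    |adjointApply hΩ L m (u - w)| ≤ ‖m‖ * ∫ x, |L u x - L w x| ∂(volOn Ω) := by
  rw [adjointApply_apply, ← Real.norm_eq_abs, ← integral_const_mul]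
  refine norm_integral_le_of_norm_le
    (((integrable_of_Lp hΩ (L u)).sub (integrable_of_Lp hΩ (L w))).abs.const_mul _) ?_
  have hm : ∀ᵐ x ∂(volOn Ω), ‖m x‖ ≤ ‖m‖ := by
    filter_upwards [ae_le_eLpNormEssSup (f := m) (μ := volOn Ω)] with x hx
    rw [Lp.norm_def, eLpNorm_exponent_top, ← toReal_enorm]
    exact ENNReal.toReal_mono
      (eLpNorm_exponent_top (f := m) (μ := volOn Ω) ▸ Lp.eLpNorm_ne_top m) hx
  rw [map_sub]
  filter_upwards [hm, Lp.coeFn_sub (L u) (L w)] with x h1 h2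
  rw [norm_mul, h2, Pi.sub_apply, Real.norm_eq_abs (L u x - L w x)]
  exact mul_le_mul_of_nonneg_right h1 (abs_nonneg _)

/-- The dual pairing in the Bregman distance is controlled by the fidelities of the two images
with respect to the same data. -/
theorem exists_abs_adjointApply_le (hΩ : IsBoundedLipschitzDomain Ω)
    (L : Lp ℝ p (volOn Ω) →L[ℝ] Lp ℝ 2 (volOn Ω)) (m : Lp ℝ ∞ (volOn Ω)) :
    ∃ B, 0 ≤ B ∧ ∀ (u w : Lp ℝ p (volOn Ω)) (f : Lp ℝ 2 (volOn Ω)) (k k' : ℝ), 0 < k → 0 < k' →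
      fidelity (L u) f ≤ ENNReal.ofReal k → fidelity (L w) f ≤ ENNReal.ofReal k' →
      |adjointApply hΩ L m (u - w)| ≤ B * (√k + √k') := by
  obtain ⟨C, hC0, hC⟩ := exists_integral_abs_sub_le_of_fidelity_le hΩ
  refine ⟨‖m‖ * C, by positivity, fun u w f k k' hk hk' h h' => ?_⟩
  refine (abs_adjointApply_le hΩ L m u w).trans ?_
  rw [mul_assoc]
  refine mul_le_mul_of_nonneg_left ?_ (norm_nonneg _)
  have hint : ∀ a b : Lp ℝ 2 (volOn Ω), Integrable (fun x => |a x - b x|) (volOn Ω) := fun a b =>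
    ((integrable_of_Lp hΩ a).sub (integrable_of_Lp hΩ b)).abs
  calc ∫ x, |L u x - L w x| ∂(volOn Ω)
      ≤ ∫ x, (|f x - L u x| + |f x - L w x|) ∂(volOn Ω) :=
        integral_mono (hint _ _) ((hint f (L u)).add (hint f (L w))) fun x => by
          have := abs_sub_le (L u x) (f x) (L w x)
          rwa [abs_sub_comm (L u x) (f x)] at this
    _ = ∫ x, |f x - L u x| ∂(volOn Ω) + ∫ x, |f x - L w x| ∂(volOn Ω) :=
        integral_add (hint _ _) (hint _ _)
    _ ≤ C * (√k + √k') := by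
        rw [mul_add]
        exact add_le_add (hC _ _ k hk h) (hC _ _ k' hk' h')

/-- The inequalities satisfied by a regularised solution `u` in terms of its (finite) fidelity `φ`
and total variation `T`: minimality against the true solution, and the subgradient inequality. -/
theorem IsRegularisedSolution.exists_real {L : Lp ℝ p (volOn Ω) →L[ℝ] Lp ℝ 2 (volOn Ω)}
    {f : Lp ℝ 2 (volOn Ω)} {β δ : ℝ} {u w : Lp ℝ p (volOn Ω)} {q : StrongDual ℝ (Lp ℝ p (volOn Ω))}
    (hu : IsRegularisedSolution L f β u) (hβ : 0 < β) (hδ : 0 ≤ δ) (hw : 0 ≤ w)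
    (hwf : fidelity (L w) f ≤ ENNReal.ofReal δ) (hq : q ∈ subdifferential totalVariation w) :
    ∃ φ T : ℝ, 0 ≤ φ ∧ 0 ≤ T ∧ fidelity (L u) f = ENNReal.ofReal φ ∧
      totalVariation u = ENNReal.ofReal T ∧ φ + β * T ≤ δ + β * (totalVariation w).toReal ∧
      (totalVariation w).toReal + q (u - w) ≤ T := by
  obtain ⟨hTw, hsub⟩ := hq
  have h1 : fidelity (L u) f + ENNReal.ofReal β * totalVariation u ≤
      ENNReal.ofReal (δ + β * (totalVariation w).toReal) := by
    refine (hu.2 w hw).trans ?_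
    rw [ENNReal.ofReal_add hδ (by positivity), ENNReal.ofReal_mul hβ.le, ENNReal.ofReal_toReal hTw]
    exact add_le_add_left hwf _
  have hfin := ne_top_of_le_ne_top ENNReal.ofReal_ne_top h1
  have hF := (ENNReal.add_ne_top.1 hfin).1
  have hT : totalVariation u ≠ ∞ := fun htop => hfin (by
    rw [htop, ENNReal.mul_top (ENNReal.ofReal_pos.2 hβ).ne', add_top])
  refine ⟨(fidelity (L u) f).toReal, (totalVariation u).toReal, ENNReal.toReal_nonneg,
    ENNReal.toReal_nonneg, (ENNReal.ofReal_toReal hF).symm, (ENNReal.ofReal_toReal hT).symm, ?_, ?_⟩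
  · have := ENNReal.toReal_le_of_le_ofReal (by positivity) h1
    rwa [ENNReal.toReal_add hF (ENNReal.mul_ne_top ENNReal.ofReal_ne_top hT), ENNReal.toReal_mul,
      ENNReal.toReal_ofReal hβ.le] at this
  · have := hsub u
    rw [← EReal.coe_ennreal_toReal hTw, ← EReal.coe_ennreal_toReal hT] at this
    exact_mod_cast this

/-- For parameters below a multiple of `√δ` the discrepancy stays below `τ δ`: this bounds the
parameter of the discrepancy principle from below. -/
theorem discrepancy_le_of_le_sqrt {B τ δ β φ T T₀ q : ℝ} (hB : 0 ≤ B) (hτ : 1 < τ) (hδ : 0 < δ)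
    (hβ0 : 0 < β) (hβ : β ≤ (1 - 1 / τ) / (2 * (B + 1)) * √δ)
    (hq : ∀ k, 0 < k → φ ≤ k → |q| ≤ B * (√k + √δ))
    (h1 : φ + β * T ≤ δ + β * T₀) (h2 : T₀ + q ≤ T) : φ ≤ τ * δ := by
  by_contra! hlt
  have hδφ : δ ≤ φ := le_of_lt (lt_of_le_of_lt (by nlinarith) hlt)
  have hφ : 0 < φ := hδ.trans_le hδφ
  have hs : √δ ≤ √φ := Real.sqrt_le_sqrt hδφ
  have hs0 : 0 ≤ √φ := Real.sqrt_nonneg φ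
  have hsq : √φ * √φ = φ := Real.mul_self_sqrt hφ.le
  have hτ' : 0 < 1 - 1 / τ := by
    rw [sub_pos, div_lt_one (by linarith)]
    exact hτ
  have hq' : |q| ≤ 2 * B * √φ := (hq φ hφ le_rfl).trans (by nlinarith)
  have h3 : φ ≤ δ + β * (2 * B * √φ) := by
    have h4 : β * (-q) ≤ β * (2 * B * √φ) :=
      mul_le_mul_of_nonneg_left ((neg_le_abs q).trans hq') hβ0.le
    nlinarith
  have h4 : β * (2 * B * √φ) ≤ (1 - 1 / τ) * φ := by
    have h5 : β * (2 * (B + 1)) ≤ (1 - 1 / τ) * √φ := by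
      rw [div_mul_eq_mul_div, le_div_iff₀ (by positivity)] at hβ
      exact hβ.trans (mul_le_mul_of_nonneg_left hs hτ'.le)
    have h6 : β * (2 * B) ≤ (1 - 1 / τ) * √φ := le_trans (by nlinarith) h5
    have h7 := mul_le_mul_of_nonneg_right h6 hs0
    nlinarith
  have h5 : φ * (1 / τ) ≤ δ := by linarith
  rw [mul_one_div, div_le_iff₀ (by linarith)] at h5
  linarith

/-- The supremum in the discrepancy principle is attained: limits of regularised solutions for
`β ↑ α` are regularised solutions for `α`, and all of these have the same fidelity. -/
theorem fidelity_le_of_isDiscrepancyParameter (K : LightSheetKernels)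
    (hΩ : IsBoundedLipschitzDomain Ω) (hp : 1 < p) (hp' : p < 3 / 2) {w : Lp ℝ p (volOn Ω)}
    (hLw : ∫ x, forwardOperator K hΩ w x ∂(volOn Ω) ≠ 0) (hw : 0 ≤ w)
    {f : Lp ℝ 2 (volOn Ω)} {q : StrongDual ℝ (Lp ℝ p (volOn Ω))}
    (hq : q ∈ subdifferential totalVariation w) {δ t α : ℝ} (hδ : 0 ≤ δ)
    (hwf : fidelity (forwardOperator K hΩ w) f ≤ ENNReal.ofReal δ) (hα0 : 0 < α)
    (hα : IsDiscrepancyParameter (forwardOperator (p := p) K hΩ) f t α) {u : Lp ℝ p (volOn Ω)}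
    (hu : IsRegularisedSolution (forwardOperator K hΩ) f α u) :
    fidelity (forwardOperator K hΩ u) f ≤ ENNReal.ofReal t := by
  set L := forwardOperator (p := p) K hΩ with hL
  obtain ⟨φ, T, hφ0, hT0, hφ, hT, -, -⟩ := hu.exists_real hα0 hδ hw hwf hq
  have hfin : fidelity (L u) f + ENNReal.ofReal α * totalVariation u ≠ ∞ := by
    rw [hφ, hT]
    exact ENNReal.add_ne_top.2 ⟨ENNReal.ofReal_ne_top,
      ENNReal.mul_ne_top ENNReal.ofReal_ne_top ENNReal.ofReal_ne_top⟩
  -- a bound for the total variation of the solutions with parameter at least `α / 2`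
  set M : ℝ := 2 * δ / α + (totalVariation w).toReal with hM
  have hM0 : 0 ≤ M := by positivity
  -- solutions with parameters `β ↑ α` nearly minimise the energy for `α`, at fidelity at most `t`
  obtain ⟨u', -, v, hu', hv, hle, hle'⟩ := exists_splitEnergy_le K hΩ hp hp' hLw (A := Set.univ)
    (m := fidelity (L u) f + ENNReal.ofReal α * totalVariation u) (t := ENNReal.ofReal t)
    (fun _ _ _ _ => trivial) (fun _ _ _ _ => trivial) f hα0 hfin fun ε hε => by
      have hlt : max (α / 2) (α - ε / (M + 1)) < α := by
        have : 0 < ε / (M + 1) := by positivity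
        exact max_lt (by linarith) (by linarith)
      obtain ⟨β, ⟨hβ0, z, hz, hzt⟩, hβ, hβα⟩ := hα.exists_between hlt
      obtain ⟨hβ1, hβ2⟩ := max_lt_iff.1 hβ
      obtain ⟨φz, Tz, hφz0, hTz0, hφz, hTz, h1, -⟩ := hz.exists_real hβ0 hδ hw hwf hq
      refine ⟨z, trivial, hz.1, ?_, hzt.trans le_self_add⟩
      have hTzM : Tz ≤ M := by
        have h2 : Tz ≤ δ / β + (totalVariation w).toReal := by
          rw [← sub_le_iff_le_add, le_div_iff₀ hβ0]
          linarith
        have h3 : δ / β ≤ 2 * δ / α := by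
          rw [div_le_div_iff₀ hβ0 hα0]
          nlinarith
        linarith
      have h4 : (α - β) * Tz ≤ ε := by
        have h5 : (α - β) * (M + 1) ≤ ε := by
          rw [← le_div_iff₀ (by positivity)]
          linarith
        have h6 : 0 ≤ α - β := by linarith
        nlinarith
      have h5 := hz.2 u hu.1
      rw [hφz, hTz, hφ, hT, ← ENNReal.ofReal_mul hβ0.le, ← ENNReal.ofReal_mul hβ0.le,
        ← ENNReal.ofReal_add hφz0 (by positivity), ← ENNReal.ofReal_add hφ0 (by positivity),
        ENNReal.ofReal_le_ofReal_iff (by positivity)] at h5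
      rw [hφz, hTz, hφ, hT, ← ENNReal.ofReal_mul hα0.le, ← ENNReal.ofReal_mul hα0.le,
        ← ENNReal.ofReal_add hφz0 (by positivity), ← ENNReal.ofReal_add hφ0 (by positivity),
        ← ENNReal.ofReal_add (by positivity) hε.le]
      refine ENNReal.ofReal_le_ofReal ?_
      have h6 : β * T ≤ α * T := mul_le_mul_of_nonneg_right hβα hT0
      nlinarith
  have hF := fidelity_le_splitEnergy (L u') f hv
  have hureg : IsRegularisedSolution L f α u' :=
    ⟨hu', fun z hz => (add_le_add_left hF _).trans (hle.trans (hu.2 z hz))⟩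
  rw [fidelity_eq_of_isRegularisedSolution K hΩ hp hp' hLw hα0 hu hureg hfin]
  exact hF.trans hle'

end Rates

theorem mainTheorem2
    (Ω : Set E3) (hΩ : IsBoundedLipschitzDomain Ω)
    (p : ℝ≥0∞) [Fact (1 ≤ p)] (hp_gt : 1 < p) (hp_lt : p < 3 / 2)
    (K : LightSheetKernels)
    (fbar : Lp ℝ 2 (volOn Ω)) (hfbar : ∫ x, fbar x ∂(volOn Ω) = 1)
    (udag : Lp ℝ p (volOn Ω))
    (hudag : IsTVMinimisingSolution (forwardOperator K hΩ) fbar udag) (hudag_nonneg : 0 ≤ udag)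
    (mdag : Lp ℝ ∞ (volOn Ω))
    (hsource : adjointApply hΩ (forwardOperator K hΩ) mdag ∈ subdifferential totalVariation udag)
    (τ : ℝ) (hτ : 1 < τ) :
    ∃ C : ℝ, ∀ σ γ : ℝ, 0 < σ → 0 < γ →
      ∀ f : Lp ℝ 2 (volOn Ω), fidelity fbar f ≤ ENNReal.ofReal (σ ^ 2 / 2 + γ) →
      ∀ α : ℝ, IsDiscrepancyParameter (forwardOperator (p := p) K hΩ) f
        (τ * (σ ^ 2 / 2 + γ)) α →
      ∀ u : Lp ℝ p (volOn Ω), IsRegularisedSolution (forwardOperator K hΩ) f α u →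
        bregmanDist totalVariation (adjointApply hΩ (forwardOperator K hΩ) mdag) u udag ≤
          ((C * (σ + Real.sqrt γ) : ℝ) : EReal) := by
  set L := forwardOperator (p := p) K hΩ with hL
  obtain ⟨rfl, -⟩ := hudag
  have hLne : ∫ x, L udag x ∂(volOn Ω) ≠ 0 := by rw [hfbar]; exact one_ne_zero
  obtain ⟨B, hB0, hB⟩ := exists_abs_adjointApply_le hΩ L mdag
  -- chosen such that the pairing with the source element, at most `2 B √φ` in absolute value,
  -- is absorbed: `2 B c ≤ 1 - 1 / τ`
  set c : ℝ := (1 - 1 / τ) / (2 * (B + 1)) with hc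
  have hc0 : 0 < c := by
    have : 0 < 1 - 1 / τ := by
      rw [sub_pos, div_lt_one (by linarith)]
      exact hτ
    positivity
  refine ⟨1 / c + B * (√τ + 1), fun σ γ hσ hγ f hf α hα u hu => ?_⟩
  set δ : ℝ := σ ^ 2 / 2 + γ with hδ
  have hδ0 : 0 < δ := by positivity
  have hs0 : 0 < √δ := Real.sqrt_pos.2 hδ0
  -- the parameter `c √δ` is admissible, so that `α` is not smaller
  have hcα : c * √δ ≤ α := by
    have hβ : 0 < c * √δ := by positivity
    obtain ⟨w, hw⟩ := exists_isRegularisedSolution K hΩ hp_gt hp_lt hLne f hudag_nonneg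
      hsource.1 (ne_top_of_le_ne_top ENNReal.ofReal_ne_top hf) hβ
    obtain ⟨φ, T, hφ0, hT0, hφ, hT, h1, h2⟩ :=
      hw.exists_real hβ hδ0.le hudag_nonneg hf hsource
    refine hα.1 ⟨hβ, w, hw, ?_⟩
    refine hφ.trans_le (ENNReal.ofReal_le_ofReal ?_)
    exact (discrepancy_le_of_le_sqrt hB0 hτ hδ0 hβ le_rfl
      (fun k hk hφk => hB w udag f k δ hk hδ0 (hφ.trans_le (ENNReal.ofReal_le_ofReal hφk)) hf)
      h1 h2)
  have hα0 : 0 < α := lt_of_lt_of_le (by positivity) hcα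
  have hFu := fidelity_le_of_isDiscrepancyParameter K hΩ hp_gt hp_lt hLne hudag_nonneg hsource
    hδ0.le hf hα0 hα hu
  obtain ⟨φ, T, hφ0, hT0, hφ, hT, h1, -⟩ := hu.exists_real hα0 hδ0.le hudag_nonneg hf hsource
  have hq := hB u udag f (τ * δ) δ (by positivity) hδ0 hFu hf
  rw [bregmanDist, ← EReal.coe_ennreal_toReal hsource.1, hT, EReal.coe_ennreal_ofReal,
    max_eq_left hT0]
  have hTd : T - (totalVariation udag).toReal ≤ 1 / c * √δ := by
    have h3 : α * (T - (totalVariation udag).toReal) ≤ √δ * √δ := by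
      rw [Real.mul_self_sqrt hδ0.le]
      linarith
    rw [one_div_mul_eq_div, le_div_iff₀ hc0]
    by_contra! h4
    have h5 : 0 < T - (totalVariation udag).toReal := by
      by_contra! h6
      nlinarith
    nlinarith [mul_le_mul_of_nonneg_right hcα h5.le]
  have hsδ : √δ ≤ σ + √γ := by
    refine Real.sqrt_le_iff.2 ⟨by positivity, ?_⟩
    have h3 := Real.sq_sqrt hγ.le
    have h4 := Real.sqrt_nonneg γ
    nlinarith [mul_nonneg hσ.le h4]
  rw [Real.sqrt_mul (by linarith)] at hq
  have hfinal : T - (totalVariation udag).toReal - adjointApply hΩ L mdag (u - udag) ≤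
      (1 / c + B * (√τ + 1)) * (σ + √γ) := by
    have h3 := (neg_le_abs _).trans hq
    have h4 : 0 ≤ 1 / c + B * (√τ + 1) := by positivity
    refine le_trans ?_ (mul_le_mul_of_nonneg_left hsδ h4)
    linarith
  exact_mod_cast hfinal
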